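/- Let $M$ be a smooth compact connected (Hausdorff) $n$-dimensional manifold, $n\ge 1$, with non-empty smooth boundary $\partial M$, and let $F\colon TM\to[0,\infty)$ be a Finsler function: $F$ is smooth on $TM\setminus 0$, and for every $x\in M$ the restriction $F\colon T_xM\to[0,\infty)$ is a Minkowski norm, i.e. $F(sy)=sF(y)$ for $s>0$, and for every $y\neq 0$ the bilinear form $g_y(v,w)=\frac12\,\partial_s\partial_t\big[F^2(y+sv+tw)\big]\big|_{s=t=0}$ on $T_xM$ is symmetric and positive definite (it is not assumed that $F(-y)=F(y)$). Let $d_F(x_1,x_2)$ be the (in general non-symmetric) distance, i.e. the infimum of the lengths $\int F(\dot c(t))\,dt$ over all piecewise smooth curves $c$ in $M$ from $x_1$ to $x_2$. For $x\in M$ let $r_x\colon\partial M\to[0,\infty)$, $r_x(z)=d_F(x,z)$. Then every $r_x$ is continuous, and the map $\mathcal R\colon M\to C(\partial M)$, $\mathcal R(x)=r_x$, is a topological embedding, where $C(\partial M)$ carries the topology of the sup norm. Moreover $\mathcal R$ is Lipschitz: there is a constant $L>0$, depending only on $(M,F)$, such that $\|r_{x_1}-r_{x_2}\|_\infty\le L\,d_F(x_1,x_2)$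 for all $x_1,x_2\in M$. -/

import Mathlib

open Set MeasureTheory Topology
open scoped Manifold ContDiff

/-- The fundamental form of a function `f` on a real vector space `V`:
`g_y(v, w) = (1/2) ∂_s ∂_t [f²(y + s v + t w)]` at `s = t = 0`. -/
noncomputable def fundamentalForm {V : Type*} [NormedAddCommGroup V] [NormedSpace ℝ V]
    (f : V → ℝ) (y v w : V) : ℝ :=
  (1 / 2) * deriv (fun s : ℝ => deriv (fun t : ℝ => f (y + s • v + t • w) ^ 2) 0) 0

/-- Minkowski norms. For `y ≠ 0` the form `g_y` is half the Hessian of `f²` at `y`, so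
`smooth` makes it bilinear and symmetric; `posDef` says that it is positive definite. -/
structure IsMinkowskiNorm {V : Type*} [NormedAddCommGroup V] [NormedSpace ℝ V]
    (f : V → ℝ) : Prop where
  nonneg : ∀ y, 0 ≤ f y
  smooth : ContDiffOn ℝ ∞ f {y | y ≠ 0}
  homogeneous : ∀ (y : V) (s : ℝ), 0 < s → f (s • y) = s * f y
  posDef : ∀ y : V, y ≠ 0 → ∀ v : V, v ≠ 0 → 0 < fundamentalForm f y v v

/-- A Finsler function on an `n`-dimensional smooth manifold with boundary `M`: a function
`F : TM → [0, ∞)` that is smooth on `TM` minus the zero section (up to the boundary of `M`) and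
restricts to a Minkowski norm on every tangent space. It need not be reversible. -/
structure FinslerFunction (n : ℕ) [NeZero n] (M : Type*) [TopologicalSpace M]
    [ChartedSpace (EuclideanHalfSpace n) M] [IsManifold (𝓡∂ n) ∞ M] where
  toFun : TangentBundle (𝓡∂ n) M → ℝ
  smooth : ContMDiffOn (𝓡∂ n).tangent 𝓘(ℝ, ℝ) ∞ toFun {v | v.2 ≠ 0}
  isMinkowskiNorm : ∀ x : M,
    IsMinkowskiNorm (V := EuclideanSpace ℝ (Fin n)) (fun y => toFun ⟨x, y⟩)

/-- `γ` restricted to `[a, b]` is a piecewise smooth curve in `M`: it is continuous and there is a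
finite partition `a = t 0 ≤ ⋯ ≤ t k = b` such that `γ` is smooth on every closed interval
`[t i, t (i + 1)]`. -/
def IsPiecewiseSmoothCurve (n : ℕ) [NeZero n] {M : Type*} [TopologicalSpace M]
    [ChartedSpace (EuclideanHalfSpace n) M] (γ : ℝ → M) (a b : ℝ) : Prop :=
  ContinuousOn γ (Icc a b) ∧
    ∃ (k : ℕ) (t : ℕ → ℝ), Monotone t ∧ t 0 = a ∧ t k = b ∧
      ∀ i < k, ContMDiffOn 𝓘(ℝ, ℝ) (𝓡∂ n) ∞ γ (Icc (t i) (t (i + 1)))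

namespace FinslerFunction

variable {n : ℕ} [NeZero n] {M : Type*} [TopologicalSpace M]
  [ChartedSpace (EuclideanHalfSpace n) M] [IsManifold (𝓡∂ n) ∞ M]

/-- The length `∫_a^b F(γ(t), γ'(t)) dt` of the curve `γ : [a, b] → M`. For a piecewise smooth curve
the integrand is bounded, and it is continuous off the finitely many partition points. -/
noncomputable def length (F : FinslerFunction n M) (γ : ℝ → M) (a b : ℝ) : ℝ :=
  ∫ t in a..b, F.toFun ⟨γ t, mfderiv 𝓘(ℝ, ℝ) (𝓡∂ n) γ t (1 : ℝ)⟩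

/-- The (in general non-symmetric) distance `d_F(x, y)`: the infimum of the lengths of the piecewise
smooth curves from `x` to `y`. The set of lengths is bounded below by `0`, and nonempty when `M` is
connected. -/
noncomputable def dist (F : FinslerFunction n M) (x y : M) : ℝ :=
  sInf {L : ℝ | ∃ (a b : ℝ) (γ : ℝ → M), a ≤ b ∧ IsPiecewiseSmoothCurve n γ a b ∧
    γ a = x ∧ γ b = y ∧ L = F.length γ a b}

/-- The boundary distance function `r_x : ∂M → ℝ`, `r_x(z) = d_F(x, z)`. -/
noncomputable def boundaryDist (F : FinslerFunction n M) (x : M)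
    (z : (𝓡∂ n).boundary M) : ℝ :=
  F.dist x z

end FinslerFunction

/-- The boundary of a compact manifold is compact; this provides the sup norm on `C(∂M, ℝ)`. -/
instance compactSpace_manifoldBoundary {n : ℕ} [NeZero n] {M : Type*} [TopologicalSpace M]
    [ChartedSpace (EuclideanHalfSpace n) M] [IsManifold (𝓡∂ n) ∞ M] [CompactSpace M] :
    CompactSpace ((𝓡∂ n).boundary M) :=
  isCompact_iff_compactSpace.mp
    (ModelWithCorners.isClosed_boundary (I := 𝓡∂ n) (M := M) (n := ∞) (by simp)).isCompact

/-! Continuity and the Lipschitz bound are soft: both follow from the triangle inequality, once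
`exists_dist_le_mul_dist_swap` shows that on a compact manifold the distance is symmetric up to a
factor. The representation is then a continuous map from a compact space to a Hausdorff space, hence
an embedding as soon as it is injective. All the work goes into `boundaryDist_injective`.

Suppose `x₁` and `x₂` have the same boundary distance function. It attains its minimum `D` at some
boundary point `z`, which is thus a closest boundary point for both. Take minimizers from `x₁` and
`x₂` to `z`, parametrized by distance. Before time `D` they avoid the boundary, and from each of
their points `z` is still a closest boundary point. Hence both reach `z` orthogonally in the Finsler
sense: the momentum, i.e. the fibre derivative of the energy, kills the directions tangent to the
boundary. Covectors doing so form a line, and unit speed together with arrival from inside singles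
out one of them. So both curves have the same end point and the same momentum there. They therefore
coincide near `z`, by unique continuation also back to time `0`, and `x₁ = x₂`.

No regularity theory of geodesics is used. Minimizers are limits of almost shortest curves
(`exists_minimizer`) and in charts are only known to be Lipschitz. The first variation
(`integral_variation_eq_zero`) and the Du Bois-Reymond lemma give the Euler-Lagrange equation in
integrated form: the momentum agrees almost everywhere with a continuous primitive
(`exists_isMomentum`). A variation with free end gives the orthogonality (`momentum_end_eq_zero`).
Strong convexity of the energy makes the velocity a Lipschitz function of position and momentum, so
Gronwall's inequality for the gaps in position and momentum gives uniqueness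
(`eqOn_of_momentum_eq`). At the boundary the end momentum is identified in `eqOn_of_coord_pos`.

The bridge between manifold and charts is `IsLocalDist`: in coordinates the distance is
infinitesimally the Minkowski norm, which is proved by comparing with straight segments from above
and with a supporting linear form from below (`exists_abs_dist_sub_le`). -/

/-! ### Minkowski norms -/

/-- The energy `f² / 2` of a function `f`. -/
noncomputable def energy {V : Type*} (f : V → ℝ) (v : V) : ℝ := f v ^ 2 / 2

theorem hasDerivAt_line {V : Type*} [NormedAddCommGroup V] [NormedSpace ℝ V] (y u : V) (t : ℝ) :
    HasDerivAt (fun t : ℝ => y + t • u) u t := by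
  simpa using ((hasDerivAt_id t).smul_const u).const_add y

namespace IsMinkowskiNorm

variable {V : Type*} [NormedAddCommGroup V] [NormedSpace ℝ V] {f : V → ℝ}

theorem map_zero (hf : IsMinkowskiNorm f) : f 0 = 0 := by
  have := hf.homogeneous 0 2 two_pos
  rw [smul_zero] at this
  linarith

theorem contDiffAt (hf : IsMinkowskiNorm f) {y : V} (hy : y ≠ 0) : ContDiffAt ℝ ∞ f y :=
  hf.smooth.contDiffAt (isOpen_ne.mem_nhds hy)

theorem contDiffAt_energy (hf : IsMinkowskiNorm f) {y : V} (hy : y ≠ 0) :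
    ContDiffAt ℝ ∞ (energy f) y :=
  ((hf.contDiffAt hy).pow 2).div_const 2

theorem energy_smul (hf : IsMinkowskiNorm f) (y : V) {s : ℝ} (hs : 0 < s) :
    energy f (s • y) = s ^ 2 * energy f y := by
  simp only [energy, hf.homogeneous y s hs]
  ring

theorem contDiffAt_fderiv_energy (hf : IsMinkowskiNorm f) {y : V} (hy : y ≠ 0) :
    ContDiffAt ℝ ∞ (fderiv ℝ (energy f)) y :=
  (hf.contDiffAt_energy hy).fderiv_right (m := ∞) (by simp)

theorem differentiableAt_fderiv_energy (hf : IsMinkowskiNorm f) {y : V} (hy : y ≠ 0) :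
    DifferentiableAt ℝ (fderiv ℝ (energy f)) y :=
  (hf.contDiffAt_fderiv_energy hy).differentiableAt (by simp)

theorem hasDerivAt_fderiv_energy (hf : IsMinkowskiNorm f) {y u : V} {t : ℝ}
    (hy : y + t • u ≠ 0) (w : V) :
    HasDerivAt (fun t : ℝ => fderiv ℝ (energy f) (y + t • u) w)
      (fderiv ℝ (fderiv ℝ (energy f)) (y + t • u) u w) t := by
  have h1 := (hf.differentiableAt_fderiv_energy hy).hasFDerivAt.comp_hasDerivAt t
    (hasDerivAt_line y u t)
  exact (ContinuousLinearMap.apply ℝ ℝ w).hasFDerivAt.comp_hasDerivAt t h1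

/-- Replaces iterated one-variable derivatives by the second derivative of the energy, for which
bilinearity and continuity are at hand. -/
theorem fundamentalForm_eq (hf : IsMinkowskiNorm f) {y : V} (hy : y ≠ 0) (u w : V) :
    fundamentalForm f y u w = fderiv ℝ (fderiv ℝ (energy f)) y u w := by
  have h0 : ∀ᶠ s : ℝ in 𝓝 0, y + s • u ≠ 0 := by
    have : ContinuousAt (fun s : ℝ => y + s • u) 0 := by fun_prop
    exact this.eventually_ne (by simpa using hy)
  have h1 : ∀ᶠ s : ℝ in 𝓝 0, deriv (fun t : ℝ => f (y + s • u + t • w) ^ 2) 0 =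
      2 * fderiv ℝ (energy f) (y + s • u) w := by
    filter_upwards [h0] with s hs
    have hd : HasFDerivAt (energy f) (fderiv ℝ (energy f) (y + s • u))
        (y + s • u + (0 : ℝ) • w) := by
      rw [zero_smul, add_zero]
      exact ((hf.contDiffAt_energy hs).differentiableAt (by simp)).hasFDerivAt
    have h2 : HasDerivAt (fun t : ℝ => 2 * energy f (y + s • u + t • w))
        (2 * fderiv ℝ (energy f) (y + s • u) w) 0 :=
      (hd.comp_hasDerivAt (0 : ℝ) (hasDerivAt_line (y + s • u) w 0)).const_mul 2
    have h3 : (fun t : ℝ => f (y + s • u + t • w) ^ 2) =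
        fun t : ℝ => 2 * energy f (y + s • u + t • w) := by
      ext t
      simp only [energy]
      ring
    rw [h3, h2.deriv]
  rw [fundamentalForm, Filter.EventuallyEq.deriv_eq h1]
  have h2 := hf.hasDerivAt_fderiv_energy (y := y) (u := u) (t := 0) (by simpa using hy) w
  rw [(h2.const_mul 2).deriv]
  simp

variable [FiniteDimensional ℝ V]

theorem exists_le_mul_norm (hf : IsMinkowskiNorm f) : ∃ C, 0 ≤ C ∧ ∀ v, f v ≤ C * ‖v‖ := by
  have hc : ContinuousOn f (Metric.sphere 0 1) := fun y hy =>
    (hf.contDiffAt (ne_zero_of_mem_unit_sphere ⟨y, hy⟩)).continuousAt.continuousWithinAt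
  obtain ⟨C, hC⟩ := (isCompact_sphere (0 : V) 1).exists_bound_of_continuousOn hc
  refine ⟨max C 0, le_max_right _ _, fun v => ?_⟩
  rcases eq_or_ne v 0 with rfl | hv
  · simp [hf.map_zero]
  have hn : 0 < ‖v‖ := norm_pos_iff.mpr hv
  have h1 := hC (‖v‖⁻¹ • v) (by simp [norm_smul, hn.ne'])
  rw [hf.homogeneous _ _ (inv_pos.mpr hn)] at h1
  have h2 := (le_abs_self _).trans (h1.trans (le_max_left C 0))
  rwa [inv_mul_le_iff₀ hn, mul_comm] at h2

/-- `f` itself need not be differentiable at the origin, but `f v ≤ C * ‖v‖` makes its square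
quadratically small. With `continuous_fderiv_energy` the energy is therefore C¹ everywhere, so
convexity arguments may cross the origin. -/
theorem hasFDerivAt_energy_zero (hf : IsMinkowskiNorm f) :
    HasFDerivAt (energy f) (0 : V →L[ℝ] ℝ) 0 := by
  obtain ⟨C, hC0, hC⟩ := hf.exists_le_mul_norm
  rw [hasFDerivAt_iff_isLittleO_nhds_zero]
  have h1 : (fun h : V => energy f (0 + h) - energy f 0 - (0 : V →L[ℝ] ℝ) h)
      =O[𝓝 0] fun h => ‖h‖ ^ 2 := by
    refine Asymptotics.IsBigO.of_bound (C ^ 2) (.of_forall fun h => ?_)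
    have := pow_le_pow_left₀ (hf.nonneg h) (hC h) 2
    have h0 := sq_nonneg (f h)
    simp only [zero_add, energy, hf.map_zero, zero_apply, Real.norm_eq_abs, ne_eq, OfNat.ofNat_ne_zero,
      not_false_eq_true, zero_pow, zero_div, sub_zero]
    rw [abs_of_nonneg (by linarith), abs_of_nonneg (by positivity)]
    nlinarith
  exact h1.trans_isLittleO (Asymptotics.isLittleO_norm_pow_id one_lt_two)

theorem differentiable_energy (hf : IsMinkowskiNorm f) : Differentiable ℝ (energy f) := fun y => by
  rcases eq_or_ne y 0 with rfl | hy
  · exact hf.hasFDerivAt_energy_zero.differentiableAt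
  · exact (hf.contDiffAt_energy hy).differentiableAt (by simp)

theorem fderiv_energy_smul (hf : IsMinkowskiNorm f) (y : V) {s : ℝ} (hs : 0 < s) :
    fderiv ℝ (energy f) (s • y) = s • fderiv ℝ (energy f) y := by
  have h1 : (fun z => energy f (s • z)) = fun z => s ^ 2 • energy f z := by
    ext z
    simp [hf.energy_smul z hs]
  have h2 := fderiv_comp_smul (𝕜 := ℝ) (f := energy f) (x := y) s
  rw [h1, fderiv_fun_const_smul (hf.differentiable_energy y)] at h2
  have h3 : s • (s • fderiv ℝ (energy f) y) = s • fderiv ℝ (energy f) (s • y) := by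
    rw [← h2, smul_smul, sq]
  exact (smul_right_injective _ hs.ne' h3).symm

/-- Euler's identity. -/
theorem fderiv_energy_apply_self (hf : IsMinkowskiNorm f) (y : V) :
    fderiv ℝ (energy f) y y = f y ^ 2 := by
  have hl : HasDerivAt (fun t : ℝ => t • y) y 1 := by
    simpa using (hasDerivAt_id (1 : ℝ)).smul_const y
  have hd : HasFDerivAt (energy f) (fderiv ℝ (energy f) y) ((1 : ℝ) • y) := by
    rw [one_smul]
    exact (hf.differentiable_energy y).hasFDerivAt
  have h1 : HasDerivAt (fun t : ℝ => energy f (t • y)) (fderiv ℝ (energy f) y y) 1 :=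
    HasFDerivAt.comp_hasDerivAt (f := fun t : ℝ => t • y) (1 : ℝ) hd hl
  have h2 : HasDerivAt (fun t : ℝ => t ^ 2 * energy f y) (2 * energy f y) 1 := by
    simpa using (hasDerivAt_pow 2 (1 : ℝ)).mul_const (energy f y)
  have h3 := h2.congr_of_eventuallyEq (f₁ := fun t : ℝ => energy f (t • y)) (by
    filter_upwards [lt_mem_nhds one_pos] with t ht
    exact hf.energy_smul y ht)
  rw [h1.unique h3, energy]
  ring

/-- By homogeneity and Euler's identity the derivative of the energy at `t • y` in direction `y` is
`t * f y ^ 2`. Its slope in `t` is also `g_y(y, y)`, so positive definiteness forces `f y ≠ 0`. -/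
theorem pos (hf : IsMinkowskiNorm f) {y : V} (hy : y ≠ 0) : 0 < f y := by
  have h1 := hf.hasDerivAt_fderiv_energy (y := 0) (u := y) (t := 1) (by simpa using hy) y
  have h2 : HasDerivAt (fun t : ℝ => t * f y ^ 2) (f y ^ 2) 1 := by
    simpa using (hasDerivAt_id (1 : ℝ)).mul_const (f y ^ 2)
  have h3 := h2.congr_of_eventuallyEq
      (f₁ := fun t : ℝ => fderiv ℝ (energy f) (0 + t • y) y) (by
    filter_upwards [lt_mem_nhds one_pos] with t ht
    simp [hf.fderiv_energy_smul y ht, hf.fderiv_energy_apply_self])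
  have h4 := h1.unique h3
  have h5 := hf.posDef y hy y hy
  rw [hf.fundamentalForm_eq hy] at h5
  rw [zero_add, one_smul] at h4
  refine lt_of_le_of_ne (hf.nonneg y) fun h => ?_
  rw [h4, ← h] at h5
  norm_num at h5

theorem exists_norm_fderiv_energy_le (hf : IsMinkowskiNorm f) :
    ∃ C, 0 ≤ C ∧ ∀ v, ‖fderiv ℝ (energy f) v‖ ≤ C * ‖v‖ := by
  have hc : ContinuousOn (fderiv ℝ (energy f)) (Metric.sphere 0 1) := fun y hy =>
    (hf.contDiffAt_fderiv_energy (ne_zero_of_mem_unit_sphere ⟨y, hy⟩)).continuousAt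
      |>.continuousWithinAt
  obtain ⟨C, hC⟩ := (isCompact_sphere (0 : V) 1).exists_bound_of_continuousOn hc
  refine ⟨max C 0, le_max_right _ _, fun v => ?_⟩
  rcases eq_or_ne v 0 with rfl | hv
  · simp [hf.hasFDerivAt_energy_zero.fderiv]
  have hn : 0 < ‖v‖ := norm_pos_iff.mpr hv
  have h1 := hC (‖v‖⁻¹ • v) (by simp [norm_smul, hn.ne'])
  rw [hf.fderiv_energy_smul _ (inv_pos.mpr hn), norm_smul, norm_inv, norm_norm] at h1
  have h2 := h1.trans (le_max_left C 0)
  rwa [inv_mul_le_iff₀ hn, mul_comm] at h2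

theorem continuous_fderiv_energy (hf : IsMinkowskiNorm f) :
    Continuous (fderiv ℝ (energy f)) := by
  rw [continuous_iff_continuousAt]
  intro y
  rcases eq_or_ne y 0 with rfl | hy
  · obtain ⟨C, -, hC⟩ := hf.exists_norm_fderiv_energy_le
    rw [ContinuousAt, hf.hasFDerivAt_energy_zero.fderiv]
    refine squeeze_zero_norm hC ?_
    have : ContinuousAt (fun v : V => C * ‖v‖) 0 := by fun_prop
    simpa [ContinuousAt] using this
  · exact (hf.contDiffAt_fderiv_energy hy).continuousAt

/-- A lower bound for the fundamental form makes the differential of the energy strongly monotone,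
also along segments through the origin. -/
theorem le_fderiv_energy_sub (hf : IsMinkowskiNorm f) {μ : ℝ}
    (hμ : ∀ y u : V, y ≠ 0 → μ * ‖u‖ ^ 2 ≤ fundamentalForm f y u u) (v w : V) :
    μ * ‖v - w‖ ^ 2 ≤ (fderiv ℝ (energy f) v - fderiv ℝ (energy f) w) (v - w) := by
  set u := v - w with hu
  rcases eq_or_ne u 0 with h0 | hu0
  · simp [h0]
  let φ : ℝ → ℝ := fun t => fderiv ℝ (energy f) (w + t • u) u - t * (μ * ‖u‖ ^ 2)
  have hφc : Continuous φ :=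
    ((hf.continuous_fderiv_energy.comp (by fun_prop)).clm_apply continuous_const).sub
      (by fun_prop)
  have hder : ∀ t : ℝ, w + t • u ≠ 0 →
      HasDerivAt φ (fundamentalForm f (w + t • u) u u - μ * ‖u‖ ^ 2) t := by
    intro t ht
    have h1 : HasDerivAt (fun t : ℝ => t * (μ * ‖u‖ ^ 2)) (μ * ‖u‖ ^ 2) t := by
      simpa using (hasDerivAt_id t).mul_const (μ * ‖u‖ ^ 2)
    rw [hf.fundamentalForm_eq ht]
    exact (hf.hasDerivAt_fderiv_energy ht u).sub h1
  have hmono : ∀ a b : ℝ, a ≤ b → (∀ t ∈ Ioo a b, w + t • u ≠ 0) → φ a ≤ φ b := by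
    intro a b hab h
    have := monotoneOn_of_deriv_nonneg (convex_Icc a b) hφc.continuousOn (by
      rw [interior_Icc]
      exact fun t ht => (hder t (h t ht)).differentiableAt.differentiableWithinAt) (by
      rw [interior_Icc]
      intro t ht
      rw [(hder t (h t ht)).deriv]
      linarith [hμ (w + t • u) u (h t ht)])
    exact this (left_mem_Icc.mpr hab) (right_mem_Icc.mpr hab) hab
  -- The segment meets the origin for at most one parameter. Splitting there gives two intervals on
  -- which `φ` is monotone, and continuity of `φ` joins them.
  have hkey : φ 0 ≤ φ 1 := by
    by_cases hex : ∃ t ∈ Ioo (0 : ℝ) 1, w + t • u = 0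
    · obtain ⟨t₀, ht₀, h0⟩ := hex
      have huniq : ∀ t, w + t • u = 0 → t = t₀ := fun t ht => by
        have : (t - t₀) • u = 0 := by
          rw [sub_smul, sub_eq_zero]
          exact add_left_cancel (ht.trans h0.symm)
        simpa [sub_eq_zero, hu0] using this
      exact (hmono 0 t₀ ht₀.1.le fun t ht h => ht.2.ne (huniq t h)).trans
        (hmono t₀ 1 ht₀.2.le fun t ht h => ht.1.ne' (huniq t h))
    · push Not at hex
      exact hmono 0 1 zero_le_one hex
  simp only [φ, zero_smul, add_zero, zero_mul, sub_zero, one_smul, one_mul] at hkey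
  have hv : w + u = v := by simp [hu]
  rw [hv] at hkey
  simp only [sub_apply]
  linarith

theorem fderiv_energy_sub_nonneg (hf : IsMinkowskiNorm f) (v w : V) :
    0 ≤ (fderiv ℝ (energy f) v - fderiv ℝ (energy f) w) (v - w) := by
  have := hf.le_fderiv_energy_sub (μ := 0) (fun y u hy => by
    rcases eq_or_ne u 0 with rfl | hu
    · simp [hf.fundamentalForm_eq hy]
    · simpa using (hf.posDef y hy u hu).le) v w
  simpa using this

/-- Monotonicity of the differential along the segment from `w` to `v` is convexity, here in the
form of the tangent inequality. -/
theorem energy_add_le (hf : IsMinkowskiNorm f) (v w : V) :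
    energy f w + fderiv ℝ (energy f) w (v - w) ≤ energy f v := by
  set u := v - w with hu
  let φ : ℝ → ℝ := fun t => energy f (w + t • u) - t * fderiv ℝ (energy f) w u
  have hder : ∀ t : ℝ,
      HasDerivAt φ (fderiv ℝ (energy f) (w + t • u) u - fderiv ℝ (energy f) w u) t := by
    intro t
    have h1 : HasDerivAt (fun t : ℝ => t * fderiv ℝ (energy f) w u)
        (fderiv ℝ (energy f) w u) t := by
      simpa using (hasDerivAt_id t).mul_const (fderiv ℝ (energy f) w u)
    exact ((hf.differentiable_energy (w + t • u)).hasFDerivAt.comp_hasDerivAt t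
      (hasDerivAt_line w u t)).sub h1
  have hmono := monotoneOn_of_deriv_nonneg (convex_Icc (0 : ℝ) 1)
    (f := φ) (fun t _ => (hder t).continuousAt.continuousWithinAt)
    (fun t _ => (hder t).differentiableAt.differentiableWithinAt) (by
      rw [interior_Icc]
      intro t ht
      rw [(hder t).deriv]
      have := hf.fderiv_energy_sub_nonneg (w + t • u) w
      simp only [add_sub_cancel_left, map_smul, sub_apply, smul_eq_mul] at this
      exact nonneg_of_mul_nonneg_right this ht.1)
    (left_mem_Icc.mpr zero_le_one) (right_mem_Icc.mpr zero_le_one) zero_le_one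
  simp only [φ, zero_smul, add_zero, zero_mul, sub_zero, one_smul, one_mul] at hmono
  have hv : w + u = v := by simp [hu]
  rw [hv] at hmono
  linarith

/-- The fundamental inequality. -/
theorem fderiv_energy_apply_le (hf : IsMinkowskiNorm f) (v w : V) :
    fderiv ℝ (energy f) w v ≤ f w * f v := by
  rcases eq_or_ne v 0 with rfl | hv
  · simp [hf.map_zero]
  rcases eq_or_ne w 0 with rfl | hw
  · simp [hf.hasFDerivAt_energy_zero.fderiv, hf.map_zero]
  have hv' := hf.pos hv
  have hw' := hf.pos hw
  -- Rescaling `v` to the norm of `w` makes the two energies in the tangent inequality cancel.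
  have h := hf.energy_add_le ((f w / f v) • v) w
  rw [hf.energy_smul _ (div_pos hw' hv'), map_sub, hf.fderiv_energy_apply_self, map_smul,
    smul_eq_mul] at h
  simp only [energy] at h
  have h2 : (f w / f v) ^ 2 * (f v ^ 2 / 2) = f w ^ 2 / 2 := by field_simp
  rw [h2] at h
  have h3 : f w / f v * fderiv ℝ (energy f) w v ≤ f w ^ 2 := by linarith
  rw [div_mul_eq_mul_div, div_le_iff₀ hv'] at h3
  nlinarith

/-- A Minkowski norm is the supremum of the linear forms below it. -/
theorem exists_support (hf : IsMinkowskiNorm f) (w : V) :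
    ∃ ξ : V →L[ℝ] ℝ, ξ w = f w ∧ ∀ v, ξ v ≤ f v := by
  rcases eq_or_ne w 0 with rfl | hw
  · exact ⟨0, by simp [hf.map_zero], fun v => by simpa using hf.nonneg v⟩
  have hw' := hf.pos hw
  refine ⟨(f w)⁻¹ • fderiv ℝ (energy f) w, ?_, fun v => ?_⟩
  · simp only [smul_apply, hf.fderiv_energy_apply_self, smul_eq_mul]
    field_simp
  · simp only [smul_apply, smul_eq_mul]
    rw [inv_mul_le_iff₀ hw']
    exact hf.fderiv_energy_apply_le v w

end IsMinkowskiNorm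

/-- The Hessian of a function homogeneous of degree two is homogeneous of degree zero. Lower bounds
for the fundamental form thus need checking only on unit vectors, a compact set. -/
theorem IsMinkowskiNorm.fundamentalForm_smul_left {V : Type*} [NormedAddCommGroup V]
    [NormedSpace ℝ V] [FiniteDimensional ℝ V] {f : V → ℝ} (hf : IsMinkowskiNorm f) {y : V}
    (hy : y ≠ 0) (u w : V) {s : ℝ} (hs : 0 < s) :
    fundamentalForm f (s • y) u w = fundamentalForm f y u w := by
  have hsy : s • y ≠ 0 := smul_ne_zero hs.ne' hy
  rw [hf.fundamentalForm_eq hy, hf.fundamentalForm_eq hsy]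
  have h1 : (fun z => fderiv ℝ (energy f) (s • z)) = fun z => s • fderiv ℝ (energy f) z := by
    ext1 z
    exact hf.fderiv_energy_smul z hs
  have h2 := fderiv_comp_smul (𝕜 := ℝ) (f := fderiv ℝ (energy f)) (x := y) s
  rw [h1, fderiv_fun_const_smul (hf.differentiableAt_fderiv_energy hy)] at h2
  rw [smul_right_injective _ hs.ne' h2]

theorem IsMinkowskiNorm.fundamentalForm_smul_smul {V : Type*} [NormedAddCommGroup V]
    [NormedSpace ℝ V] {f : V → ℝ} (hf : IsMinkowskiNorm f) {y : V}
    (hy : y ≠ 0) (u : V) (c : ℝ) :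
    fundamentalForm f y (c • u) (c • u) = c ^ 2 * fundamentalForm f y u u := by
  rw [hf.fundamentalForm_eq hy, hf.fundamentalForm_eq hy, map_smul, map_smul]
  simp only [smul_apply, smul_eq_mul]
  ring

/-! ### Smooth families of Minkowski norms -/

/-- A family `f x` of Minkowski norms, smooth in both variables off the zero section, whose
parameter ranges over a compact convex set with nonempty interior. -/
structure IsFinslerFamily {V : Type*} [NormedAddCommGroup V] [NormedSpace ℝ V] (U : Set V)
    (f : V × V → ℝ) : Prop where
  isCompact : IsCompact U
  convex : Convex ℝ U
  nonempty_interior : (interior U).Nonempty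
  smooth : ContDiffOn ℝ ∞ f (U ×ˢ {0}ᶜ)
  minkowski : ∀ x ∈ U, IsMinkowskiNorm fun v => f (x, v)

/-- The differential of the energy of a family of Minkowski norms. -/
noncomputable def energyDeriv {V : Type*} [NormedAddCommGroup V] [NormedSpace ℝ V] (U : Set V)
    (f : V × V → ℝ) : V × V → (V × V →L[ℝ] ℝ) :=
  fderivWithin ℝ (energy f) (U ×ˢ {0}ᶜ)

/-- The vectors whose norm lies between two bounds. -/
def annulus (V : Type*) [NormedAddCommGroup V] (r R : ℝ) : Set V := {v | r ≤ ‖v‖ ∧ ‖v‖ ≤ R}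

theorem isCompact_annulus (V : Type*) [NormedAddCommGroup V] [NormedSpace ℝ V]
    [FiniteDimensional ℝ V] (r R : ℝ) : IsCompact (annulus V r R) := by
  have := FiniteDimensional.proper_real V
  have h : annulus V r R = Metric.closedBall 0 R ∩ {v | r ≤ ‖v‖} := by
    ext v
    simp [annulus, and_comm]
  rw [h]
  exact (isCompact_closedBall 0 R).inter_right (isClosed_le continuous_const continuous_norm)

theorem ne_zero_of_mem_annulus {V : Type*} [NormedAddCommGroup V] {r R : ℝ} (hr : 0 < r) {v : V}
    (hv : v ∈ annulus V r R) : v ≠ 0 :=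
  norm_pos_iff.mp (hr.trans_le hv.1)

theorem unitSphere_subset_compl_zero {V : Type*} [NormedAddCommGroup V] [NormedSpace ℝ V] :
    Metric.sphere (0 : V) 1 ⊆ {0}ᶜ :=
  fun v hv => ne_zero_of_mem_unit_sphere ⟨v, hv⟩

namespace IsFinslerFamily

variable {V : Type*} [NormedAddCommGroup V] [NormedSpace ℝ V] {U : Set V} {f : V × V → ℝ}

/-- Half-balls at the boundary are not neighbourhoods of all their points, but convexity and
nonempty interior still make derivatives within them unique. -/
theorem uniqueDiffOn (h : IsFinslerFamily U f) : UniqueDiffOn ℝ (U ×ˢ ({0}ᶜ : Set V)) :=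
  (uniqueDiffOn_convex h.convex h.nonempty_interior).prod isOpen_compl_singleton.uniqueDiffOn

theorem contDiffOn_energy (h : IsFinslerFamily U f) :
    ContDiffOn ℝ ∞ (energy f) (U ×ˢ {0}ᶜ) :=
  (h.smooth.pow 2).div_const 2

theorem contDiffOn_energyDeriv (h : IsFinslerFamily U f) :
    ContDiffOn ℝ ∞ (energyDeriv U f) (U ×ˢ {0}ᶜ) :=
  h.contDiffOn_energy.fderivWithin h.uniqueDiffOn (by simp)

theorem hasFDerivWithinAt_energy (h : IsFinslerFamily U f) {x v : V} (hx : x ∈ U) (hv : v ≠ 0) :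
    HasFDerivWithinAt (energy f) (energyDeriv U f (x, v)) (U ×ˢ {0}ᶜ) (x, v) :=
  (h.contDiffOn_energy.differentiableOn (by simp) (x, v) ⟨hx, hv⟩).hasFDerivWithinAt

theorem hasFDerivAt_energy (h : IsFinslerFamily U f) {x v : V} (hx : x ∈ interior U)
    (hv : v ≠ 0) : HasFDerivAt (energy f) (energyDeriv U f (x, v)) (x, v) :=
  (h.hasFDerivWithinAt_energy (interior_subset hx) hv).hasFDerivAt
    (prod_mem_nhds (mem_interior_iff_mem_nhds.mp hx) (isOpen_compl_singleton.mem_nhds hv))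

theorem fderiv_energy_fiber (h : IsFinslerFamily U f) {x v : V} (hx : x ∈ U) (hv : v ≠ 0)
    (w : V) :
    fderiv ℝ (energy fun v => f (x, v)) v w = energyDeriv U f (x, v) (0, w) := by
  have h1 := (h.hasFDerivWithinAt_energy hx hv).comp_hasFDerivAt v
    (f := fun v => (x, v)) (hasFDerivAt_prodMk_right x v) (by
      filter_upwards [isOpen_compl_singleton.mem_nhds hv] with u hu
      exact ⟨hx, hu⟩)
  have h2 : (energy fun v => f (x, v)) = energy f ∘ fun v => (x, v) := rfl
  rw [h2, h1.fderiv]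
  simp

/-- The right-hand side is jointly continuous in point and vectors, which turns pointwise positive
definiteness into a uniform bound by compactness. -/
theorem fundamentalForm_fiber (h : IsFinslerFamily U f) {x v : V} (hx : x ∈ U) (hv : v ≠ 0)
    (u w : V) :
    fundamentalForm (fun v => f (x, v)) v u w =
      fderivWithin ℝ (energyDeriv U f) (U ×ˢ {0}ᶜ) (x, v) (0, u) (0, w) := by
  have hm := h.minkowski x hx
  have hv0 : v + (0 : ℝ) • u ≠ 0 := by simpa using hv
  have hne : ∀ᶠ t : ℝ in 𝓝 0, v + t • u ≠ 0 :=
    (hasDerivAt_line v u 0).continuousAt.eventually_ne hv0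
  have h1 := hm.hasDerivAt_fderiv_energy hv0 w
  have h2 : HasDerivAt (fun t : ℝ => (x, v + t • u)) (0, u) 0 :=
    (hasDerivAt_const 0 x).prodMk (hasDerivAt_line v u 0)
  have h3 : HasFDerivWithinAt (energyDeriv U f)
      (fderivWithin ℝ (energyDeriv U f) (U ×ˢ {0}ᶜ) (x, v)) (U ×ˢ {0}ᶜ) (x, v + (0 : ℝ) • u) := by
    rw [zero_smul, add_zero]
    exact (h.contDiffOn_energyDeriv.differentiableOn (by simp) (x, v) ⟨hx, hv⟩).hasFDerivWithinAt
  have h4 := HasFDerivWithinAt.comp_hasDerivAt (f := fun t : ℝ => (x, v + t • u)) 0 h3 h2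
    (by filter_upwards [hne] with t ht using ⟨hx, ht⟩)
  have h5 : HasDerivAt (fun t : ℝ => energyDeriv U f (x, v + t • u) (0, w))
      (fderivWithin ℝ (energyDeriv U f) (U ×ˢ {0}ᶜ) (x, v) (0, u) (0, w)) 0 :=
    (ContinuousLinearMap.apply ℝ ℝ ((0, w) : V × V)).hasFDerivAt.comp_hasDerivAt 0 h4
  have h6 := h5.congr_of_eventuallyEq (by
    filter_upwards [hne] with t ht
    exact h.fderiv_energy_fiber hx ht w)
  have h7 := h6.unique h1
  rw [zero_smul, add_zero] at h7
  rw [hm.fundamentalForm_eq hv, h7]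

/-- The domain with the zero section removed is not convex; restricting the vector to a ball that
avoids the origin restores convexity. -/
theorem locallyLipschitzOn (h : IsFinslerFamily U f) {W : Type*} [NormedAddCommGroup W]
    [NormedSpace ℝ W] {g : V × V → W} (hg : ContDiffOn ℝ ∞ g (U ×ˢ {0}ᶜ)) :
    LocallyLipschitzOn (U ×ˢ {0}ᶜ) g := by
  rintro ⟨x, v⟩ ⟨hx, hv⟩
  have hv' : (v : V) ≠ 0 := hv
  obtain ⟨r, hr, hrs⟩ := Metric.isOpen_iff.mp (isOpen_compl_singleton (x := (0 : V))) v hv'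
  have h1 : ContDiffWithinAt ℝ 1 g (U ×ˢ Metric.ball v r) (x, v) :=
    ((hg (x, v) ⟨hx, hv⟩).mono (prod_mono_right hrs)).of_le (by norm_cast)
  obtain ⟨K, t, ht, hK⟩ := h1.exists_lipschitzOnWith (h.convex.prod (convex_ball v r))
  refine ⟨K, t, ?_, hK⟩
  have h2 : 𝓝[U ×ˢ {0}ᶜ] (x, v) ≤ 𝓝[U ×ˢ Metric.ball v r] (x, v) := by
    rw [nhdsWithin_prod_eq, nhdsWithin_prod_eq, Metric.isOpen_ball.nhdsWithin_eq
      (Metric.mem_ball_self hr), isOpen_compl_singleton.nhdsWithin_eq hv]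
  exact h2 ht

theorem exists_lipschitzOnWith (h : IsFinslerFamily U f) {W : Type*} [NormedAddCommGroup W]
    [NormedSpace ℝ W] {g : V × V → W} (hg : ContDiffOn ℝ ∞ g (U ×ˢ {0}ᶜ)) {k : Set V}
    (hk : IsCompact k) (hk0 : k ⊆ {0}ᶜ) :
    ∃ C, 0 < C ∧ ∀ x ∈ U, ∀ y ∈ U, ∀ v ∈ k, ∀ w ∈ k,
      ‖g (x, v) - g (y, w)‖ ≤ C * (‖x - y‖ + ‖v - w‖) := by
  obtain ⟨K, hK⟩ := LocallyLipschitzOn.exists_lipschitzOnWith_of_compact (h.isCompact.prod hk)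
    ((h.locallyLipschitzOn hg).mono (prod_mono_right hk0))
  refine ⟨K + 1, by positivity, fun x hx y hy v hv w hw => ?_⟩
  have h1 := hK.dist_le_mul (x, v) ⟨hx, hv⟩ (y, w) ⟨hy, hw⟩
  rw [dist_eq_norm, dist_eq_norm, Prod.mk_sub_mk, Prod.norm_mk] at h1
  have h2 : max ‖x - y‖ ‖v - w‖ ≤ ‖x - y‖ + ‖v - w‖ :=
    max_le (by linarith [norm_nonneg (v - w)]) (by linarith [norm_nonneg (x - y)])
  have h3 : 0 ≤ ‖x - y‖ + ‖v - w‖ := by positivity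
  nlinarith [mul_le_mul_of_nonneg_left h2 K.2]

variable [FiniteDimensional ℝ V]

/-- Uniform bounds for the family in terms of the norm. -/
theorem exists_bounds (h : IsFinslerFamily U f) :
    ∃ m C, 0 < m ∧ 0 < C ∧ ∀ x ∈ U, ∀ v, m * ‖v‖ ≤ f (x, v) ∧ f (x, v) ≤ C * ‖v‖ := by
  have hk := h.isCompact.prod (isCompact_sphere (0 : V) 1)
  have hc : ContinuousOn f (U ×ˢ Metric.sphere 0 1) :=
    h.smooth.continuousOn.mono (prod_mono_right unitSphere_subset_compl_zero)
  obtain ⟨m, hm0, hm⟩ := hk.exists_forall_le' hc (a := 0) fun p hp =>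
    (h.minkowski p.1 hp.1).pos (unitSphere_subset_compl_zero hp.2)
  obtain ⟨C, hC⟩ := hk.exists_bound_of_continuousOn hc
  refine ⟨m, max C 1, hm0, by positivity, fun x hx v => ?_⟩
  rcases eq_or_ne v 0 with rfl | hv
  · simp [(h.minkowski x hx).map_zero]
  have hn : 0 < ‖v‖ := norm_pos_iff.mpr hv
  have hs : ‖v‖⁻¹ • v ∈ Metric.sphere (0 : V) 1 := by simp [norm_smul, hn.ne']
  have hh : f (x, ‖v‖⁻¹ • v) = ‖v‖⁻¹ * f (x, v) :=
    (h.minkowski x hx).homogeneous v _ (inv_pos.mpr hn)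
  have h1 := hm (x, ‖v‖⁻¹ • v) ⟨hx, hs⟩
  have h2 := (le_abs_self _).trans ((hC (x, ‖v‖⁻¹ • v) ⟨hx, hs⟩).trans (le_max_left C 1))
  rw [hh] at h1 h2
  rw [le_inv_mul_iff₀ hn] at h1
  rw [inv_mul_le_iff₀ hn] at h2
  constructor <;> linarith

/-- The family is Lipschitz in the parameter. -/
theorem exists_abs_sub_le (h : IsFinslerFamily U f) :
    ∃ C, 0 < C ∧ ∀ x ∈ U, ∀ y ∈ U, ∀ v, |f (x, v) - f (y, v)| ≤ C * ‖x - y‖ * ‖v‖ := by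
  obtain ⟨C, hC0, hC⟩ := h.exists_lipschitzOnWith h.smooth (isCompact_sphere 0 1) unitSphere_subset_compl_zero
  refine ⟨C, hC0, fun x hx y hy v => ?_⟩
  rcases eq_or_ne v 0 with rfl | hv
  · simp [(h.minkowski x hx).map_zero, (h.minkowski y hy).map_zero]
  have hn : 0 < ‖v‖ := norm_pos_iff.mpr hv
  have hs : ‖v‖⁻¹ • v ∈ Metric.sphere (0 : V) 1 := by simp [norm_smul, hn.ne']
  have h1 := hC x hx y hy _ hs _ hs
  have hh : ∀ z ∈ U, f (z, ‖v‖⁻¹ • v) = ‖v‖⁻¹ * f (z, v) := fun z hz =>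
    (h.minkowski z hz).homogeneous v _ (inv_pos.mpr hn)
  rw [hh x hx, hh y hy, ← mul_sub, sub_self, norm_zero, add_zero, norm_mul, norm_inv, norm_norm,
    Real.norm_eq_abs, inv_mul_le_iff₀ hn] at h1
  linarith

/-- At zero vectors smoothness says nothing; there the uniform bound by a multiple of the norm gives
continuity. -/
theorem continuousOn (h : IsFinslerFamily U f) : ContinuousOn f (U ×ˢ univ) := by
  rintro ⟨x, v⟩ ⟨hx, -⟩
  rcases eq_or_ne v 0 with rfl | hv
  · obtain ⟨m, C, hm, -, hb⟩ := h.exists_bounds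
    have h0 : f (x, 0) = 0 := (h.minkowski x hx).map_zero
    rw [ContinuousWithinAt, h0]
    refine squeeze_zero_norm' (a := fun p : V × V => C * ‖p.2‖) ?_ ?_
    · filter_upwards [self_mem_nhdsWithin] with p hp
      rw [Real.norm_of_nonneg ((h.minkowski p.1 hp.1).nonneg p.2)]
      exact (hb p.1 hp.1 p.2).2
    · have : ContinuousAt (fun p : V × V => C * ‖p.2‖) (x, 0) := by fun_prop
      simpa [ContinuousAt] using this.mono_left nhdsWithin_le_nhds
  · have h1 := h.smooth.continuousOn (x, v) ⟨hx, hv⟩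
    rw [ContinuousWithinAt, nhdsWithin_prod_eq, isOpen_compl_singleton.nhdsWithin_eq hv] at h1
    rwa [ContinuousWithinAt, nhdsWithin_prod_eq, nhdsWithin_univ]

/-- The differential of the energy is strongly monotone in the fibres, uniformly. -/
theorem exists_monotone (h : IsFinslerFamily U f) :
    ∃ μ, 0 < μ ∧ ∀ x ∈ U, ∀ v w, v ≠ 0 → w ≠ 0 →
      μ * ‖v - w‖ ^ 2 ≤ (energyDeriv U f (x, v) - energyDeriv U f (x, w)) (0, v - w) := by
  have hk := (h.isCompact.prod (isCompact_sphere (0 : V) 1)).prod (isCompact_sphere (0 : V) 1)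
  have hc : ContinuousOn (fun p : (V × V) × V =>
      fderivWithin ℝ (energyDeriv U f) (U ×ˢ {0}ᶜ) p.1 (0, p.2) (0, p.2))
      ((U ×ˢ Metric.sphere 0 1) ×ˢ Metric.sphere 0 1) := by
    have h1 : ContinuousOn (fderivWithin ℝ (energyDeriv U f) (U ×ˢ {0}ᶜ))
        (U ×ˢ Metric.sphere 0 1) :=
      (h.contDiffOn_energyDeriv.continuousOn_fderivWithin h.uniqueDiffOn (by simp)).mono
        (prod_mono_right unitSphere_subset_compl_zero)
    have h2 : ContinuousOn (fun p : (V × V) × V => ((0 : V), p.2))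
        ((U ×ˢ Metric.sphere 0 1) ×ˢ Metric.sphere 0 1) := by fun_prop
    exact ((h1.comp continuousOn_fst fun p hp => hp.1).clm_apply h2).clm_apply h2
  obtain ⟨μ, hμ0, hμ⟩ := hk.exists_forall_le' hc (a := 0) fun p hp => by
    rw [← h.fundamentalForm_fiber hp.1.1 (unitSphere_subset_compl_zero hp.1.2)]
    exact (h.minkowski _ hp.1.1).posDef _ (unitSphere_subset_compl_zero hp.1.2) _ (unitSphere_subset_compl_zero hp.2)
  refine ⟨μ, hμ0, fun x hx v w hv hw => ?_⟩
  have hm := h.minkowski x hx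
  have h1 : ∀ y u : V, y ≠ 0 → μ * ‖u‖ ^ 2 ≤ fundamentalForm (fun v => f (x, v)) y u u := by
    intro y u hy
    rcases eq_or_ne u 0 with rfl | hu
    · simp [hm.fundamentalForm_eq hy]
    have hny : 0 < ‖y‖ := norm_pos_iff.mpr hy
    have hnu : 0 < ‖u‖ := norm_pos_iff.mpr hu
    have h2 := hμ ((x, ‖y‖⁻¹ • y), ‖u‖⁻¹ • u)
      ⟨⟨hx, by simp [norm_smul, hny.ne']⟩, by simp [norm_smul, hnu.ne']⟩
    have hy' : ‖y‖⁻¹ • y ≠ 0 := smul_ne_zero (inv_pos.mpr hny).ne' hy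
    simp only [] at h2
    rw [← h.fundamentalForm_fiber hx hy', hm.fundamentalForm_smul_smul hy',
      hm.fundamentalForm_smul_left hy _ _ (inv_pos.mpr hny), inv_pow,
      le_inv_mul_iff₀ (by positivity)] at h2
    linarith
  have h3 := hm.le_fderiv_energy_sub h1 v w
  simp only [sub_apply] at h3 ⊢
  rwa [h.fderiv_energy_fiber hx hv, h.fderiv_energy_fiber hx hw] at h3

theorem energyDeriv_apply_self (h : IsFinslerFamily U f) {x v : V} (hx : x ∈ U) (hv : v ≠ 0) :
    energyDeriv U f (x, v) (0, v) = f (x, v) ^ 2 := by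
  rw [← h.fderiv_energy_fiber hx hv, (h.minkowski x hx).fderiv_energy_apply_self]

theorem exists_energyDeriv_bound (h : IsFinslerFamily U f) {r R : ℝ} (hr : 0 < r) :
    ∃ C, 0 < C ∧ ∀ x ∈ U, ∀ v ∈ annulus V r R, ‖energyDeriv U f (x, v)‖ ≤ C := by
  obtain ⟨C, hC⟩ := (h.isCompact.prod (isCompact_annulus V r R)).exists_bound_of_continuousOn
    (h.contDiffOn_energyDeriv.continuousOn.mono
      (prod_mono_right fun v hv => ne_zero_of_mem_annulus hr hv))
  exact ⟨max C 1, by positivity, fun x hx v hv => (hC (x, v) ⟨hx, hv⟩).trans (le_max_left _ _)⟩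

theorem exists_energyDeriv_lipschitz (h : IsFinslerFamily U f) {r R : ℝ} (hr : 0 < r) :
    ∃ C, 0 < C ∧ ∀ x ∈ U, ∀ y ∈ U, ∀ v ∈ annulus V r R, ∀ w ∈ annulus V r R,
      ‖energyDeriv U f (x, v) - energyDeriv U f (y, w)‖ ≤ C * (‖x - y‖ + ‖v - w‖) :=
  h.exists_lipschitzOnWith h.contDiffOn_energyDeriv (isCompact_annulus V r R)
    fun _ hv => ne_zero_of_mem_annulus hr hv

end IsFinslerFamily

/-! ### Lipschitz curves and length -/

/-- The integrands below are continuous only on a set in which the curve and its velocity lie almost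
everywhere; extending by zero makes them measurable. -/
theorem AEMeasurable.aestronglyMeasurable_comp_continuousOn {α X : Type*} [MeasurableSpace α]
    {μ : Measure α} [TopologicalSpace X] [MeasurableSpace X] [BorelSpace X] {G : X → ℝ} {S : Set X}
    (hG : ContinuousOn G S) (hS : MeasurableSet S) {x : α → X} (hx : AEMeasurable x μ)
    (hxS : ∀ᵐ t ∂μ, x t ∈ S) : AEStronglyMeasurable (fun t => G (x t)) μ := by
  classical
  have h1 : Measurable (S.piecewise G 0) := hG.measurable_piecewise continuousOn_const hS
  refine (h1.comp_aemeasurable hx).aestronglyMeasurable.congr ?_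
  filter_upwards [hxS] with t ht
  exact Set.piecewise_eq_of_mem _ _ _ ht

theorem intervalIntegrable_of_ae_bound {g : ℝ → ℝ} {a b C : ℝ} (hab : a ≤ b)
    (hg : AEStronglyMeasurable g (volume.restrict (Ioc a b)))
    (hC : ∀ᵐ t ∂volume.restrict (Ioc a b), ‖g t‖ ≤ C) : IntervalIntegrable g volume a b := by
  rw [intervalIntegrable_iff_integrableOn_Ioc_of_le hab]
  exact Integrable.of_bound hg C hC

/-- A function `d` on `U` which satisfies the triangle inequality, is comparable with the norm, and
is infinitesimally given by the family of norms `f`. -/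
structure IsLocalDist {V : Type*} [NormedAddCommGroup V] [NormedSpace ℝ V] (U : Set V)
    (f : V × V → ℝ) (d : V → V → ℝ) : Prop where
  triangle : ∀ x ∈ U, ∀ y ∈ U, ∀ z ∈ U, d x z ≤ d x y + d y z
  le : ∃ C, 0 < C ∧ ∀ x ∈ U, ∀ y ∈ U, |d x y| ≤ C * ‖y - x‖
  asymp : ∀ x₀ ∈ U, ∀ ε > 0, ∃ ρ > 0, ∀ x ∈ U, ∀ y ∈ U, ‖x - x₀‖ < ρ → ‖y - x₀‖ < ρ →
    |d x y - f (x₀, y - x)| ≤ ε * ‖y - x‖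

/-- `c` is a Lipschitz curve in `U` minimizing `d` on `[a, b]`, parametrized by `d`-length, and lying
in the interior of `U` except possibly at the end. -/
structure IsLocalMinimizer {V : Type*} [NormedAddCommGroup V] [NormedSpace ℝ V] (U : Set V)
    (d : V → V → ℝ) (c : ℝ → V) (a b : ℝ) : Prop where
  lipschitz : ∃ K, LipschitzWith K c
  mem : ∀ t ∈ Icc a b, c t ∈ U
  mem_interior : ∀ t ∈ Ico a b, c t ∈ interior U
  dist_eq : ∀ s t, a ≤ s → s ≤ t → t ≤ b → d (c s) (c t) = t - s

theorem LipschitzWith.ae_hasDerivAt {V : Type*} [NormedAddCommGroup V] [NormedSpace ℝ V]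
    [FiniteDimensional ℝ V] {K : NNReal} {c : ℝ → V} (hc : LipschitzWith K c) :
    ∀ᵐ t, HasDerivAt c (deriv c t) t := by
  filter_upwards [hc.ae_differentiableAt] with t ht using ht.hasDerivAt

namespace IsLocalDist

variable {V : Type*} [NormedAddCommGroup V] [NormedSpace ℝ V] [FiniteDimensional ℝ V]
  {U : Set V} {f : V × V → ℝ} {d : V → V → ℝ}

/-- The metric derivative of a differentiable curve. -/
theorem tendsto_slope (hd : IsLocalDist U f d) (h : IsFinslerFamily U f) {c : ℝ → V} {t : ℝ}
    {v : V} (hc : HasDerivAt c v t) (ht : c t ∈ U) (hU : ∀ᶠ s in 𝓝[>] t, c s ∈ U) :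
    Filter.Tendsto (fun s => (s - t)⁻¹ * d (c t) (c s)) (𝓝[>] t) (𝓝 (f (c t, v))) := by
  have hs : Filter.Tendsto (fun s => (s - t)⁻¹ • (c s - c t)) (𝓝[>] t) (𝓝 v) := by
    have h1 := hasDerivAt_iff_tendsto_slope.mp hc
    refine (h1.mono_left (nhdsWithin_mono t fun s (hs : t < s) => hs.ne')).congr fun s => ?_
    rw [slope_def_module]
  have hf : Filter.Tendsto (fun s => f (c t, (s - t)⁻¹ • (c s - c t))) (𝓝[>] t)
      (𝓝 (f (c t, v))) := by
    have h1 : ContinuousOn (fun v => f (c t, v)) univ :=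
      h.continuousOn.comp (by fun_prop) fun v _ => ⟨ht, mem_univ v⟩
    exact (continuousOn_univ.mp h1).continuousAt.tendsto.comp hs
  -- The norm frozen at `c t` replaces `d`. The error is a small multiple of `‖c s - c t‖`, harmless
  -- after division because the difference quotients stay below `‖v‖ + 1`.
  have hz : Filter.Tendsto (fun s => (s - t)⁻¹ * d (c t) (c s) -
      f (c t, (s - t)⁻¹ • (c s - c t))) (𝓝[>] t) (𝓝 0) := by
    rw [Metric.tendsto_nhds]
    intro ε hε
    have hv : 0 < ‖v‖ + 1 := by positivity
    obtain ⟨ρ, hρ, hρd⟩ := hd.asymp (c t) ht (ε / (2 * (‖v‖ + 1))) (by positivity)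
    have h1 : ∀ᶠ s in 𝓝[>] t, ‖c s - c t‖ < ρ := by
      have := hc.continuousAt.eventually (Metric.ball_mem_nhds (c t) hρ)
      filter_upwards [nhdsWithin_le_nhds this] with s hs
      rwa [dist_eq_norm] at hs
    have h2 : ∀ᶠ s in 𝓝[>] t, ‖(s - t)⁻¹ • (c s - c t)‖ < ‖v‖ + 1 :=
      hs.norm.eventually_lt_const (by linarith)
    filter_upwards [h1, h2, hU, self_mem_nhdsWithin] with s hs1 hs2 hsU hst
    have hst' : 0 < (s - t)⁻¹ := inv_pos.mpr (sub_pos.mpr hst)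
    have h3 := hρd (c t) ht (c s) hsU (by simpa using hρ) hs1
    have h4 : f (c t, (s - t)⁻¹ • (c s - c t)) = (s - t)⁻¹ * f (c t, c s - c t) :=
      (h.minkowski _ ht).homogeneous _ _ hst'
    rw [dist_zero_right, Real.norm_eq_abs, h4, ← mul_sub, abs_mul, abs_of_pos hst']
    rw [norm_smul, Real.norm_of_nonneg hst'.le] at hs2
    calc (s - t)⁻¹ * |d (c t) (c s) - f (c t, c s - c t)|
        ≤ (s - t)⁻¹ * (ε / (2 * (‖v‖ + 1)) * ‖c s - c t‖) := by gcongr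
      _ = ε / (2 * (‖v‖ + 1)) * ((s - t)⁻¹ * ‖c s - c t‖) := by ring
      _ ≤ ε / (2 * (‖v‖ + 1)) * (‖v‖ + 1) := by gcongr
      _ = ε / 2 := by field_simp
      _ < ε := by linarith
  simpa using hz.add hf

variable [MeasurableSpace V] [BorelSpace V]

theorem integrable_comp_deriv (h : IsFinslerFamily U f) {c : ℝ → V} {K : NNReal}
    (hc : LipschitzWith K c) {a b : ℝ} (hab : a ≤ b) (hU : ∀ t ∈ Icc a b, c t ∈ U) :
    IntervalIntegrable (fun t => f (c t, deriv c t)) volume a b := by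
  have := FiniteDimensional.proper_real V
  obtain ⟨m, C, -, -, hb⟩ := h.exists_bounds
  have hmem : ∀ᵐ t ∂volume.restrict (Ioc a b), t ∈ Ioc a b := ae_restrict_mem measurableSet_Ioc
  refine intervalIntegrable_of_ae_bound (C := |C| * K) hab ?_ ?_
  · refine AEMeasurable.aestronglyMeasurable_comp_continuousOn h.continuousOn
      (h.isCompact.measurableSet.prod MeasurableSet.univ)
      (hc.continuous.measurable.prodMk (measurable_deriv c)).aemeasurable ?_
    filter_upwards [hmem] with t ht using ⟨hU t (Ioc_subset_Icc_self ht), mem_univ _⟩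
  · filter_upwards [hmem] with t ht
    have ht' := hU t (Ioc_subset_Icc_self ht)
    rw [Real.norm_of_nonneg ((h.minkowski _ ht').nonneg _)]
    calc f (c t, deriv c t) ≤ C * ‖deriv c t‖ := (hb _ ht' _).2
      _ ≤ |C| * K := mul_le_mul (le_abs_self C) (norm_deriv_le_of_lipschitz hc) (norm_nonneg _)
        (abs_nonneg C)

/-- The distance of the endpoints of a Lipschitz curve is at most its length. -/
theorem le_integral (hd : IsLocalDist U f d) (h : IsFinslerFamily U f) {c : ℝ → V} {K : NNReal}
    (hc : LipschitzWith K c) {a b : ℝ} (hab : a ≤ b) (hU : ∀ t ∈ Icc a b, c t ∈ U) :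
    d (c a) (c b) ≤ ∫ t in a..b, f (c t, deriv c t) := by
  obtain ⟨C, hC0, hC⟩ := hd.le
  have ha := hU a (left_mem_Icc.mpr hab)
  have hself : d (c a) (c a) = 0 := by simpa using hC _ ha _ ha
  -- The distance from the start is Lipschitz in time, hence the integral of its derivative, and by
  -- the triangle inequality that derivative is at most the metric derivative of the curve.
  have hlip : LipschitzOnWith (⟨C, hC0.le⟩ * K) (fun t => d (c a) (c t)) (uIcc a b) := by
    rw [uIcc_of_le hab]
    have key : ∀ s ∈ Icc a b, ∀ t ∈ Icc a b, d (c a) (c s) - d (c a) (c t) ≤ C * K * |s - t| := by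
      intro s hs t ht
      have h1 := hd.triangle _ ha _ (hU t ht) _ (hU s hs)
      have h2 := (le_abs_self _).trans (hC _ (hU t ht) _ (hU s hs))
      have h3 := hc.dist_le_mul s t
      rw [dist_eq_norm, Real.dist_eq] at h3
      nlinarith [mul_le_mul_of_nonneg_left h3 hC0.le]
    refine LipschitzOnWith.of_dist_le_mul fun s hs t ht => ?_
    rw [Real.dist_eq, Real.dist_eq, abs_le]
    have h1 := key s hs t ht
    have h2 := key t ht s hs
    rw [abs_sub_comm] at h2
    change -(C * K * |s - t|) ≤ _ ∧ _ ≤ C * K * |s - t|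
    constructor <;> linarith
  have hac := hlip.absolutelyContinuousOnInterval
  have h1 := hac.integral_deriv_eq_sub
  rw [hself, sub_zero] at h1
  rw [← h1]
  refine intervalIntegral.integral_mono_ae_restrict hab hac.intervalIntegrable_deriv
    (integrable_comp_deriv h hc hab hU) ?_
  have hb : ∀ᵐ t : ℝ, t ≠ b := by simp [ae_iff, measure_singleton]
  rw [Filter.EventuallyLE, ae_restrict_iff' measurableSet_Icc]
  filter_upwards [hac.ae_differentiableAt, hc.ae_hasDerivAt, hb] with t h2 h3 htb ht
  have htb' : t < b := lt_of_le_of_ne ht.2 htb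
  have hev : ∀ᶠ s in 𝓝[>] t, s ∈ Icc a b := by
    filter_upwards [Ioc_mem_nhdsGT htb'] with s hs using ⟨ht.1.trans hs.1.le, hs.2⟩
  have h4 := hd.tendsto_slope h h3 (hU t ht) (hev.mono fun s hs => hU s hs)
  have h5 := hasDerivAt_iff_tendsto_slope.mp (h2 (by rwa [uIcc_of_le hab])).hasDerivAt
  refine le_of_tendsto_of_tendsto (b := 𝓝[>] t)
    (h5.mono_left (nhdsWithin_mono t fun s (hs : t < s) => hs.ne')) h4 ?_
  filter_upwards [hev, self_mem_nhdsWithin] with s hs hst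
  have hst' : 0 < (s - t)⁻¹ := inv_pos.mpr (sub_pos.mpr hst)
  rw [slope_def_module, smul_eq_mul]
  have := hd.triangle _ ha _ (hU t ht) _ (hU s hs)
  gcongr
  linarith

end IsLocalDist

namespace IsLocalMinimizer

variable {V : Type*} [NormedAddCommGroup V] [NormedSpace ℝ V] [FiniteDimensional ℝ V]
  {U : Set V} {f : V × V → ℝ} {d : V → V → ℝ} {c : ℝ → V} {a b : ℝ}

/-- Parametrization by `d`-length makes the metric derivative equal to one, and `tendsto_slope`
identifies it with `f`. -/
theorem apply_deriv_eq_one (hm : IsLocalMinimizer U d c a b) (hd : IsLocalDist U f d)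
    (h : IsFinslerFamily U f) {t : ℝ} {v : V} (ht : t ∈ Ico a b) (hv : HasDerivAt c v t) :
    f (c t, v) = 1 := by
  have hev : ∀ᶠ s in 𝓝[>] t, s ∈ Icc a b := by
    filter_upwards [Ioc_mem_nhdsGT ht.2] with s hs using ⟨ht.1.trans hs.1.le, hs.2⟩
  have h4 := hd.tendsto_slope h hv (hm.mem t (Ico_subset_Icc_self ht))
    (hev.mono fun s hs => hm.mem s hs)
  refine tendsto_nhds_unique h4 (tendsto_const_nhds.congr' ?_)
  filter_upwards [hev, self_mem_nhdsWithin] with s hs hst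
  rw [hm.dist_eq t s ht.1 (le_of_lt hst) hs.2, inv_mul_cancel₀ (sub_pos.mpr hst).ne']

theorem ae_hasDerivAt (hm : IsLocalMinimizer U d c a b) (hd : IsLocalDist U f d)
    (h : IsFinslerFamily U f) :
    ∀ᵐ t, t ∈ Icc a b → c t ∈ interior U ∧ HasDerivAt c (deriv c t) t ∧
      f (c t, deriv c t) = 1 := by
  obtain ⟨K, hK⟩ := hm.lipschitz
  have hb : ∀ᵐ t : ℝ, t ≠ b := by simp [ae_iff, measure_singleton]
  filter_upwards [hK.ae_hasDerivAt, hb] with t ht htb hmem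
  have ht' : t ∈ Ico a b := ⟨hmem.1, lt_of_le_of_ne hmem.2 htb⟩
  exact ⟨hm.mem_interior t ht', ht, hm.apply_deriv_eq_one hd h ht' ht⟩

/-- The velocities of minimizers lie in an annulus. -/
theorem exists_annulus (h : IsFinslerFamily U f) :
    ∃ r R, 0 < r ∧ ∀ x ∈ U, ∀ v, f (x, v) = 1 → v ∈ annulus V r R := by
  obtain ⟨m, C, hm0, hC0, hb⟩ := h.exists_bounds
  refine ⟨C⁻¹, m⁻¹, by positivity, fun x hx v hv => ?_⟩
  have h1 := hb x hx v
  rw [hv] at h1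
  refine ⟨?_, ?_⟩
  · rw [inv_le_iff_one_le_mul₀ hC0]
    linarith
  · rw [← one_div, le_div_iff₀ hm0]
    linarith

end IsLocalMinimizer

/-! ### The first variation -/

theorem LipschitzWith.exists_add_smul {V : Type*} [NormedAddCommGroup V] [NormedSpace ℝ V]
    {c : ℝ → V} {K K' : NNReal} (hc : LipschitzWith K c) {η : ℝ → ℝ} (hη : LipschitzWith K' η)
    (ε : ℝ) (e : V) : ∃ L, LipschitzWith L fun t => c t + (ε * η t) • e := by
  refine ⟨K + ‖ε‖₊ * K' * ‖e‖₊, LipschitzWith.of_dist_le_mul fun s t => ?_⟩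
  have h1 := hc.dist_le_mul s t
  have h2 := hη.dist_le_mul s t
  rw [dist_eq_norm] at h1 ⊢
  rw [dist_eq_norm] at h2
  have h3 : c s + (ε * η s) • e - (c t + (ε * η t) • e) =
      (c s - c t) + (ε * (η s - η t)) • e := by
    rw [mul_sub, sub_smul]
    abel
  rw [h3]
  refine (norm_add_le _ _).trans ?_
  rw [norm_smul, norm_mul]
  have h4 : ‖ε‖ * ‖η s - η t‖ * ‖e‖ ≤ ‖ε‖ * (K' * dist s t) * ‖e‖ := by gcongr
  push_cast
  linarith

theorem hasDerivAt_add_mul_smul {V : Type*} [NormedAddCommGroup V] [NormedSpace ℝ V] (x e : V)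
    (k ε : ℝ) : HasDerivAt (fun ε : ℝ => x + (ε * k) • e) (k • e) ε := by
  simpa [mul_smul] using hasDerivAt_line x (k • e) ε

namespace IsLocalMinimizer

variable {V : Type*} [NormedAddCommGroup V] [NormedSpace ℝ V] [FiniteDimensional ℝ V]
  {U : Set V} {f : V × V → ℝ} {d : V → V → ℝ} {c : ℝ → V} {a b : ℝ}

theorem exists_ae_energyDeriv_bound (hm : IsLocalMinimizer U d c a b)
    (hd : IsLocalDist U f d) (h : IsFinslerFamily U f) :
    ∃ C, ∀ᵐ t, t ∈ Icc a b → ‖energyDeriv U f (c t, deriv c t)‖ ≤ C := by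
  obtain ⟨r, R, hr, hrR⟩ := exists_annulus h
  obtain ⟨C, -, hC⟩ := h.exists_energyDeriv_bound (R := R) hr
  refine ⟨C, ?_⟩
  filter_upwards [hm.ae_hasDerivAt hd h] with t ht htm
  obtain ⟨h1, -, h2⟩ := ht htm
  exact hC _ (interior_subset h1) _ (hrR _ (interior_subset h1) _ h2)

variable [MeasurableSpace V] [BorelSpace V]

theorem aestronglyMeasurable_energyDeriv (hm : IsLocalMinimizer U d c a b)
    (hd : IsLocalDist U f d) (h : IsFinslerFamily U f) (w : V × V) :
    AEStronglyMeasurable (fun t => energyDeriv U f (c t, deriv c t) w)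
      (volume.restrict (Ioc a b)) := by
  have := FiniteDimensional.proper_real V
  obtain ⟨K, hK⟩ := hm.lipschitz
  obtain ⟨r, R, hr, hrR⟩ := exists_annulus h
  have hG : ContinuousOn (fun p => energyDeriv U f p w) (U ×ˢ {0}ᶜ) :=
    h.contDiffOn_energyDeriv.continuousOn.clm_apply continuousOn_const
  refine AEMeasurable.aestronglyMeasurable_comp_continuousOn hG
    (h.isCompact.measurableSet.prod (measurableSet_singleton _).compl)
    (hK.continuous.measurable.prodMk (measurable_deriv c)).aemeasurable ?_
  rw [ae_restrict_iff' measurableSet_Ioc]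
  filter_upwards [hm.ae_hasDerivAt hd h] with t ht htm
  obtain ⟨h1, -, h2⟩ := ht (Ioc_subset_Icc_self htm)
  exact ⟨interior_subset h1, ne_zero_of_mem_annulus hr (hrR _ (interior_subset h1) _ h2)⟩

theorem intervalIntegrable_energyDeriv (hm : IsLocalMinimizer U d c a b)
    (hd : IsLocalDist U f d) (h : IsFinslerFamily U f) (hab : a ≤ b) (w : V × V) :
    IntervalIntegrable (fun t => energyDeriv U f (c t, deriv c t) w) volume a b := by
  obtain ⟨C, hC⟩ := hm.exists_ae_energyDeriv_bound hd h
  refine intervalIntegrable_of_ae_bound (C := C * ‖w‖) hab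
    (hm.aestronglyMeasurable_energyDeriv hd h w) ?_
  rw [ae_restrict_iff' measurableSet_Ioc]
  filter_upwards [hC] with t ht htm
  exact (ContinuousLinearMap.le_opNorm _ _).trans
    (mul_le_mul_of_nonneg_right (ht (Ioc_subset_Icc_self htm)) (norm_nonneg w))

/-- The first variation of the energy vanishes along minimizers. -/
theorem integral_variation_eq_zero (hm : IsLocalMinimizer U d c a b) (hd : IsLocalDist U f d)
    (h : IsFinslerFamily U f) {b' : ℝ} (hab : a ≤ b') (hb : b' ≤ b) {η : ℝ → ℝ} {Kη : NNReal}
    (hη : LipschitzWith Kη η) (e : V) (ha : η a = 0) {ε₀ : ℝ} (hε₀ : 0 < ε₀)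
    (hU : ∀ ε, |ε| ≤ ε₀ → ∀ t ∈ Icc a b', c t + (ε * η t) • e ∈ U)
    (hlen : ∀ ε, |ε| ≤ ε₀ → b' - a ≤ d (c a) (c b' + (ε * η b') • e)) :
    ∫ t in a..b', (η t * energyDeriv U f (c t, deriv c t) (e, 0) +
      deriv η t * energyDeriv U f (c t, deriv c t) (0, e)) = 0 := by
  have := FiniteDimensional.proper_real V
  obtain ⟨K, hK⟩ := hm.lipschitz
  obtain ⟨r, R, hr, hrR⟩ := exists_annulus h
  obtain ⟨C, hC0, hC⟩ := h.exists_energyDeriv_bound (r := r / 2) (R := R + r / 2) (by positivity)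
  obtain ⟨N, hN⟩ := (isCompact_Icc (a := a) (b := b')).exists_bound_of_continuousOn
    hη.continuous.continuousOn
  -- Half of `ε₀` leaves room to double the variation: the varied point is the midpoint of an
  -- interior point and a point of the convex set `U`, hence interior. The second bound changes
  -- velocities by at most `r / 2`, keeping them away from zero, where the energy is not smooth.
  set ε₁ := min (ε₀ / 2) (r / (2 * (Kη * ‖e‖ + 1))) with hε₁
  have hε₁0 : 0 < ε₁ := by positivity
  have hsub : Ioc a b' ⊆ Icc a b := fun t ht => ⟨ht.1.le, ht.2.trans hb⟩
  have hsub' : Ioc a b' ⊆ Icc a b' := Ioc_subset_Icc_self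
  -- the variation stays in the domain of the family
  have hdom : ∀ᵐ t, t ∈ Ioc a b' → ∀ ε, |ε| < ε₁ → c t + (ε * η t) • e ∈ interior U ∧
      deriv c t + (ε * deriv η t) • e ∈ annulus V (r / 2) (R + r / 2) := by
    filter_upwards [hm.ae_hasDerivAt hd h] with t ht htm ε hε
    obtain ⟨h1, -, h3⟩ := ht (hsub htm)
    have hv := hrR _ (interior_subset h1) _ h3
    constructor
    · have h4 : |2 * ε| ≤ ε₀ := by
        rw [abs_mul, abs_two]
        linarith [min_le_left (ε₀ / 2) (r / (2 * (Kη * ‖e‖ + 1)))]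
      have h5 := h.convex.combo_interior_self_mem_interior h1 (hU _ h4 t (hsub' htm))
        (a := 1 / 2) (b := 1 / 2) (by norm_num) (by norm_num) (by norm_num)
      convert h5 using 1
      rw [smul_add, ← add_assoc, ← add_smul, smul_smul]
      norm_num
      ring_nf
    · have h4 : ‖(ε * deriv η t) • e‖ ≤ r / 2 := by
        rw [norm_smul, norm_mul, Real.norm_eq_abs ε]
        have h5 : ‖deriv η t‖ ≤ Kη := norm_deriv_le_of_lipschitz hη
        calc |ε| * ‖deriv η t‖ * ‖e‖ ≤ ε₁ * Kη * ‖e‖ := by gcongr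
          _ ≤ ε₁ * (Kη * ‖e‖ + 1) := by nlinarith
          _ ≤ r / (2 * (Kη * ‖e‖ + 1)) * (Kη * ‖e‖ + 1) := by
            gcongr
            exact min_le_right _ _
          _ = r / 2 := by field_simp
      have h6 := norm_sub_le_norm_add (deriv c t) ((ε * deriv η t) • e)
      have h7 := norm_add_le (deriv c t) ((ε * deriv η t) • e)
      exact ⟨by linarith [hv.1], by linarith [hv.2]⟩
  set J : ℝ → ℝ := fun ε => ∫ t in a..b',
    energy f (c t + (ε * η t) • e, deriv c t + (ε * deriv η t) • e) with hJ
  set F' : ℝ → ℝ → ℝ := fun ε t =>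
    η t * energyDeriv U f (c t + (ε * η t) • e, deriv c t + (ε * deriv η t) • e) (e, 0) +
    deriv η t * energyDeriv U f (c t + (ε * η t) • e, deriv c t + (ε * deriv η t) • e) (0, e)
    with hF'
  have hS : MeasurableSet (U ×ˢ ({0}ᶜ : Set V)) :=
    h.isCompact.measurableSet.prod (measurableSet_singleton _).compl
  have hmeas : ∀ ε, Measurable fun t =>
      (c t + (ε * η t) • e, deriv c t + (ε * deriv η t) • e) := by
    intro ε
    have h1 := hK.continuous.measurable
    have h2 := hη.continuous.measurable
    have h3 := measurable_deriv c
    have h4 := measurable_deriv η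
    exact (h1.add ((h2.const_mul ε).smul_const e)).prodMk
      (h3.add ((h4.const_mul ε).smul_const e))
  have hmemS : ∀ ε, |ε| < ε₁ → ∀ᵐ t ∂volume.restrict (Ioc a b'),
      (c t + (ε * η t) • e, deriv c t + (ε * deriv η t) • e) ∈ U ×ˢ ({0}ᶜ : Set V) := by
    intro ε hε
    rw [ae_restrict_iff' measurableSet_Ioc]
    filter_upwards [hdom] with t ht htm
    obtain ⟨h1, h2⟩ := ht htm ε hε
    exact ⟨interior_subset h1, ne_zero_of_mem_annulus (by positivity) h2⟩
  have hFmeas : ∀ ε, |ε| < ε₁ → AEStronglyMeasurable (fun t =>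
      energy f (c t + (ε * η t) • e, deriv c t + (ε * deriv η t) • e))
      (volume.restrict (Ioc a b')) := fun ε hε =>
    AEMeasurable.aestronglyMeasurable_comp_continuousOn h.contDiffOn_energy.continuousOn hS
      (hmeas ε).aemeasurable (hmemS ε hε)
  have hbound : ∀ w : V × V, ‖w‖ = ‖e‖ → ∀ᵐ t, t ∈ Ioc a b' → ∀ ε, |ε| < ε₁ →
      ‖energyDeriv U f (c t + (ε * η t) • e, deriv c t + (ε * deriv η t) • e) w‖ ≤ C * ‖e‖ := by
    intro w hw
    filter_upwards [hdom] with t ht htm ε hε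
    obtain ⟨h1, h2⟩ := ht htm ε hε
    rw [← hw]
    exact (ContinuousLinearMap.le_opNorm _ _).trans
      (mul_le_mul_of_nonneg_right (hC _ (interior_subset h1) _ h2) (norm_nonneg w))
  have hNt : ∀ t ∈ Ioc a b', ‖η t‖ ≤ N := fun t ht => hN t (hsub' ht)
  obtain ⟨-, hCint⟩ : IntervalIntegrable (F' 0) volume a b' ∧
      HasDerivAt J (∫ t in a..b', F' 0 t) 0 := by
    refine intervalIntegral.hasDerivAt_integral_of_dominated_loc_of_deriv_le
      (Metric.ball_mem_nhds 0 hε₁0) (bound := fun _ => N * (C * ‖e‖) + Kη * (C * ‖e‖))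
      ?_ ?_ ?_ ?_ intervalIntegrable_const ?_
    · rw [uIoc_of_le hab]
      filter_upwards [Metric.ball_mem_nhds 0 hε₁0] with ε hε
      rw [Metric.mem_ball, dist_zero_right, Real.norm_eq_abs] at hε
      exact hFmeas ε hε
    · refine intervalIntegrable_of_ae_bound (C := 1 / 2) hab (hFmeas 0 (by simpa)) ?_
      rw [ae_restrict_iff' measurableSet_Ioc]
      filter_upwards [hm.ae_hasDerivAt hd h] with t ht htm
      obtain ⟨h1, h2, h3⟩ := ht (hsub htm)
      simp [energy, h3]
    · rw [uIoc_of_le hab]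
      have h1 : ∀ w : V × V, AEStronglyMeasurable (fun t => energyDeriv U f
          (c t + ((0 : ℝ) * η t) • e, deriv c t + ((0 : ℝ) * deriv η t) • e) w)
          (volume.restrict (Ioc a b')) := fun w =>
        AEMeasurable.aestronglyMeasurable_comp_continuousOn
          (G := fun p => energyDeriv U f p w)
          (h.contDiffOn_energyDeriv.continuousOn.clm_apply continuousOn_const) hS
          (hmeas 0).aemeasurable (hmemS 0 (by simpa))
      exact (hη.continuous.aestronglyMeasurable.mul (h1 _)).add
        ((measurable_deriv η).aestronglyMeasurable.mul (h1 _))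
    · rw [uIoc_of_le hab]
      filter_upwards [hbound (e, 0) (by simp), hbound (0, e) (by simp)] with t h1 h2 htm ε hε
      rw [Metric.mem_ball, dist_zero_right, Real.norm_eq_abs] at hε
      refine (norm_add_le _ _).trans (add_le_add ?_ ?_)
      · rw [norm_mul]
        exact mul_le_mul (hNt t htm) (h1 htm ε hε) (norm_nonneg _)
          ((norm_nonneg _).trans (hNt t htm))
      · rw [norm_mul]
        exact mul_le_mul (norm_deriv_le_of_lipschitz hη) (h2 htm ε hε) (norm_nonneg _) Kη.2
    · rw [uIoc_of_le hab]
      filter_upwards [hdom] with t ht htm ε hε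
      rw [Metric.mem_ball, dist_zero_right, Real.norm_eq_abs] at hε
      obtain ⟨h1, h2⟩ := ht htm ε hε
      have h3 := (h.hasFDerivAt_energy h1 (ne_zero_of_mem_annulus (by positivity) h2))
      have h4 : HasDerivAt
          (fun ε : ℝ => (c t + (ε * η t) • e, deriv c t + (ε * deriv η t) • e))
          (η t • e, deriv η t • e) ε :=
        (hasDerivAt_add_mul_smul _ _ _ _).prodMk (hasDerivAt_add_mul_smul _ _ _ _)
      have h5 := HasFDerivAt.comp_hasDerivAt (f := fun ε : ℝ =>
        (c t + (ε * η t) • e, deriv c t + (ε * deriv η t) • e)) ε h3 h4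
      refine h5.congr_deriv ?_
      have h6 : ((η t • e, deriv η t • e) : V × V) = η t • (e, 0) + deriv η t • (0, e) := by
        simp
      rw [h6, map_add, map_smul, map_smul, smul_eq_mul, smul_eq_mul]
  -- Length is compared with energy through `f ≤ 1 / 2 + f ^ 2 / 2`, an equality at unit speed. The
  -- varied curve has length at least `b' - a`, so its energy `J ε` is at least `(b' - a) / 2 = J
  -- 0`.
  have hmin : IsLocalMin J 0 := by
    have hJ0 : J 0 = (b' - a) / 2 := by
      have : J 0 = ∫ t in a..b', (1 / 2 : ℝ) := by
        refine intervalIntegral.integral_congr_ae ?_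
        rw [uIoc_of_le hab]
        filter_upwards [hm.ae_hasDerivAt hd h] with t ht htm
        obtain ⟨h1, h2, h3⟩ := ht (hsub htm)
        simp [energy, h3]
      rw [this, intervalIntegral.integral_const, smul_eq_mul]
      ring
    filter_upwards [Metric.ball_mem_nhds 0 hε₁0] with ε hε
    rw [Metric.mem_ball, dist_zero_right, Real.norm_eq_abs] at hε
    have hεε₀ : |ε| ≤ ε₀ := by
      linarith [min_le_left (ε₀ / 2) (r / (2 * (Kη * ‖e‖ + 1)))]
    obtain ⟨L, hL⟩ := hK.exists_add_smul hη ε e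
    have h1 := hd.le_integral h hL hab (hU ε hεε₀)
    simp only [ha, mul_zero, zero_smul, add_zero] at h1
    have hJint : IntervalIntegrable (fun t => energy f
        (c t + (ε * η t) • e, deriv c t + (ε * deriv η t) • e)) volume a b' := by
      obtain ⟨m, C', -, hC'0, hb'⟩ := h.exists_bounds
      refine intervalIntegrable_of_ae_bound (C := (C' * (R + r / 2)) ^ 2 / 2) hab
        (hFmeas ε hε) ?_
      rw [ae_restrict_iff' measurableSet_Ioc]
      filter_upwards [hdom] with t ht htm
      obtain ⟨h3, h4⟩ := ht htm ε hε
      have h5 := (hb' _ (interior_subset h3) (deriv c t + (ε * deriv η t) • e)).2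
      have h6 := (h.minkowski _ (interior_subset h3)).nonneg
        (deriv c t + (ε * deriv η t) • e)
      have h7 : f (c t + (ε * η t) • e, deriv c t + (ε * deriv η t) • e) ≤
          C' * (R + r / 2) := h5.trans (mul_le_mul_of_nonneg_left h4.2 hC'0.le)
      rw [Real.norm_of_nonneg (by simp only [energy]; positivity)]
      simp only [energy]
      gcongr
    have h2 : ∫ t in a..b', f (c t + (ε * η t) • e, deriv (fun t => c t + (ε * η t) • e) t) ≤
        ∫ t in a..b', (1 / 2 +
          energy f (c t + (ε * η t) • e, deriv c t + (ε * deriv η t) • e)) := by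
      have hint := IsLocalDist.integrable_comp_deriv h hL hab (hU ε hεε₀)
      have hder : ∀ᵐ t, deriv (fun t => c t + (ε * η t) • e) t =
          deriv c t + (ε * deriv η t) • e := by
        filter_upwards [hK.ae_hasDerivAt, hη.ae_hasDerivAt] with t h3 h4
        exact (h3.add ((h4.const_mul ε).smul_const e)).deriv
      refine intervalIntegral.integral_mono_ae_restrict hab hint ?_ ?_
      · exact intervalIntegrable_const.add hJint
      · refine ae_restrict_of_ae ?_
        filter_upwards [hder] with t ht
        rw [ht]
        simp only [energy]
        nlinarith [sq_nonneg (f (c t + (ε * η t) • e, deriv c t + (ε * deriv η t) • e) - 1)]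
    have h3 : ∫ t in a..b', (1 / 2 +
        energy f (c t + (ε * η t) • e, deriv c t + (ε * deriv η t) • e)) =
        (b' - a) / 2 + J ε := by
      rw [intervalIntegral.integral_add intervalIntegrable_const hJint,
        intervalIntegral.integral_const, smul_eq_mul]
      ring
    have h4 := hlen ε hεε₀
    rw [hJ0]
    linarith
  have := hmin.hasDerivAt_eq_zero hCint
  simpa [hF'] using this

end IsLocalMinimizer

/-! ### The Du Bois-Reymond lemma and Gronwall's inequality -/

theorem ae_ne_point (b : ℝ) : ∀ᵐ t : ℝ, t ≠ b := by simp [ae_iff, measure_singleton]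

/-- The Du Bois-Reymond lemma. -/
theorem exists_ae_eq_const_add_integral {A B : ℝ → ℝ} {a b CA CB : ℝ} (hab : a < b)
    (hA : AEStronglyMeasurable A (volume.restrict (Ioc a b)))
    (hAb : ∀ᵐ t, t ∈ Ioc a b → ‖A t‖ ≤ CA)
    (hB : AEStronglyMeasurable B (volume.restrict (Ioc a b)))
    (hBb : ∀ᵐ t, t ∈ Ioc a b → ‖B t‖ ≤ CB)
    (H : ∀ (η : ℝ → ℝ) (K : NNReal), LipschitzWith K η → η a = 0 → η b = 0 →
      ∫ t in a..b, (η t * A t + deriv η t * B t) = 0) :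
    ∃ C, ∀ᵐ t, t ∈ Ioc a b → B t = C + ∫ s in a..t, A s := by
  have hAi : IntervalIntegrable A volume a b :=
    intervalIntegrable_of_ae_bound hab.le hA ((ae_restrict_iff' measurableSet_Ioc).mpr hAb)
  have hBi : IntervalIntegrable B volume a b :=
    intervalIntegrable_of_ae_bound hab.le hB ((ae_restrict_iff' measurableSet_Ioc).mpr hBb)
  set G : ℝ → ℝ := fun t => ∫ s in a..t, A s with hG
  have hGac : AbsolutelyContinuousOnInterval G a b :=
    hAi.absolutelyContinuousOnInterval_intervalIntegral (by simp)
  have hGc : ContinuousOn G (Icc a b) := by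
    simpa [uIcc_of_le hab.le] using hGac.continuousOn
  obtain ⟨CG, hCG⟩ := isCompact_Icc.exists_bound_of_continuousOn hGc
  have hGi : IntervalIntegrable G volume a b :=
    hGac.continuousOn.intervalIntegrable
  -- Subtracting the mean makes the primitive `η` of `h = B - G - m` vanish at both ends, so it is
  -- an admissible test function. Integrating `η * A` by parts then leaves `∫ h * (B - G) = 0`, and
  -- since `∫ h = 0` also `∫ h ^ 2 = 0`.
  set m : ℝ := (∫ t in a..b, (B t - G t)) / (b - a) with hm
  set h : ℝ → ℝ := (Ioc a b).indicator fun t => B t - G t - m with hh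
  have hhm : AEStronglyMeasurable h volume := by
    rw [aestronglyMeasurable_indicator_iff measurableSet_Ioc]
    exact (hB.sub ((hGc.mono Ioc_subset_Icc_self).aestronglyMeasurable measurableSet_Ioc)).sub
      aestronglyMeasurable_const
  have hhb : ∀ᵐ t, ‖h t‖ ≤ |CB| + |CG| + |m| := by
    filter_upwards [hBb] with t ht
    by_cases htm : t ∈ Ioc a b
    · rw [hh, indicator_of_mem htm]
      have h1 := ht htm
      have h2 := hCG t (Ioc_subset_Icc_self htm)
      have h3 := norm_sub_le (B t - G t) m
      have h4 := norm_sub_le (B t) (G t)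
      rw [Real.norm_eq_abs m] at h3
      linarith [le_abs_self CB, le_abs_self CG]
    · rw [hh, indicator_of_notMem htm, norm_zero]
      positivity
  have hhi : ∀ s t, IntervalIntegrable h volume s t := by
    have key : ∀ s t, s ≤ t → IntervalIntegrable h volume s t := fun s t hst =>
      intervalIntegrable_of_ae_bound hst hhm.restrict (ae_restrict_of_ae hhb)
    intro s t
    rcases le_total s t with hst | hst
    · exact key s t hst
    · exact (key t s hst).symm
  set η : ℝ → ℝ := fun t => ∫ s in a..t, h s with hη
  have hηL : LipschitzWith ⟨|CB| + |CG| + |m|, by positivity⟩ η := by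
    refine LipschitzWith.of_dist_le_mul fun s t => ?_
    rw [dist_eq_norm, hη]
    simp only
    rw [intervalIntegral.integral_interval_sub_left (hhi _ _) (hhi _ _)]
    refine (intervalIntegral.norm_integral_le_of_norm_le_const_ae
      (C := |CB| + |CG| + |m|) (by filter_upwards [hhb] with x hx _ using hx)).trans ?_
    rw [Real.dist_eq]
    rfl
  have hloc : LocallyIntegrable h volume := by
    refine Integrable.locallyIntegrable ?_
    rw [hh, integrable_indicator_iff measurableSet_Ioc,
      ← intervalIntegrable_iff_integrableOn_Ioc_of_le hab.le]
    exact (hBi.sub hGi).sub intervalIntegrable_const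
  have hηd : ∀ᵐ t, deriv η t = h t := by
    filter_upwards [_root_.LocallyIntegrable.ae_hasDerivAt_integral hloc] with t ht using (ht a).deriv
  have hηa : η a = 0 := by simp [hη]
  have hcongr : ∀ g : ℝ → ℝ, ∫ t in a..b, h t * g t = ∫ t in a..b, (B t - G t - m) * g t := by
    intro g
    refine intervalIntegral.integral_congr_ae (.of_forall fun t ht => ?_)
    rw [uIoc_of_le hab.le] at ht
    simp [hh, indicator_of_mem ht]
  have hba : b - a ≠ 0 := (sub_pos.mpr hab).ne'
  have hηb : η b = 0 := by
    have h1 := hcongr fun _ => 1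
    simp only [mul_one] at h1
    rw [hη]
    simp only
    rw [h1, intervalIntegral.integral_sub (hBi.sub hGi) intervalIntegrable_const,
      intervalIntegral.integral_const, smul_eq_mul, hm]
    field_simp
    ring
  have hηac : AbsolutelyContinuousOnInterval η a b :=
    (hηL.lipschitzOnWith (s := uIcc a b)).absolutelyContinuousOnInterval
  have hparts := hGac.integral_mul_deriv_eq_deriv_mul hηac
  rw [hηa, hηb, mul_zero, mul_zero, sub_zero, zero_sub] at hparts
  have hGd : ∫ t in a..b, deriv G t * η t = ∫ t in a..b, η t * A t := by
    refine intervalIntegral.integral_congr_ae ?_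
    filter_upwards [hAi.ae_hasDerivAt_integral] with t ht htm
    rw [(ht (uIoc_subset_uIcc htm) a (by simp)).deriv, mul_comm]
  have hH := H η _ hηL hηa hηb
  have hi1 : IntervalIntegrable (fun t => η t * A t) volume a b :=
    hAi.continuousOn_mul hηL.continuous.continuousOn
  have hbdd : ∀ g : ℝ → ℝ, IntervalIntegrable g volume a b →
      IntervalIntegrable (fun t => h t * g t) volume a b := by
    intro g hg
    rw [intervalIntegrable_iff_integrableOn_Ioc_of_le hab.le] at hg ⊢
    exact Integrable.bdd_mul hg hhm.restrict (ae_restrict_of_ae hhb)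
  have hd1 : ∀ g : ℝ → ℝ, (fun t => deriv η t * g t) =ᵐ[volume.restrict (uIoc a b)]
      fun t => h t * g t := fun g => ae_restrict_of_ae (by
    filter_upwards [hηd] with t ht
    rw [ht])
  have hi2 : IntervalIntegrable (fun t => deriv η t * B t) volume a b :=
    (hbdd B hBi).congr_ae (hd1 B).symm
  rw [intervalIntegral.integral_add hi1 hi2, ← hGd,
    intervalIntegral.integral_congr_ae_restrict (hd1 B)] at hH
  have hparts' : ∫ t in a..b, G t * deriv η t = ∫ t in a..b, h t * G t := by
    rw [← intervalIntegral.integral_congr_ae_restrict (hd1 G)]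
    exact intervalIntegral.integral_congr fun t _ => mul_comm _ _
  rw [hparts'] at hparts
  have hz : ∫ t in a..b, h t * (B t - G t - m) = 0 := by
    have h1 : (fun t => h t * (B t - G t - m)) = fun t => (h t * B t - h t * G t) - m * h t := by
      ext t
      ring
    rw [h1, intervalIntegral.integral_sub ((hbdd B hBi).sub (hbdd G hGi))
      ((hhi a b).const_mul m), intervalIntegral.integral_sub (hbdd B hBi) (hbdd G hGi),
      intervalIntegral.integral_const_mul]
    have h2 : ∫ t in a..b, h t = 0 := hηb
    rw [h2]
    linarith
  rw [hcongr, intervalIntegral.integral_of_le hab.le, integral_eq_zero_iff_of_nonneg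
    (fun t => mul_self_nonneg _)] at hz
  · refine ⟨m, ?_⟩
    rw [Filter.EventuallyEq, ae_restrict_iff' measurableSet_Ioc] at hz
    filter_upwards [hz] with t ht htm
    have := mul_self_eq_zero.mp (ht htm)
    linarith
  · have h1 := hbdd _ ((hBi.sub hGi).sub (intervalIntegrable_const (c := m)))
    rw [intervalIntegrable_iff_integrableOn_Ioc_of_le hab.le] at h1
    refine Integrable.congr h1 ?_
    rw [Filter.EventuallyEq, ae_restrict_iff' measurableSet_Ioc]
    filter_upwards with t ht
    simp [hh, indicator_of_mem ht]

/-- Gronwall's inequality in integral form, backwards in time. -/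
theorem eq_zero_of_le_mul_integral {w : ℝ → ℝ} {a b K : ℝ} (hw : ContinuousOn w (Icc a b))
    (h0 : ∀ t ∈ Icc a b, 0 ≤ w t) (hK : 0 ≤ K)
    (h : ∀ t ∈ Icc a b, w t ≤ K * ∫ s in t..b, w s) : ∀ t ∈ Icc a b, w t = 0 := by
  intro t ht
  have hab : a ≤ b := ht.1.trans ht.2
  have hwi : IntervalIntegrable w volume b a := by
    apply ContinuousOn.intervalIntegrable
    rwa [uIcc_of_ge hab]
  set W : ℝ → ℝ := fun t => ∫ s in t..b, w s with hW
  have hWe : ∀ t, W t = -∫ s in b..t, w s := fun t => intervalIntegral.integral_symm _ _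
  have hWc : ContinuousOn W (Icc a b) := by
    have := (intervalIntegral.continuousOn_primitive_interval' (a := b) hwi (by simp)).neg
    rw [uIcc_of_ge hab] at this
    exact this.congr fun t _ => hWe t
  have hWd : ∀ t ∈ Ioo a b, HasDerivAt W (-w t) t := by
    intro t ht
    have h1 : IntervalIntegrable w volume b t := by
      apply hwi.mono_set
      rw [uIcc_of_ge hab, uIcc_of_ge ht.2.le]
      exact Icc_subset_Icc_left ht.1.le
    have h2 : ContinuousAt w t := hw.continuousAt (Icc_mem_nhds ht.1 ht.2)
    have h3 : StronglyMeasurableAtFilter w (𝓝 t) volume :=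
      ⟨Icc a b, Icc_mem_nhds ht.1 ht.2, hw.aestronglyMeasurable measurableSet_Icc⟩
    have h4 := (intervalIntegral.integral_hasDerivAt_right h1 h3 h2).neg
    exact h4.congr_of_eventuallyEq (.of_forall hWe)
  -- The hypothesis says `w ≤ K * W` while `W' = -w`. The product increases to its value `0` at `b`,
  -- so `W ≤ 0`, and then `w ≤ 0`.
  have hmono : MonotoneOn (fun t => W t * Real.exp (K * t)) (Icc a b) := by
    have hder : ∀ t ∈ Ioo a b, HasDerivAt (fun t => W t * Real.exp (K * t))
        (-w t * Real.exp (K * t) + W t * (Real.exp (K * t) * K)) t := by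
      intro t ht
      have h1 : HasDerivAt (fun t => K * t) K t := by
        simpa using (hasDerivAt_id t).const_mul K
      exact (hWd t ht).mul h1.exp
    refine monotoneOn_of_deriv_nonneg (convex_Icc a b) ?_ ?_ ?_
    · exact hWc.mul (by fun_prop)
    · rw [interior_Icc]
      exact fun t ht => (hder t ht).differentiableAt.differentiableWithinAt
    · rw [interior_Icc]
      intro t ht
      rw [(hder t ht).deriv]
      have h1 := h t (Ioo_subset_Icc_self ht)
      have h2 : -w t * Real.exp (K * t) + W t * (Real.exp (K * t) * K) =
          (K * W t - w t) * Real.exp (K * t) := by ring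
      rw [h2]
      exact mul_nonneg (sub_nonneg.mpr h1) (Real.exp_pos _).le
  have h1 := hmono ht (right_mem_Icc.mpr hab) ht.2
  have hWb : W b = 0 := by simp [hW]
  simp only [hWb, zero_mul] at h1
  have h2 : W t ≤ 0 := nonpos_of_mul_nonpos_left h1 (Real.exp_pos _)
  have h3 := h t ht
  have h4 : K * W t ≤ 0 := mul_nonpos_of_nonneg_of_nonpos hK h2
  exact le_antisymm (h3.trans h4) (h0 t ht)

/-! ### Momenta of minimizers and unique continuation -/

/-- `P` is the component in the direction `e` of the momentum of the curve `c` on `[a, b]`: it is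
almost everywhere the fibre derivative of the energy, and it satisfies the Euler-Lagrange
equation. -/
structure IsMomentum {V : Type*} [NormedAddCommGroup V] [NormedSpace ℝ V] (U : Set V)
    (f : V × V → ℝ) (c : ℝ → V) (a b : ℝ) (e : V) (P : ℝ → ℝ) : Prop where
  ae_eq : ∀ᵐ t, t ∈ Ioc a b → energyDeriv U f (c t, deriv c t) (0, e) = P t
  eq_sub : ∀ t ∈ Icc a b, P t = P b - ∫ s in t..b, energyDeriv U f (c s, deriv c s) (e, 0)
  continuousOn : ContinuousOn P (Icc a b)

theorem exists_mem_Ioo_of_ae {p : ℝ → Prop} (hp : ∀ᵐ t, p t) {a b : ℝ} (hab : a < b) :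
    ∃ t ∈ Ioo a b, p t := by
  by_contra! hne
  have h1 : Ioo a b ⊆ {t | ¬ p t} := fun t ht => hne t ht
  have h2 := measure_mono_null h1 hp
  simp [hab.not_ge] at h2

namespace IsLocalMinimizer

variable {V : Type*} [NormedAddCommGroup V] [NormedSpace ℝ V] [FiniteDimensional ℝ V]
  {U : Set V} {f : V × V → ℝ} {d : V → V → ℝ} {c : ℝ → V} {a b : ℝ}

theorem exists_ae_energyDeriv_apply_bound (hm : IsLocalMinimizer U d c a b)
    (hd : IsLocalDist U f d) (h : IsFinslerFamily U f) (w : V × V) :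
    ∃ C, ∀ᵐ t, t ∈ Icc a b → ‖energyDeriv U f (c t, deriv c t) w‖ ≤ C := by
  obtain ⟨C, hC⟩ := hm.exists_ae_energyDeriv_bound hd h
  refine ⟨C * ‖w‖, ?_⟩
  filter_upwards [hC] with t ht htm
  exact (ContinuousLinearMap.le_opNorm _ _).trans
    (mul_le_mul_of_nonneg_right (ht htm) (norm_nonneg w))

/-- A norming functional for `c₁ t - c₂ t` reduces the claim to a real Lipschitz function, which is
the integral of its derivative. -/
theorem norm_sub_le_integral {c₁ c₂ : ℝ → V} {K₁ K₂ : NNReal} (h₁ : LipschitzWith K₁ c₁)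
    (h₂ : LipschitzWith K₂ c₂) {t b : ℝ} (htb : t ≤ b) (hb : c₁ b = c₂ b) {g : ℝ → ℝ}
    (hg : IntervalIntegrable g volume t b)
    (hle : ∀ᵐ s, s ∈ Ioc t b → ‖deriv c₁ s - deriv c₂ s‖ ≤ g s) :
    ‖c₁ t - c₂ t‖ ≤ ∫ s in t..b, g s := by
  obtain ⟨ξ, hξ, hξt⟩ := exists_dual_vector'' ℝ (c₁ t - c₂ t)
  set φ : ℝ → ℝ := fun s => ξ (c₁ s - c₂ s) with hφ
  have hlip : LipschitzWith (‖ξ‖₊ * (K₁ + K₂)) φ := ξ.lipschitz.comp (h₁.sub h₂)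
  have h3 := (hlip.lipschitzOnWith (s := uIcc t b)).absolutelyContinuousOnInterval
    |>.integral_deriv_eq_sub
  have h4 : φ b = 0 := by simp [hφ, hb]
  have h5 : φ t = ‖c₁ t - c₂ t‖ := hξt
  have h6 : ‖∫ s in t..b, deriv φ s‖ ≤ ∫ s in t..b, g s := by
    refine intervalIntegral.norm_integral_le_of_norm_le htb ?_ hg
    filter_upwards [h₁.ae_hasDerivAt, h₂.ae_hasDerivAt, hle] with s hs1 hs2 hs3 hsm
    have h7 : HasDerivAt φ (ξ (deriv c₁ s - deriv c₂ s)) s :=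
      ξ.hasFDerivAt.comp_hasDerivAt s (hs1.sub hs2)
    rw [h7.deriv]
    refine (ξ.le_opNorm _).trans ((mul_le_of_le_one_left (norm_nonneg _) hξ).trans (hs3 hsm))
  rw [h3, h4, h5, zero_sub, norm_neg, norm_norm] at h6
  exact h6

variable [MeasurableSpace V] [BorelSpace V]

/-- Stopping at `b' < b` keeps the curve in a compact subset of the interior of `U`, so small
variations with fixed ends are admissible in every direction. At `b` itself the curve may touch the
boundary. -/
theorem exists_const (hm : IsLocalMinimizer U d c a b) (hd : IsLocalDist U f d)
    (h : IsFinslerFamily U f) (e : V) {b' : ℝ} (hab : a < b') (hb : b' < b) :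
    ∃ C, ∀ᵐ t, t ∈ Ioc a b' → energyDeriv U f (c t, deriv c t) (0, e) =
      C + ∫ s in a..t, energyDeriv U f (c s, deriv c s) (e, 0) := by
  have hsub : Ioc a b' ⊆ Ioc a b := Ioc_subset_Ioc_right hb.le
  obtain ⟨CA, hCA⟩ := hm.exists_ae_energyDeriv_apply_bound hd h (e, 0)
  obtain ⟨CB, hCB⟩ := hm.exists_ae_energyDeriv_apply_bound hd h (0, e)
  refine exists_ae_eq_const_add_integral hab
    ((hm.aestronglyMeasurable_energyDeriv hd h (e, 0)).mono_set hsub)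
    (by filter_upwards [hCA] with t ht htm using ht (Ioc_subset_Icc_self (hsub htm)))
    ((hm.aestronglyMeasurable_energyDeriv hd h (0, e)).mono_set hsub)
    (by filter_upwards [hCB] with t ht htm using ht (Ioc_subset_Icc_self (hsub htm)))
    fun η K hη ha hb' => ?_
  obtain ⟨K', hK'⟩ := hm.lipschitz
  have hk : IsCompact (c '' Icc a b') := isCompact_Icc.image hK'.continuous
  have hkU : c '' Icc a b' ⊆ interior U := by
    rintro _ ⟨t, ht, rfl⟩
    exact hm.mem_interior t ⟨ht.1, ht.2.trans_lt hb⟩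
  obtain ⟨δ, hδ, hδU⟩ := hk.exists_cthickening_subset_open isOpen_interior hkU
  obtain ⟨N, hN⟩ := (isCompact_Icc (a := a) (b := b')).exists_bound_of_continuousOn
    hη.continuous.continuousOn
  have hN0 : 0 ≤ N := (norm_nonneg _).trans (hN a (left_mem_Icc.mpr hab.le))
  refine hm.integral_variation_eq_zero hd h hab.le hb.le hη e ha (ε₀ := δ / (N * ‖e‖ + 1))
    (by positivity) (fun ε hε t ht => ?_) (fun ε _ => ?_)
  · refine interior_subset (hδU (Metric.mem_cthickening_of_dist_le _ (c t) _ _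
      (mem_image_of_mem c ht) ?_))
    rw [dist_eq_norm, add_sub_cancel_left, norm_smul, norm_mul, Real.norm_eq_abs ε]
    calc |ε| * ‖η t‖ * ‖e‖ ≤ δ / (N * ‖e‖ + 1) * N * ‖e‖ := by
          gcongr
          exact hN t ht
      _ = δ * (N * ‖e‖ / (N * ‖e‖ + 1)) := by ring
      _ ≤ δ * 1 := by
          gcongr
          rw [div_le_one (by positivity)]
          linarith
      _ = δ := mul_one δ
  · rw [hb', mul_zero, zero_smul, add_zero, hm.dist_eq a b' le_rfl hab.le hb.le]

/-- The intervals `[a, β k]` exhaust `[a, b)` and overlap, so their constants agree. The integrand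
is integrable up to `b`, which extends the momentum continuously to the end point. -/
theorem exists_isMomentum (hm : IsLocalMinimizer U d c a b) (hd : IsLocalDist U f d)
    (h : IsFinslerFamily U f) (hab : a < b) (e : V) : ∃ P, IsMomentum U f c a b e P := by
  set A : ℝ → ℝ := fun s => energyDeriv U f (c s, deriv c s) (e, 0) with hA
  have hAi : IntervalIntegrable A volume a b :=
    hm.intervalIntegrable_energyDeriv hd h hab.le (e, 0)
  have hAi' : ∀ t ∈ Icc a b, IntervalIntegrable A volume a t ∧ IntervalIntegrable A volume t b := by
    intro t ht
    constructor
    · apply hAi.mono_set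
      rw [uIcc_of_le hab.le, uIcc_of_le ht.1]
      exact Icc_subset_Icc_right ht.2
    · apply hAi.mono_set
      rw [uIcc_of_le hab.le, uIcc_of_le ht.2]
      exact Icc_subset_Icc_left ht.1
  -- With `k + 2` already `β 0`, the midpoint, exceeds `a`.
  set β : ℕ → ℝ := fun k => b - (b - a) / (k + 2) with hβ
  have hba : 0 < b - a := sub_pos.mpr hab
  have hβa : ∀ k, a < β k := fun k => by
    have : (b - a) / (k + 2) < b - a := by
      rw [div_lt_iff₀ (by positivity)]
      nlinarith [(Nat.cast_nonneg k : (0 : ℝ) ≤ k)]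
    simp only [hβ]
    linarith
  have hβb : ∀ k, β k < b := fun k => by
    have : 0 < (b - a) / (k + 2) := by positivity
    simp only [hβ]
    linarith
  choose C hC using fun k => hm.exists_const hd h e (hβa k) (hβb k)
  have hCeq : ∀ k, C k = C 0 := by
    intro k
    obtain ⟨t, ht, h1, h2⟩ := exists_mem_Ioo_of_ae ((hC k).and (hC 0))
      (lt_min (hβa k) (hβa 0))
    have h3 := h1 ⟨ht.1, ht.2.le.trans (min_le_left _ _)⟩
    have h4 := h2 ⟨ht.1, ht.2.le.trans (min_le_right _ _)⟩
    linarith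
  refine ⟨fun t => C 0 + ∫ s in a..t, A s, ?_, ?_, ?_⟩
  · filter_upwards [ae_all_iff.mpr hC, ae_ne_point b] with t ht htb htm
    have htb' : t < b := lt_of_le_of_ne htm.2 htb
    obtain ⟨k, hk⟩ := exists_nat_ge ((b - a) / (b - t))
    have hk' : t ≤ β k := by
      rw [div_le_iff₀ (sub_pos.mpr htb')] at hk
      have h1 : (b - a) / (k + 2) ≤ b - t := by
        rw [div_le_iff₀ (by positivity)]
        nlinarith
      simp only [hβ]
      linarith
    rw [ht k ⟨htm.1, hk'⟩, hCeq k]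
  · intro t ht
    have := intervalIntegral.integral_add_adjacent_intervals (hAi' t ht).1 (hAi' t ht).2
    rw [← this]
    ring
  · have := intervalIntegral.continuousOn_primitive_interval' (a := a) hAi (by simp)
    rw [uIcc_of_le hab.le] at this
    exact continuousOn_const.add this

/-- The natural boundary condition: if the end of a minimizer can be moved in the direction `e`
without getting closer to its start, then the momentum in the direction `e` vanishes there. -/
theorem momentum_end_eq_zero (hm : IsLocalMinimizer U d c a b) (hd : IsLocalDist U f d)
    (h : IsFinslerFamily U f) (hab : a < b) {e : V} {P : ℝ → ℝ}
    (hP : IsMomentum U f c a b e P) {ε₀ : ℝ} (hε₀ : 0 < ε₀)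
    (hU : ∀ ε, |ε| ≤ ε₀ → ∀ t ∈ Icc a b, c t + (ε * (t - a)) • e ∈ U)
    (hlen : ∀ ε, |ε| ≤ ε₀ → b - a ≤ d (c a) (c b + (ε * (b - a)) • e)) : P b = 0 := by
  -- This variation field vanishes at the start but not at the end. Integrating by parts with the
  -- Euler-Lagrange equation leaves only the boundary term `(b - a) * P b`.
  have hη : LipschitzWith 1 fun t : ℝ => t - a := LipschitzWith.of_dist_le_mul fun s t => by
    simp [Real.dist_eq]
  have h1 := hm.integral_variation_eq_zero hd h hab.le le_rfl hη e (sub_self a) hε₀ hU hlen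
  set A : ℝ → ℝ := fun s => energyDeriv U f (c s, deriv c s) (e, 0) with hA
  have hAi : IntervalIntegrable A volume a b :=
    hm.intervalIntegrable_energyDeriv hd h hab.le (e, 0)
  set G : ℝ → ℝ := fun t => ∫ s in a..t, A s with hG
  have hPG : ∀ t ∈ Icc a b, P t = P b - G b + G t := by
    intro t ht
    have h2 := hP.eq_sub t ht
    have h3 := intervalIntegral.integral_interval_sub_left (a := a) (b := b) (c := t)
      (f := A) hAi (hAi.mono_set (by
        rw [uIcc_of_le hab.le, uIcc_of_le ht.1]
        exact Icc_subset_Icc_right ht.2))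
    rw [h2, ← h3]
    ring
  have hder : ∀ t, deriv (fun t : ℝ => t - a) t = 1 := fun t => by simp
  have h2 : ∫ t in a..b, ((t - a) * A t + deriv (fun t : ℝ => t - a) t *
      energyDeriv U f (c t, deriv c t) (0, e)) =
      ∫ t in a..b, ((P b - G b) + (deriv (fun t : ℝ => t - a) t * G t +
        (t - a) * deriv G t)) := by
    refine intervalIntegral.integral_congr_ae ?_
    filter_upwards [hP.ae_eq, hAi.ae_hasDerivAt_integral] with t ht1 ht2 htm
    have h3 := (ht2 (uIoc_subset_uIcc htm) a (by simp)).deriv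
    rw [uIoc_of_le hab.le] at htm
    rw [hder, ht1 htm, hPG t (Ioc_subset_Icc_self htm), h3]
    ring
  have hGac : AbsolutelyContinuousOnInterval G a b :=
    hAi.absolutelyContinuousOnInterval_intervalIntegral (by simp)
  have hηac : AbsolutelyContinuousOnInterval (fun t : ℝ => t - a) a b :=
    (hη.lipschitzOnWith (s := uIcc a b)).absolutelyContinuousOnInterval
  rw [h2, intervalIntegral.integral_add intervalIntegrable_const,
    hηac.integral_deriv_mul_eq_sub hGac, intervalIntegral.integral_const] at h1
  · simp only [smul_eq_mul, sub_self, zero_mul, sub_zero] at h1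
    have h3 : (b - a) * P b = 0 := by linarith
    exact (mul_eq_zero.mp h3).resolve_left (sub_pos.mpr hab).ne'
  · exact (hηac.intervalIntegrable_deriv.mul_continuousOn hGac.continuousOn).add
      (hGac.intervalIntegrable_deriv.continuousOn_mul hηac.continuousOn)

/-- Minimizers are determined by their end point and the momentum there. -/
theorem eqOn_of_momentum_eq (h : IsFinslerFamily U f) (hd : IsLocalDist U f d) {c₁ c₂ : ℝ → V}
    (h₁ : IsLocalMinimizer U d c₁ a b) (h₂ : IsLocalMinimizer U d c₂ a b)
    {ι : Type*} [Fintype ι] (bs : Module.Basis ι ℝ V) {P₁ P₂ : ι → ℝ → ℝ}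
    (hP₁ : ∀ i, IsMomentum U f c₁ a b (bs i) (P₁ i))
    (hP₂ : ∀ i, IsMomentum U f c₂ a b (bs i) (P₂ i))
    (hcb : c₁ b = c₂ b) (hPb : ∀ i, P₁ i b = P₂ i b) : EqOn c₁ c₂ (Icc a b) := by
  obtain ⟨K₁, hK₁⟩ := h₁.lipschitz
  obtain ⟨K₂, hK₂⟩ := h₂.lipschitz
  obtain ⟨r, R, hr, hrR⟩ := exists_annulus h
  obtain ⟨L, hL0, hL⟩ := h.exists_energyDeriv_lipschitz (R := R) hr
  obtain ⟨μ, hμ0, hμ⟩ := h.exists_monotone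
  set κ : ℝ := ‖(bs.equivFunL : V →L[ℝ] ι → ℝ)‖ with hκ
  have hcoord : ∀ u i, |bs.equivFun u i| ≤ κ * ‖u‖ := fun u i =>
    (norm_le_pi_norm (bs.equivFun u) i).trans ((bs.equivFunL : V →L[ℝ] ι → ℝ).le_opNorm u)
  set Q : ℝ → ℝ := fun t => ∑ i, |P₁ i t - P₂ i t| with hQ
  -- Position and momentum together satisfy a first-order system, so their combined gap is the
  -- quantity to which Gronwall applies.
  set w : ℝ → ℝ := fun t => ‖c₁ t - c₂ t‖ + Q t with hw
  have hQ0 : ∀ t, 0 ≤ Q t := fun t => Finset.sum_nonneg fun i _ => abs_nonneg _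
  have hw0 : ∀ t, 0 ≤ w t := fun t => add_nonneg (norm_nonneg _) (hQ0 t)
  have hwc : ContinuousOn w (Icc a b) := by
    refine ((hK₁.continuous.sub hK₂.continuous).norm.continuousOn).add
      (continuousOn_finsetSum _ fun i _ => ?_)
    exact ((hP₁ i).continuousOn.sub (hP₂ i).continuousOn).abs
  set k₁ : ℝ := (κ + L) / μ with hk₁
  have hk₁0 : 0 ≤ k₁ := by positivity
  -- Strong monotonicity inverts the Legendre transform: up to the Lipschitz dependence on the base
  -- point, a gap in velocity costs a proportional gap in momentum. The derivatives of both parts of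
  -- `w` are thus bounded by multiples of `w`.
  have hvel : ∀ᵐ s, s ∈ Ioc a b → ‖deriv c₁ s - deriv c₂ s‖ ≤ k₁ * w s ∧
      ∀ i, |energyDeriv U f (c₁ s, deriv c₁ s) (bs i, 0) -
        energyDeriv U f (c₂ s, deriv c₂ s) (bs i, 0)| ≤ L * (1 + k₁) * ‖bs i‖ * w s := by
    filter_upwards [h₁.ae_hasDerivAt hd h, h₂.ae_hasDerivAt hd h,
      ae_all_iff.mpr fun i => (hP₁ i).ae_eq, ae_all_iff.mpr fun i => (hP₂ i).ae_eq]
      with s hs1 hs2 hB1 hB2 hsm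
    obtain ⟨hx1, -, hf1⟩ := hs1 (Ioc_subset_Icc_self hsm)
    obtain ⟨hx2, -, hf2⟩ := hs2 (Ioc_subset_Icc_self hsm)
    replace hx1 := interior_subset hx1
    replace hx2 := interior_subset hx2
    have hv1 := hrR _ hx1 _ hf1
    have hv2 := hrR _ hx2 _ hf2
    set u := deriv c₁ s - deriv c₂ s with hu
    have h3 := hμ _ hx1 _ _ (ne_zero_of_mem_annulus hr hv1) (ne_zero_of_mem_annulus hr hv2)
    rw [← hu] at h3
    have h4 : (energyDeriv U f (c₁ s, deriv c₁ s) - energyDeriv U f (c₂ s, deriv c₂ s)) (0, u) ≤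
        κ * ‖u‖ * Q s := by
      have h5 : ((0, u) : V × V) = ∑ i, bs.equivFun u i • ((0, bs i) : V × V) := by
        ext1
        · simp [Prod.fst_sum]
        · simp [Prod.snd_sum]
      rw [h5, map_sum, hQ, Finset.mul_sum]
      refine Finset.sum_le_sum fun i _ => ?_
      rw [map_smul, smul_eq_mul, sub_apply, hB1 i hsm, hB2 i hsm]
      refine (le_abs_self _).trans ?_
      rw [abs_mul]
      exact mul_le_mul_of_nonneg_right (hcoord u i) (abs_nonneg _)
    have h5 : (energyDeriv U f (c₂ s, deriv c₂ s) - energyDeriv U f (c₁ s, deriv c₂ s)) (0, u) ≤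
        L * ‖c₁ s - c₂ s‖ * ‖u‖ := by
      refine (Real.le_norm_self _).trans ((ContinuousLinearMap.le_opNorm _ _).trans ?_)
      have h6 := hL _ hx2 _ hx1 _ hv2 _ hv2
      rw [sub_self, norm_zero, add_zero, norm_sub_rev (c₂ s)] at h6
      have h7 : ‖((0, u) : V × V)‖ = ‖u‖ := by simp
      rw [h7]
      gcongr
    have h6 : ‖u‖ ≤ k₁ * w s := by
      have h7 : μ * ‖u‖ ^ 2 ≤ (κ + L) * w s * ‖u‖ := by
        simp only [sub_apply] at h3 h4 h5
        have h8 : κ * ‖u‖ * Q s + L * ‖c₁ s - c₂ s‖ * ‖u‖ ≤ (κ + L) * w s * ‖u‖ := by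
          have h9 : 0 ≤ κ * ‖c₁ s - c₂ s‖ * ‖u‖ := by positivity
          have h10 : 0 ≤ L * Q s * ‖u‖ :=
            mul_nonneg (mul_nonneg hL0.le (hQ0 s)) (norm_nonneg u)
          simp only [hw]
          nlinarith
        linarith
      rcases (norm_nonneg u).eq_or_lt with h0 | h0
      · rw [← h0]
        exact mul_nonneg hk₁0 (hw0 s)
      · rw [hk₁, div_mul_eq_mul_div, le_div_iff₀ hμ0]
        nlinarith
    refine ⟨h6, fun i => ?_⟩
    have h7 := hL _ hx1 _ hx2 _ hv1 _ hv2
    have h8 : ‖c₁ s - c₂ s‖ ≤ w s := by simp only [hw]; linarith [hQ0 s]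
    rw [← sub_apply, ← Real.norm_eq_abs]
    refine (ContinuousLinearMap.le_opNorm _ _).trans ?_
    have h9 : ‖((bs i, 0) : V × V)‖ = ‖bs i‖ := by simp
    rw [h9]
    calc _ ≤ L * (w s + k₁ * w s) * ‖bs i‖ := by
          gcongr
          exact h7.trans (by gcongr)
      _ = _ := by ring
  have hwi : ∀ t ∈ Icc a b, IntervalIntegrable w volume t b := by
    intro t ht
    apply ContinuousOn.intervalIntegrable
    rw [uIcc_of_le ht.2]
    exact hwc.mono (Icc_subset_Icc_left ht.1)
  set k₂ : ℝ := ∑ i, L * (1 + k₁) * ‖bs i‖ with hk₂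
  have hk₂0 : 0 ≤ k₂ := Finset.sum_nonneg fun i _ => by positivity
  have hgron : ∀ t ∈ Icc a b, w t ≤ (k₁ + k₂) * ∫ s in t..b, w s := by
    intro t ht
    have hsub : Ioc t b ⊆ Ioc a b := Ioc_subset_Ioc_left ht.1
    have h3 : ‖c₁ t - c₂ t‖ ≤ ∫ s in t..b, k₁ * w s := by
      refine norm_sub_le_integral hK₁ hK₂ ht.2 hcb ((hwi t ht).const_mul k₁) ?_
      filter_upwards [hvel] with s hs hsm using (hs (hsub hsm)).1
    have h4 : Q t ≤ k₂ * ∫ s in t..b, w s := by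
      rw [hk₂, Finset.sum_mul]
      refine Finset.sum_le_sum fun i _ => ?_
      have hab : a ≤ b := ht.1.trans ht.2
      have hi : uIcc t b ⊆ uIcc a b := by
        rw [uIcc_of_le hab, uIcc_of_le ht.2]
        exact Icc_subset_Icc_left ht.1
      have hi1 := (h₁.intervalIntegrable_energyDeriv hd h hab (bs i, 0)).mono_set hi
      have hi2 := (h₂.intervalIntegrable_energyDeriv hd h hab (bs i, 0)).mono_set hi
      have h5 : P₁ i t - P₂ i t = -∫ s in t..b, (energyDeriv U f (c₁ s, deriv c₁ s) (bs i, 0) -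
          energyDeriv U f (c₂ s, deriv c₂ s) (bs i, 0)) := by
        rw [(hP₁ i).eq_sub t ht, (hP₂ i).eq_sub t ht, hPb i, intervalIntegral.integral_sub hi1 hi2]
        ring
      rw [h5, abs_neg, ← Real.norm_eq_abs, ← intervalIntegral.integral_const_mul]
      refine intervalIntegral.norm_integral_le_of_norm_le ht.2 ?_ ((hwi t ht).const_mul _)
      filter_upwards [hvel] with s hs hsm using (hs (hsub hsm)).2 i
    rw [intervalIntegral.integral_const_mul] at h3
    simp only [hw] at h3 h4 ⊢
    linarith
  intro t ht
  have h3 := eq_zero_of_le_mul_integral hwc (fun t _ => hw0 t) (add_nonneg hk₁0 hk₂0) hgron t ht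
  have h4 : ‖c₁ t - c₂ t‖ ≤ 0 := by
    simp only [hw] at h3
    linarith [hQ0 t]
  exact sub_eq_zero.mp (norm_le_zero_iff.mp h4)

/-- Minimizers which agree at the end agree everywhere. -/
theorem eqOn_of_eqOn_Icc (h : IsFinslerFamily U f) (hd : IsLocalDist U f d) {c₁ c₂ : ℝ → V}
    (h₁ : IsLocalMinimizer U d c₁ a b) (h₂ : IsLocalMinimizer U d c₂ a b) {s : ℝ}
    (has : a ≤ s) (hsb : s < b) (heq : EqOn c₁ c₂ (Icc s b)) : EqOn c₁ c₂ (Icc a b) := by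
  have hab := has.trans_lt hsb
  have bs := Module.finBasis ℝ V
  choose P₁ hP₁ using fun i => h₁.exists_isMomentum hd h hab (bs i)
  choose P₂ hP₂ using fun i => h₂.exists_isMomentum hd h hab (bs i)
  refine eqOn_of_momentum_eq h hd h₁ h₂ bs hP₁ hP₂ (heq (right_mem_Icc.mpr hsb.le)) fun i => ?_
  -- Where the curves coincide so do their velocities, hence almost everywhere their momenta;
  -- continuity carries this to `b`.
  have hae : ∀ᵐ t, t ∈ Ioo s b → P₁ i t = P₂ i t := by
    filter_upwards [(hP₁ i).ae_eq, (hP₂ i).ae_eq] with t h3 h4 htm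
    have htm' : t ∈ Ioc a b := ⟨has.trans_lt htm.1, htm.2.le⟩
    rw [← h3 htm', ← h4 htm', heq (Ioo_subset_Icc_self htm)]
    have h5 : c₁ =ᶠ[𝓝 t] c₂ := by
      filter_upwards [Ioo_mem_nhds htm.1 htm.2] with x hx using heq (Ioo_subset_Icc_self hx)
    rw [h5.deriv_eq]
  by_contra hne
  have hcont : ContinuousOn (fun t => P₁ i t - P₂ i t) (Icc a b) :=
    (hP₁ i).continuousOn.sub (hP₂ i).continuousOn
  have h3 : ∀ᶠ t in 𝓝[Icc a b] b, P₁ i t - P₂ i t ≠ 0 :=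
    (hcont b (right_mem_Icc.mpr hab.le)).eventually_ne (sub_ne_zero.mpr hne)
  rw [nhdsWithin_Icc_eq_nhdsLE hab, eventually_nhdsWithin_iff, Metric.eventually_nhds_iff] at h3
  obtain ⟨δ, hδ, h3⟩ := h3
  obtain ⟨t, ht, h4⟩ := exists_mem_Ioo_of_ae hae (max_lt hsb (sub_lt_self b hδ))
  refine h3 (y := t) ?_ ht.2.le (sub_eq_zero.mpr (h4 ⟨(le_max_left _ _).trans_lt ht.1, ht.2⟩))
  rw [Real.dist_eq, abs_lt]
  constructor <;> linarith [(le_max_right s (b - δ)).trans_lt ht.1, ht.2]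

end IsLocalMinimizer

/-! ### Minimizers reaching the boundary -/

namespace IsLocalMinimizer

variable {V : Type*} [NormedAddCommGroup V] [NormedSpace ℝ V] [FiniteDimensional ℝ V]
  {U : Set V} {f : V × V → ℝ} {d : V → V → ℝ} {c : ℝ → V} {a b : ℝ}

/-- A limit velocity of a minimizer at its end, at which the functional `ℓ` decreases. -/
theorem exists_end_velocity (hm : IsLocalMinimizer U d c a b) (hd : IsLocalDist U f d)
    (h : IsFinslerFamily U f) (hab : a < b) {ι : Type*} [Finite ι] {e : ι → V} {P : ι → ℝ → ℝ}
    (hP : ∀ i, IsMomentum U f c a b (e i) (P i)) (ℓ : V →L[ℝ] ℝ)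
    (hℓ : ∀ t ∈ Ico a b, ℓ (c b) < ℓ (c t)) :
    ∃ v, f (c b, v) = 1 ∧ ℓ v ≤ 0 ∧ ∀ i, energyDeriv U f (c b, v) (0, e i) = P i b := by
  obtain ⟨K, hK⟩ := hm.lipschitz
  obtain ⟨r, R, hr, hrR⟩ := exists_annulus h
  have hgood := (hm.ae_hasDerivAt hd h).and (ae_all_iff.mpr fun i => (hP i).ae_eq)
  -- Otherwise `ℓ` would be nondecreasing along the curve on `[s, b]`, against `ℓ (c b) < ℓ (c s)`.
  -- Such good times accumulate at `b`, and compactness of the annulus provides the limit velocity.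
  have hex : ∀ s ∈ Ico a b, ∃ t ∈ Ioo s b, f (c t, deriv c t) = 1 ∧ ℓ (deriv c t) ≤ 0 ∧
      ∀ i, energyDeriv U f (c t, deriv c t) (0, e i) = P i t := by
    intro s hs
    by_contra! hne
    have hlip : LipschitzWith (‖ℓ‖₊ * K) fun t => ℓ (c t) := ℓ.lipschitz.comp hK
    have h3 := (hlip.lipschitzOnWith (s := uIcc s b)).absolutelyContinuousOnInterval
      |>.integral_deriv_eq_sub
    have h4 : 0 ≤ ∫ t in s..b, deriv (fun t => ℓ (c t)) t := by
      refine intervalIntegral.integral_nonneg_of_ae_restrict hs.2.le ?_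
      rw [Filter.EventuallyLE, ae_restrict_iff' measurableSet_Icc]
      filter_upwards [hgood, ae_ne_point s, ae_ne_point b] with t ht hts htb htm
      have hto : t ∈ Ioo s b := ⟨lt_of_le_of_ne htm.1 hts.symm, lt_of_le_of_ne htm.2 htb⟩
      obtain ⟨-, h5, h6⟩ := ht.1 ⟨hs.1.trans htm.1, htm.2⟩
      have h7 : HasDerivAt (fun t => ℓ (c t)) (ℓ (deriv c t)) t :=
        ℓ.hasFDerivAt.comp_hasDerivAt t h5
      rw [h7.deriv]
      by_contra hlt
      obtain ⟨i, hi⟩ := hne t hto h6 (not_le.mp hlt).le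
      exact hi (ht.2 i ⟨hs.1.trans_lt hto.1, htm.2⟩)
    rw [h3] at h4
    linarith [hℓ s hs]
  obtain ⟨s, hsm, hsm', hst⟩ := exists_seq_strictMono_tendsto' hab
  choose t ht hf hv hB using fun k => hex (s k) ⟨(hsm' k).1.le, (hsm' k).2⟩
  have htb : Filter.Tendsto t Filter.atTop (𝓝 b) :=
    tendsto_of_tendsto_of_tendsto_of_le_of_le hst tendsto_const_nhds
      (fun k => (ht k).1.le) fun k => (ht k).2.le
  have htI : ∀ k, t k ∈ Icc a b := fun k => ⟨(hsm' k).1.le.trans (ht k).1.le, (ht k).2.le⟩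
  have hann : ∀ k, deriv c (t k) ∈ annulus V r R := fun k => hrR _ (hm.mem _ (htI k)) _ (hf k)
  obtain ⟨v, hvann, φ, hφ, hφv⟩ := (isCompact_annulus V r R).tendsto_subseq hann
  have hbU : c b ∈ U := hm.mem b (right_mem_Icc.mpr hab.le)
  have htφ : Filter.Tendsto (t ∘ φ) Filter.atTop (𝓝 b) := htb.comp hφ.tendsto_atTop
  have hcφ : Filter.Tendsto (fun k => (c (t (φ k)), deriv c (t (φ k)))) Filter.atTop
      (𝓝 (c b, v)) := ((hK.continuous.tendsto b).comp htφ).prodMk_nhds hφv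
  refine ⟨v, ?_, ?_, fun i => ?_⟩
  · have h1 : Filter.Tendsto (fun k => (c (t (φ k)), deriv c (t (φ k)))) Filter.atTop
        (𝓝[U ×ˢ univ] (c b, v)) := tendsto_nhdsWithin_iff.mpr
      ⟨hcφ, .of_forall fun k => ⟨hm.mem _ (htI _), mem_univ _⟩⟩
    have h2 := (h.continuousOn (c b, v) ⟨hbU, mem_univ v⟩).tendsto.comp h1
    exact tendsto_nhds_unique h2 (tendsto_const_nhds.congr fun k => (hf (φ k)).symm)
  · exact le_of_tendsto ((ℓ.continuous.tendsto v).comp hφv) (.of_forall fun k => hv (φ k))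
  · have h1 : Filter.Tendsto (fun k => (c (t (φ k)), deriv c (t (φ k)))) Filter.atTop
        (𝓝[U ×ˢ {0}ᶜ] (c b, v)) := tendsto_nhdsWithin_iff.mpr
      ⟨hcφ, .of_forall fun k => ⟨hm.mem _ (htI _), ne_zero_of_mem_annulus hr (hann _)⟩⟩
    have h2 : ContinuousOn (fun p => energyDeriv U f p (0, e i)) (U ×ˢ {0}ᶜ) :=
      h.contDiffOn_energyDeriv.continuousOn.clm_apply continuousOn_const
    have h3 := (h2 (c b, v) ⟨hbU, ne_zero_of_mem_annulus hr hvann⟩).tendsto.comp h1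
    have h4 : Filter.Tendsto (t ∘ φ) Filter.atTop (𝓝[Icc a b] b) :=
      tendsto_nhdsWithin_iff.mpr ⟨htφ, .of_forall fun k => htI (φ k)⟩
    have h5 := ((hP i).continuousOn b (right_mem_Icc.mpr hab.le)).tendsto.comp h4
    exact tendsto_nhds_unique h3 (h5.congr fun k => (hB (φ k) i).symm)

variable [MeasurableSpace V] [BorelSpace V]

/-- Minimizers which hit the hyperplane `bs.coord i₀ = 0` from the same side, at the same point and
orthogonally, agree. -/
theorem eqOn_of_coord_pos (h : IsFinslerFamily U f) (hd : IsLocalDist U f d) {c₁ c₂ : ℝ → V}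
    (h₁ : IsLocalMinimizer U d c₁ a b) (h₂ : IsLocalMinimizer U d c₂ a b) (hab : a < b)
    {ι : Type*} [Fintype ι] [DecidableEq ι] (bs : Module.Basis ι ℝ V) (i₀ : ι)
    (hcb : c₁ b = c₂ b) (h0 : bs.coord i₀ (c₁ b) = 0)
    (hpos₁ : ∀ t ∈ Ico a b, 0 < bs.coord i₀ (c₁ t)) (hpos₂ : ∀ t ∈ Ico a b, 0 < bs.coord i₀ (c₂ t))
    {ε₀ : ℝ} (hε₀ : 0 < ε₀)
    (hU₁ : ∀ i ≠ i₀, ∀ ε, |ε| ≤ ε₀ → ∀ t ∈ Icc a b, c₁ t + (ε * (t - a)) • bs i ∈ U)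
    (hU₂ : ∀ i ≠ i₀, ∀ ε, |ε| ≤ ε₀ → ∀ t ∈ Icc a b, c₂ t + (ε * (t - a)) • bs i ∈ U)
    (hlen₁ : ∀ i ≠ i₀, ∀ ε, |ε| ≤ ε₀ → b - a ≤ d (c₁ a) (c₁ b + (ε * (b - a)) • bs i))
    (hlen₂ : ∀ i ≠ i₀, ∀ ε, |ε| ≤ ε₀ → b - a ≤ d (c₂ a) (c₂ b + (ε * (b - a)) • bs i)) :
    EqOn c₁ c₂ (Icc a b) := by
  choose P₁ hP₁ using fun i => h₁.exists_isMomentum hd h hab (bs i)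
  choose P₂ hP₂ using fun i => h₂.exists_isMomentum hd h hab (bs i)
  have hz₁ : ∀ i ≠ i₀, P₁ i b = 0 := fun i hi =>
    h₁.momentum_end_eq_zero hd h hab (hP₁ i) hε₀ (hU₁ i hi) (hlen₁ i hi)
  have hz₂ : ∀ i ≠ i₀, P₂ i b = 0 := fun i hi =>
    h₂.momentum_end_eq_zero hd h hab (hP₂ i) hε₀ (hU₂ i hi) (hlen₂ i hi)
  set ℓ : V →L[ℝ] ℝ := LinearMap.toContinuousLinearMap (bs.coord i₀) with hℓ
  have hℓa : ∀ v, ℓ v = bs.coord i₀ v := fun v => rfl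
  obtain ⟨v₁, hf₁, hv₁, hB₁⟩ := h₁.exists_end_velocity hd h hab hP₁ ℓ fun t ht => by
    rw [hℓa, hℓa, h0]
    exact hpos₁ t ht
  obtain ⟨v₂, hf₂, hv₂, hB₂⟩ := h₂.exists_end_velocity hd h hab hP₂ ℓ fun t ht => by
    rw [hℓa, hℓa, ← hcb, h0]
    exact hpos₂ t ht
  -- A covector killing all basis directions but `bs i₀` is a multiple of `ℓ`; for the end momenta
  -- only one scalar remains unknown.
  have hlin : ∀ (T : V × V →L[ℝ] ℝ) (p : ι → ℝ), (∀ i, T (0, bs i) = p i) →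
      (∀ i ≠ i₀, p i = 0) → ∀ u, T (0, u) = ℓ u * p i₀ := by
    intro T p hT hp u
    have h5 : ((0, u) : V × V) = ∑ i, bs.equivFun u i • ((0, bs i) : V × V) := by
      ext1
      · simp [Prod.fst_sum]
      · simp [Prod.snd_sum]
    rw [h5, map_sum, Finset.sum_eq_single i₀]
    · rw [map_smul, hT, smul_eq_mul]
      rfl
    · intro i _ hi
      rw [map_smul, hT, hp i hi, smul_zero]
    · simp
  have hl₁ := hlin _ _ hB₁ hz₁
  have hl₂ := hlin _ _ hB₂ hz₂
  have hbU : c₁ b ∈ U := h₁.mem b (right_mem_Icc.mpr hab.le)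
  obtain ⟨r, R, hr, hrR⟩ := exists_annulus h
  rw [← hcb] at hf₂ hl₂
  have hne₁ := ne_zero_of_mem_annulus hr (hrR _ hbU _ hf₁)
  have hne₂ := ne_zero_of_mem_annulus hr (hrR _ hbU _ hf₂)
  have he₁ : ℓ v₁ * P₁ i₀ b = 1 := by
    rw [← hl₁, h.energyDeriv_apply_self hbU hne₁, hf₁, one_pow]
  have he₂ : ℓ v₂ * P₂ i₀ b = 1 := by
    rw [← hl₂, h.energyDeriv_apply_self hbU hne₂, hf₂, one_pow]
  -- Euler's identity at unit speed gives `ℓ vᵢ * pᵢ = 1` with `ℓ vᵢ < 0`. The function `x ↦ 1 / x`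
  -- decreases on the negative axis, so `(ℓ v₁ - ℓ v₂) * (p₁ - p₂) ≤ 0`, which strong monotonicity
  -- allows only for `v₁ = v₂`. The common sign matters: inward and outward normals are different
  -- solutions.
  have hveq : v₁ = v₂ := by
    obtain ⟨μ, hμ0, hμ⟩ := h.exists_monotone
    have h3 := hμ _ hbU _ _ hne₁ hne₂
    rw [sub_apply, hl₁, hl₂, map_sub] at h3
    have hneg₁ : ℓ v₁ < 0 := lt_of_le_of_ne hv₁ fun h0 => by simp [h0] at he₁
    have hneg₂ : ℓ v₂ < 0 := lt_of_le_of_ne hv₂ fun h0 => by simp [h0] at he₂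
    have hp : 0 < ℓ v₁ * ℓ v₂ := mul_pos_of_neg_of_neg hneg₁ hneg₂
    have h4 : ℓ v₁ * ℓ v₂ * ((ℓ v₁ - ℓ v₂) * P₁ i₀ b - (ℓ v₁ - ℓ v₂) * P₂ i₀ b) =
        -(ℓ v₁ - ℓ v₂) ^ 2 := by
      linear_combination ((ℓ v₁ - ℓ v₂) * ℓ v₂) * he₁ - ((ℓ v₁ - ℓ v₂) * ℓ v₁) * he₂
    have h5 : (ℓ v₁ - ℓ v₂) * P₁ i₀ b - (ℓ v₁ - ℓ v₂) * P₂ i₀ b ≤ 0 := by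
      by_contra! h6
      have := mul_pos hp h6
      nlinarith [sq_nonneg (ℓ v₁ - ℓ v₂)]
    have h6 : ‖v₁ - v₂‖ ^ 2 ≤ 0 := by
      by_contra! h7
      linarith [mul_pos hμ0 h7]
    have h7 : ‖v₁ - v₂‖ = 0 := by
      have := sq_nonneg ‖v₁ - v₂‖
      exact pow_eq_zero_iff two_ne_zero |>.mp (le_antisymm h6 this)
    exact sub_eq_zero.mp (norm_eq_zero.mp h7)
  refine eqOn_of_momentum_eq h hd h₁ h₂ bs hP₁ hP₂ hcb fun i => ?_
  rw [← hB₁, ← hB₂, ← hcb, hveq]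

end IsLocalMinimizer

/-! ### Finsler functions in charts -/

theorem fundamentalForm_comp_linear {V W : Type*} [NormedAddCommGroup V] [NormedSpace ℝ V]
    [NormedAddCommGroup W] [NormedSpace ℝ W] (f : W → ℝ) (L : V →L[ℝ] W) (y v w : V) :
    fundamentalForm (fun v => f (L v)) y v w = fundamentalForm f (L y) (L v) (L w) := by
  simp [fundamentalForm]

theorem IsMinkowskiNorm.comp_injective {V W : Type*} [NormedAddCommGroup V] [NormedSpace ℝ V]
    [NormedAddCommGroup W] [NormedSpace ℝ W] {f : W → ℝ} (hf : IsMinkowskiNorm f) (L : V →L[ℝ] W)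
    (hL : Function.Injective L) : IsMinkowskiNorm fun v => f (L v) where
  nonneg y := hf.nonneg _
  smooth := hf.smooth.comp L.contDiff.contDiffOn fun y hy => (map_ne_zero_iff L hL).mpr hy
  homogeneous y s hs := by rw [map_smul, hf.homogeneous _ _ hs]
  posDef y hy v hv := by
    rw [fundamentalForm_comp_linear]
    exact hf.posDef _ ((map_ne_zero_iff L hL).mpr hy) _ ((map_ne_zero_iff L hL).mpr hv)

section Chart

variable {n : ℕ} [NeZero n]

/-- The points of the model half-space within distance `r` of `x₀`. -/
def chartBall (x₀ : EuclideanSpace ℝ (Fin n)) (r : ℝ) : Set (EuclideanSpace ℝ (Fin n)) :=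
  Metric.closedBall x₀ r ∩ range (𝓡∂ n)

theorem mem_chartBall {x₀ x : EuclideanSpace ℝ (Fin n)} {r : ℝ} :
    x ∈ chartBall x₀ r ↔ ‖x - x₀‖ ≤ r ∧ x ∈ range (𝓡∂ n) := by
  rw [chartBall, mem_inter_iff, mem_closedBall_iff_norm]

theorem self_mem_chartBall {x₀ : EuclideanSpace ℝ (Fin n)} (hx₀ : x₀ ∈ range (𝓡∂ n)) {r : ℝ}
    (hr : 0 ≤ r) : x₀ ∈ chartBall x₀ r :=
  ⟨Metric.mem_closedBall_self hr, hx₀⟩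

theorem chartBall_mono (x₀ : EuclideanSpace ℝ (Fin n)) {r s : ℝ} (h : r ≤ s) :
    chartBall x₀ r ⊆ chartBall x₀ s :=
  inter_subset_inter_left _ (Metric.closedBall_subset_closedBall h)

theorem convex_chartBall (x₀ : EuclideanSpace ℝ (Fin n)) (r : ℝ) : Convex ℝ (chartBall x₀ r) :=
  (convex_closedBall _ _).inter (𝓡∂ n).convex_range

theorem isCompact_chartBall (x₀ : EuclideanSpace ℝ (Fin n)) (r : ℝ) :
    IsCompact (chartBall x₀ r) :=
  (isCompact_closedBall _ _).inter_right (𝓡∂ n).isClosed_range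

theorem nonempty_interior_chartBall {x₀ : EuclideanSpace ℝ (Fin n)} (hx₀ : x₀ ∈ range (𝓡∂ n))
    {r : ℝ} (hr : 0 < r) : (interior (chartBall x₀ r)).Nonempty := by
  have h1 : x₀ ∈ closure (interior (range (𝓡∂ n))) :=
    (𝓡∂ n).range_subset_closure_interior hx₀
  obtain ⟨x, hx, hxr⟩ := mem_closure_iff_nhds.mp h1 _ (Metric.ball_mem_nhds _ hr)
  refine ⟨x, ?_⟩
  rw [chartBall, interior_inter]
  exact ⟨Metric.ball_subset_interior_closedBall hx, hxr⟩

variable {M : Type*} [TopologicalSpace M] [ChartedSpace (EuclideanHalfSpace n) M]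

theorem exists_chartBall_subset_target {p : M} {x₀ : EuclideanSpace ℝ (Fin n)}
    (hx₀ : x₀ ∈ (extChartAt (𝓡∂ n) p).target) :
    ∃ r > 0, chartBall x₀ r ⊆ (extChartAt (𝓡∂ n) p).target := by
  obtain ⟨r, hr, hsub⟩ := Metric.mem_nhdsWithin_iff.mp
    (extChartAt_target_mem_nhdsWithin_of_mem (I := 𝓡∂ n) hx₀)
  refine ⟨r / 2, by positivity, fun x hx => hsub ⟨?_, hx.2⟩⟩
  exact Metric.closedBall_subset_ball (by linarith) hx.1

/-- The points whose image in the chart at `p` lies in a chart ball form a neighbourhood of the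
centre. -/
theorem eventually_mem_chartBall {p q : M} (hq : q ∈ (extChartAt (𝓡∂ n) p).source) {r : ℝ}
    (hr : 0 < r) : ∀ᶠ x in 𝓝 q, x ∈ (extChartAt (𝓡∂ n) p).source ∧
      extChartAt (𝓡∂ n) p x ∈ chartBall (extChartAt (𝓡∂ n) p q) r := by
  have h1 := (continuousAt_extChartAt' (I := 𝓡∂ n) hq).eventually
    (Metric.closedBall_mem_nhds _ hr)
  filter_upwards [(isOpen_extChartAt_source (I := 𝓡∂ n) p).mem_nhds hq, h1] with x hx hx2
  exact ⟨hx, hx2, extChartAt_target_subset_range p ((extChartAt (𝓡∂ n) p).map_source hx)⟩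

end Chart

namespace FinslerFunction

variable {n : ℕ} [NeZero n] {M : Type*} [TopologicalSpace M]
  [ChartedSpace (EuclideanHalfSpace n) M] [IsManifold (𝓡∂ n) ∞ M]

/-- A Finsler function in the chart at `p`. -/
noncomputable def inChart (F : FinslerFunction n M) (p : M) :
    EuclideanSpace ℝ (Fin n) × EuclideanSpace ℝ (Fin n) → ℝ := fun w =>
  F.toFun ((extChartAt (𝓡∂ n).tangent (⟨p, 0⟩ : TangentBundle (𝓡∂ n) M)).symm w)

theorem extChartAt_tangent_target (p : M) :
    (extChartAt (𝓡∂ n).tangent (⟨p, 0⟩ : TangentBundle (𝓡∂ n) M)).target =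
      (extChartAt (𝓡∂ n) p).target ×ˢ univ := by
  rw [FiberBundle.extChartAt_target]
  congr 1
  refine inter_eq_left.mpr fun x hx => ?_
  have := (extChartAt (𝓡∂ n) p).map_target hx
  rwa [extChartAt_source] at this

theorem tangentCoordChange_injective (p : M) {y : M} (hy : y ∈ (extChartAt (𝓡∂ n) p).source) :
    Function.Injective (tangentCoordChange (𝓡∂ n) p y y) := by
  intro v w hvw
  have hyy := mem_extChartAt_source (I := 𝓡∂ n) y
  have h1 : ∀ v, tangentCoordChange (𝓡∂ n) y p y (tangentCoordChange (𝓡∂ n) p y y v) = v :=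
    fun v => by
      rw [tangentCoordChange_comp ⟨⟨hy, hyy⟩, hy⟩, tangentCoordChange_self hy]
  rw [← h1 v, hvw, h1]

/-- On each fibre the chart expression is `F` composed with an injective linear coordinate change.
-/
theorem isMinkowskiNorm_inChart (F : FinslerFunction n M) (p : M) {x : EuclideanSpace ℝ (Fin n)}
    (hx : x ∈ (extChartAt (𝓡∂ n) p).target) : IsMinkowskiNorm fun v => F.inChart p (x, v) := by
  have h1 := (F.isMinkowskiNorm ((extChartAt (𝓡∂ n) p).symm x)).comp_injective _
    (tangentCoordChange_injective p ((extChartAt (𝓡∂ n) p).map_target hx))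
  exact h1

theorem contDiffOn_inChart (F : FinslerFunction n M) (p : M) :
    ContDiffOn ℝ ∞ (F.inChart p) ((extChartAt (𝓡∂ n) p).target ×ˢ {0}ᶜ) := by
  have h1 : ContMDiffOn 𝓘(ℝ, EuclideanSpace ℝ (Fin n) × EuclideanSpace ℝ (Fin n))
      (𝓡∂ n).tangent ∞ (extChartAt (𝓡∂ n).tangent (⟨p, 0⟩ : TangentBundle (𝓡∂ n) M)).symm
      ((extChartAt (𝓡∂ n) p).target ×ˢ {0}ᶜ) := by
    refine (contMDiffOn_extChartAt_symm (⟨p, 0⟩ : TangentBundle (𝓡∂ n) M)).mono ?_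
    rw [extChartAt_tangent_target]
    exact prod_mono_right (subset_univ _)
  have h2 := F.smooth.comp h1 (by
    rintro ⟨_, v⟩ ⟨hx, hv⟩
    exact (map_ne_zero_iff _ (tangentCoordChange_injective p
      ((extChartAt (𝓡∂ n) p).map_target hx))).mpr hv)
  exact contMDiffOn_iff_contDiffOn.mp h2

theorem isFinslerFamily_inChart (F : FinslerFunction n M) {p : M}
    {x₀ : EuclideanSpace ℝ (Fin n)} (hx₀ : x₀ ∈ range (𝓡∂ n)) {r : ℝ} (hr : 0 < r)
    (hrp : chartBall x₀ r ⊆ (extChartAt (𝓡∂ n) p).target) :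
    IsFinslerFamily (chartBall x₀ r) (F.inChart p) where
  isCompact := isCompact_chartBall x₀ r
  convex := convex_chartBall x₀ r
  nonempty_interior := nonempty_interior_chartBall hx₀ hr
  smooth := (F.contDiffOn_inChart p).mono (prod_mono_left hrp)
  minkowski _ hx := F.isMinkowskiNorm_inChart p (hrp hx)

theorem inChart_tangentCoordChange (F : FinslerFunction n M) {p y : M}
    (hy : y ∈ (extChartAt (𝓡∂ n) p).source) (v : EuclideanSpace ℝ (Fin n)) :
    F.inChart p (extChartAt (𝓡∂ n) p y, tangentCoordChange (𝓡∂ n) y p y v) = F.toFun ⟨y, v⟩ := by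
  have h1 : (⟨y, v⟩ : TangentBundle (𝓡∂ n) M) ∈
      (extChartAt (𝓡∂ n).tangent (⟨p, 0⟩ : TangentBundle (𝓡∂ n) M)).source := by
    rw [extChartAt_source, TangentBundle.mem_chart_source_iff]
    rwa [extChartAt_source] at hy
  have h2 := (extChartAt (𝓡∂ n).tangent (⟨p, 0⟩ : TangentBundle (𝓡∂ n) M)).left_inv h1
  rw [inChart]
  exact congrArg F.toFun h2

/-- Continuity at the zero section is not assumed and comes from the local estimates. It is needed
because piecewise smooth curves may have zero velocity. -/
theorem continuous (F : FinslerFunction n M) : Continuous F.toFun := by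
  rw [continuous_iff_continuousAt]
  rintro ⟨p, v⟩
  have hp := mem_extChartAt_target (I := 𝓡∂ n) p
  have hp' := extChartAt_target_subset_range p hp
  obtain ⟨r, hr, hrp⟩ := exists_chartBall_subset_target hp
  have hf := (F.isFinslerFamily_inChart hp' hr hrp).continuousOn
  set Φ := extChartAt (𝓡∂ n).tangent (⟨p, 0⟩ : TangentBundle (𝓡∂ n) M) with hΦ
  have hsrc : (⟨p, v⟩ : TangentBundle (𝓡∂ n) M) ∈ Φ.source := by
    rw [hΦ, extChartAt_source, TangentBundle.mem_chart_source_iff]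
    exact mem_chart_source _ p
  have hΦc : ContinuousAt Φ (⟨p, v⟩ : TangentBundle (𝓡∂ n) M) := continuousAt_extChartAt' hsrc
  have hproj : ContinuousAt (fun w : TangentBundle (𝓡∂ n) M => w.1) ⟨p, v⟩ :=
    (FiberBundle.continuous_proj (EuclideanSpace ℝ (Fin n)) _).continuousAt
  have hev := hproj.eventually (eventually_mem_chartBall (n := n) (mem_extChartAt_source p) hr)
  have h1 : Filter.Tendsto Φ (𝓝 (⟨p, v⟩ : TangentBundle (𝓡∂ n) M))
      (𝓝[chartBall (extChartAt (𝓡∂ n) p p) r ×ˢ univ] (Φ ⟨p, v⟩)) := by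
    refine tendsto_nhdsWithin_iff.mpr ⟨hΦc, ?_⟩
    filter_upwards [hev] with w hw using ⟨hw.2, mem_univ _⟩
  have h2 := (hf (Φ ⟨p, v⟩) ⟨self_mem_chartBall hp' hr.le, mem_univ _⟩).tendsto.comp h1
  have h3 : ∀ᶠ w in 𝓝 (⟨p, v⟩ : TangentBundle (𝓡∂ n) M), F.inChart p (Φ w) = F.toFun w := by
    filter_upwards [hev] with w hw using F.inChart_tangentCoordChange hw.1 w.2
  have h4 : F.inChart p (Φ ⟨p, v⟩) = F.toFun ⟨p, v⟩ := h3.self_of_nhds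
  rw [ContinuousAt, ← h4]
  exact h2.congr' h3

/-- The chart expression of the speed of a curve. -/
theorem inChart_deriv (F : FinslerFunction n M) {p : M} {γ : ℝ → M} {t : ℝ}
    (hγ : MDifferentiableAt 𝓘(ℝ, ℝ) (𝓡∂ n) γ t) (ht : γ t ∈ (extChartAt (𝓡∂ n) p).source) :
    DifferentiableAt ℝ (fun s => extChartAt (𝓡∂ n) p (γ s)) t ∧
    F.inChart p (extChartAt (𝓡∂ n) p (γ t), deriv (fun s => extChartAt (𝓡∂ n) p (γ s)) t) =
      F.toFun ⟨γ t, mfderiv 𝓘(ℝ, ℝ) (𝓡∂ n) γ t (1 : ℝ)⟩ := by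
  have hsrc : γ t ∈ (chartAt (EuclideanHalfSpace n) p).source := by rwa [extChartAt_source] at ht
  have h1 := HasMFDerivAt.comp t (hasMFDerivAt_extChartAt (I := 𝓡∂ n) hsrc) hγ.hasMFDerivAt
  rw [mfderiv_chartAt_eq_tangentCoordChange hsrc] at h1
  have h2 : HasFDerivAt (fun s => extChartAt (𝓡∂ n) p (γ s))
      ((tangentCoordChange (𝓡∂ n) (γ t) p (γ t)).comp
        (show ℝ →L[ℝ] EuclideanSpace ℝ (Fin n) from mfderiv 𝓘(ℝ, ℝ) (𝓡∂ n) γ t)) t :=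
    h1.hasFDerivAt
  have h3 : HasDerivAt (fun s => extChartAt (𝓡∂ n) p (γ s))
      (tangentCoordChange (𝓡∂ n) (γ t) p (γ t)
        ((show ℝ →L[ℝ] EuclideanSpace ℝ (Fin n) from mfderiv 𝓘(ℝ, ℝ) (𝓡∂ n) γ t) 1)) t :=
    h2.hasDerivAt
  refine ⟨h3.differentiableAt, ?_⟩
  rw [h3.deriv]
  exact F.inChart_tangentCoordChange ht _

end FinslerFunction

/-! ### Piecewise smooth curves -/

theorem exists_mem_Icc_of_monotone_partition {t : ℕ → ℝ} {k : ℕ} {s : ℝ} (h0 : t 0 ≤ s)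
    (hk : s ≤ t k) (hs : ∀ i, s ≠ t i) : ∃ i < k, s ∈ Ioo (t i) (t (i + 1)) := by
  induction k with
  | zero => exact absurd (le_antisymm hk h0) (hs 0)
  | succ k ih =>
    rcases le_or_gt s (t k) with h | h
    · obtain ⟨i, hi, hi'⟩ := ih h
      exact ⟨i, by omega, hi'⟩
    · exact ⟨k, by omega, h, lt_of_le_of_ne hk (hs _)⟩

section Curves

variable {n : ℕ} [NeZero n] {M : Type*} [TopologicalSpace M]
  [ChartedSpace (EuclideanHalfSpace n) M]

theorem IsPiecewiseSmoothCurve.exists_countable {γ : ℝ → M} {a b : ℝ}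
    (h : IsPiecewiseSmoothCurve n γ a b) :
    ∃ s : Set ℝ, s.Countable ∧ ∀ t ∈ Icc a b \ s, MDifferentiableAt 𝓘(ℝ, ℝ) (𝓡∂ n) γ t := by
  obtain ⟨-, k, t, -, rfl, rfl, hs⟩ := h
  refine ⟨range t, countable_range t, fun x hx => ?_⟩
  obtain ⟨i, hi, hxi⟩ := exists_mem_Icc_of_monotone_partition hx.1.1 hx.1.2
    fun i h => hx.2 ⟨i, h.symm⟩
  exact ((hs i hi).contMDiffAt (Icc_mem_nhds hxi.1 hxi.2)).mdifferentiableAt (by simp)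

theorem Set.Subsingleton.contMDiffOn {γ : ℝ → M} {s : Set ℝ} (hs : s.Subsingleton) :
    ContMDiffOn 𝓘(ℝ, ℝ) (𝓡∂ n) ∞ γ s := by
  rcases s.eq_empty_or_nonempty with rfl | ⟨x, hx⟩
  · exact fun x hx => hx.elim
  · exact (contMDiffOn_const (c := γ x)).congr fun y hy => by rw [hs hy hx]

theorem isPiecewiseSmoothCurve_of_contMDiffOn {γ : ℝ → M} {a b : ℝ} (hab : a ≤ b)
    (h : ContMDiffOn 𝓘(ℝ, ℝ) (𝓡∂ n) ∞ γ (Icc a b)) : IsPiecewiseSmoothCurve n γ a b := by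
  refine ⟨h.continuousOn, 1, fun i => if i = 0 then a else b, ?_, by simp, by simp, ?_⟩
  · refine monotone_nat_of_le_succ fun i => ?_
    by_cases hi : i = 0 <;> simp [hi, hab]
  · intro i hi
    obtain rfl : i = 0 := by omega
    simpa using h

/-- The partition points are clamped to `[c, d]`. Pieces lying outside collapse to single points,
where smoothness is trivial. -/
theorem IsPiecewiseSmoothCurve.mono {γ : ℝ → M} {a b c d : ℝ}
    (h : IsPiecewiseSmoothCurve n γ a b) (hac : a ≤ c) (hcd : c ≤ d) (hdb : d ≤ b) :
    IsPiecewiseSmoothCurve n γ c d := by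
  obtain ⟨hc, k, t, ht, rfl, rfl, hs⟩ := h
  refine ⟨hc.mono (Icc_subset_Icc hac hdb), k, fun i => max c (min (t i) d), ?_, ?_, ?_, ?_⟩
  · exact fun i j hij => max_le_max le_rfl (min_le_min (ht hij) le_rfl)
  · simp [hac]
  · simp [hcd, hdb]
  · intro i hi
    rcases le_or_gt (t (i + 1)) c with h1 | h1
    · refine Set.Subsingleton.contMDiffOn ?_
      have h2 : t i ≤ c := (ht (Nat.le_succ i)).trans h1
      simp only [max_eq_left (min_le_left _ d |>.trans h1), max_eq_left (min_le_left _ d |>.trans h2),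
        Icc_self, subsingleton_singleton]
    · rcases le_or_gt d (t i) with h2 | h2
      · refine Set.Subsingleton.contMDiffOn ?_
        have h3 : d ≤ t (i + 1) := h2.trans (ht (Nat.le_succ i))
        simp [min_eq_right h2, min_eq_right h3]
      · refine (hs i hi).mono fun x hx => ⟨?_, ?_⟩
        · have := (le_max_right _ _).trans hx.1
          exact (min_eq_left h2.le) ▸ this
        · refine hx.2.trans (max_le h1.le (min_le_left _ _))

theorem IsPiecewiseSmoothCurve.comp_add {γ : ℝ → M} {a b : ℝ}
    (h : IsPiecewiseSmoothCurve n γ a b) (c : ℝ) :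
    IsPiecewiseSmoothCurve n (fun t => γ (t + c)) (a - c) (b - c) := by
  obtain ⟨hc, k, t, ht, rfl, rfl, hs⟩ := h
  refine ⟨hc.comp (by fun_prop) fun x hx => ⟨by linarith [hx.1], by linarith [hx.2]⟩, k,
    fun i => t i - c, fun i j hij => sub_le_sub_right (ht hij) _, rfl, rfl, fun i hi => ?_⟩
  refine (hs i hi).comp (t := Icc (t i) (t (i + 1))) (f := fun x : ℝ => x + c) ?_
    fun x hx => ⟨by linarith [hx.1], by linarith [hx.2]⟩
  exact contMDiffOn_iff_contDiffOn.mpr (by fun_prop)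

theorem IsPiecewiseSmoothCurve.piecewise {γ γ' : ℝ → M} {a b c : ℝ}
    (h : IsPiecewiseSmoothCurve n γ a b) (h' : IsPiecewiseSmoothCurve n γ' b c)
    (hγ : γ b = γ' b) :
    IsPiecewiseSmoothCurve n (fun t => if t ≤ b then γ t else γ' t) a c := by
  obtain ⟨hc, k, t, ht, rfl, rfl, hs⟩ := h
  obtain ⟨hc', k', t', ht', h0, rfl, hs'⟩ := h'
  have e1 : ∀ x, x ≤ t k → (if x ≤ t k then γ x else γ' x) = γ x := fun x hx => if_pos hx
  have e2 : ∀ x, t k ≤ x → (if x ≤ t k then γ x else γ' x) = γ' x := fun x hx => by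
    rcases hx.eq_or_lt with rfl | hx
    · rw [if_pos le_rfl, hγ]
    · rw [if_neg hx.not_ge]
  refine ⟨?_, k + k', fun i => if i ≤ k then t i else t' (i - k), ?_, by simp, ?_, ?_⟩
  · have h1 : ContinuousOn (fun x => if x ≤ t k then γ x else γ' x) (Icc (t 0) (t k)) :=
      hc.congr fun x hx => e1 x hx.2
    have h2 : ContinuousOn (fun x => if x ≤ t k then γ x else γ' x) (Icc (t k) (t' k')) :=
      hc'.congr fun x hx => e2 x hx.1
    rw [← Icc_union_Icc_eq_Icc (ht (Nat.zero_le k)) (h0 ▸ ht' (Nat.zero_le k'))]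
    exact h1.union_of_isClosed h2 isClosed_Icc isClosed_Icc
  · refine monotone_nat_of_le_succ fun i => ?_
    rcases lt_trichotomy i k with hi | rfl | hi
    · simpa [hi.le, Nat.succ_le_of_lt hi] using ht (Nat.le_succ i)
    · simpa [← h0] using ht' (Nat.zero_le 1)
    · simpa [hi.not_ge, show ¬ i + 1 ≤ k by omega, show i + 1 - k = i - k + 1 by omega]
        using ht' (Nat.le_succ _)
  · rcases Nat.eq_zero_or_pos k' with rfl | hk
    · simp [h0]
    · simp [show ¬ k' = 0 by omega]
  · intro i hi
    rcases lt_or_ge i k with hik | hik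
    · simp only [hik.le, Nat.succ_le_of_lt hik, if_true]
      exact (hs i hik).congr fun x hx => e1 x (hx.2.trans (ht hik))
    · have e3 : (if i ≤ k then t i else t' (i - k)) = t' (i - k) := by
        rcases hik.eq_or_lt with rfl | h
        · simp [h0]
        · simp [h.not_ge]
      have e4 : (if i + 1 ≤ k then t (i + 1) else t' (i + 1 - k)) = t' (i - k + 1) := by
        rw [if_neg (by omega), show i + 1 - k = i - k + 1 by omega]
      change ContMDiffOn _ _ _ _ (Icc (if i ≤ k then t i else t' (i - k))
        (if i + 1 ≤ k then t (i + 1) else t' (i + 1 - k)))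
      rw [e3, e4]
      exact (hs' (i - k) (by omega)).congr fun x hx =>
        e2 x (h0.symm.le.trans ((ht' (Nat.zero_le _)).trans hx.1))

end Curves

/-! ### Lengths of curves, concatenation and elementary properties of the distance. -/

namespace FinslerFunction

variable {n : ℕ} [NeZero n] {M : Type*} [TopologicalSpace M]
  [ChartedSpace (EuclideanHalfSpace n) M] [IsManifold (𝓡∂ n) ∞ M]

/-- The speed `F(γ(t), γ'(t))`. -/
noncomputable def speed (F : FinslerFunction n M) (γ : ℝ → M) (t : ℝ) : ℝ :=
  F.toFun ⟨γ t, mfderiv 𝓘(ℝ, ℝ) (𝓡∂ n) γ t (1 : ℝ)⟩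

theorem speed_nonneg (F : FinslerFunction n M) (γ : ℝ → M) (t : ℝ) : 0 ≤ F.speed γ t :=
  (F.isMinkowskiNorm (γ t)).nonneg _

theorem speed_congr (F : FinslerFunction n M) {γ γ' : ℝ → M} {t : ℝ} (h : γ =ᶠ[𝓝 t] γ') :
    F.speed γ t = F.speed γ' t := by
  have h0 : γ t = γ' t := h.self_of_nhds
  have h1 : (mfderiv 𝓘(ℝ, ℝ) (𝓡∂ n) γ t : ℝ →L[ℝ] EuclideanSpace ℝ (Fin n)) =
    mfderiv 𝓘(ℝ, ℝ) (𝓡∂ n) γ' t := h.mfderiv_eq (I := 𝓘(ℝ, ℝ)) (I' := 𝓡∂ n)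
  have h2 : ∀ (x y : M) (A B : ℝ →L[ℝ] EuclideanSpace ℝ (Fin n)), x = y → A = B →
      F.toFun ⟨x, A 1⟩ = F.toFun ⟨y, B 1⟩ := by rintro x _ A _ rfl rfl; rfl
  exact h2 _ _ _ _ h0 h1

theorem speed_comp_add (F : FinslerFunction n M) {γ : ℝ → M} {c t : ℝ}
    (h : MDifferentiableAt 𝓘(ℝ, ℝ) (𝓡∂ n) γ (t + c)) :
    F.speed (fun s => γ (s + c)) t = F.speed γ (t + c) := by
  have h1 : HasMFDerivAt 𝓘(ℝ, ℝ) 𝓘(ℝ, ℝ) (fun s : ℝ => s + c) t (ContinuousLinearMap.id ℝ ℝ) :=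
    ((hasFDerivAt_id t).add_const c).hasMFDerivAt
  have h2 := (HasMFDerivAt.comp t h.hasMFDerivAt h1).mfderiv
  have h3 : ∀ (x : M) (A B : ℝ →L[ℝ] EuclideanSpace ℝ (Fin n)),
      A = B.comp (ContinuousLinearMap.id ℝ ℝ) → F.toFun ⟨x, A 1⟩ = F.toFun ⟨x, B 1⟩ := by
    rintro x _ B rfl; rfl
  exact h3 _ _ _ h2

/-- Inside each piece the speed equals the one formed with the derivative within the closed piece,
which is continuous up to the ends. -/
theorem intervalIntegrable_speed (F : FinslerFunction n M) {γ : ℝ → M} {a b : ℝ}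
    (h : IsPiecewiseSmoothCurve n γ a b) : IntervalIntegrable (F.speed γ) volume a b := by
  obtain ⟨-, k, t, ht, rfl, rfl, hs⟩ := h
  refine IntervalIntegrable.trans_iterate fun i hi => ?_
  rcases (ht (Nat.le_succ i)).eq_or_lt with h | h
  · rw [Nat.succ_eq_add_one] at h; rw [h]
  have hu : UniqueMDiffOn 𝓘(ℝ, ℝ) (Icc (t i) (t (i + 1))) :=
    (uniqueDiffOn_Icc h).uniqueMDiffOn
  have h1 := (hs i hi).continuousOn_tangentMapWithin (by simp) hu
  have h2 : Continuous fun s : ℝ => (⟨s, (1 : ℝ)⟩ : TangentBundle 𝓘(ℝ, ℝ) ℝ) := by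
    have : Continuous (tangentBundleModelSpaceHomeomorph 𝓘(ℝ, ℝ)).symm := Homeomorph.continuous _
    exact this.comp (continuous_id.prodMk continuous_const)
  have h3 : ContinuousOn (fun s => F.toFun (tangentMapWithin 𝓘(ℝ, ℝ) (𝓡∂ n) γ
      (Icc (t i) (t (i + 1))) ⟨s, (1 : ℝ)⟩)) (Icc (t i) (t (i + 1))) :=
    F.continuous.comp_continuousOn (h1.comp h2.continuousOn fun s hs => hs)
  refine (h3.intervalIntegrable_of_Icc h.le).congr_uIoo fun s hs' => ?_
  rw [uIoo_of_le h.le] at hs'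
  change F.toFun ⟨γ s, mfderivWithin 𝓘(ℝ, ℝ) (𝓡∂ n) γ (Icc (t i) (t (i + 1))) s (1 : ℝ)⟩ = _
  rw [mfderivWithin_of_mem_nhds (Icc_mem_nhds hs'.1 hs'.2)]
  rfl

theorem length_nonneg (F : FinslerFunction n M) (γ : ℝ → M) {a b : ℝ} (hab : a ≤ b) :
    0 ≤ F.length γ a b :=
  intervalIntegral.integral_nonneg hab fun t _ => F.speed_nonneg γ t

theorem length_add (F : FinslerFunction n M) {γ : ℝ → M} {a b c : ℝ}
    (h : IsPiecewiseSmoothCurve n γ a c) (hab : a ≤ b) (hbc : b ≤ c) :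
    F.length γ a b + F.length γ b c = F.length γ a c :=
  intervalIntegral.integral_add_adjacent_intervals
    (F.intervalIntegrable_speed (h.mono le_rfl hab hbc))
    (F.intervalIntegrable_speed (h.mono hab hbc le_rfl))

theorem length_comp_add (F : FinslerFunction n M) {γ : ℝ → M} {a b : ℝ} (hab : a ≤ b)
    (h : IsPiecewiseSmoothCurve n γ a b) (c : ℝ) :
    F.length (fun t => γ (t + c)) (a - c) (b - c) = F.length γ a b := by
  obtain ⟨s, hs, hd⟩ := h.exists_countable
  have h1 : F.length (fun t => γ (t + c)) (a - c) (b - c) =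
      ∫ t in (a - c)..(b - c), F.speed γ (t + c) := by
    refine intervalIntegral.integral_congr_ae ?_
    have hs' : ((fun t => t + c) ⁻¹' s).Countable := hs.preimage (add_left_injective c)
    filter_upwards [hs'.ae_notMem volume] with t ht ht'
    rw [uIoc_of_le (by linarith)] at ht'
    exact F.speed_comp_add (hd _ ⟨⟨by linarith [ht'.1], by linarith [ht'.2]⟩, ht⟩)
  rw [h1, intervalIntegral.integral_comp_add_right (F.speed γ)]
  simp [length, speed]

theorem length_congr (F : FinslerFunction n M) {γ γ' : ℝ → M} {a b : ℝ} (hab : a ≤ b)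
    (h : EqOn γ γ' (Ioo a b)) : F.length γ a b = F.length γ' a b := by
  refine intervalIntegral.integral_congr_uIoo fun t ht => ?_
  rw [uIoo_of_le hab] at ht
  refine F.speed_congr ?_
  filter_upwards [Ioo_mem_nhds ht.1 ht.2] with s hs using h hs

/-- There is a piecewise smooth curve of length `L` from `x` to `y`. -/
def HasCurve (F : FinslerFunction n M) (x y : M) (L : ℝ) : Prop :=
  ∃ (a b : ℝ) (γ : ℝ → M), a ≤ b ∧ IsPiecewiseSmoothCurve n γ a b ∧
    γ a = x ∧ γ b = y ∧ L = F.length γ a b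

theorem HasCurve.nonneg {F : FinslerFunction n M} {x y : M} {L : ℝ} (h : F.HasCurve x y L) :
    0 ≤ L := by
  obtain ⟨a, b, γ, hab, -, -, -, rfl⟩ := h
  exact F.length_nonneg γ hab

theorem HasCurve.refl (F : FinslerFunction n M) (x : M) : F.HasCurve x x 0 :=
  ⟨0, 0, fun _ => x, le_rfl, isPiecewiseSmoothCurve_of_contMDiffOn le_rfl contMDiffOn_const,
    rfl, rfl, by simp [length]⟩

theorem HasCurve.trans {F : FinslerFunction n M} {x y z : M} {L L' : ℝ} (h : F.HasCurve x y L)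
    (h' : F.HasCurve y z L') : F.HasCurve x z (L + L') := by
  obtain ⟨a, b, γ, hab, hγ, rfl, hb, rfl⟩ := h
  obtain ⟨a', b', γ', hab', hγ', ha', rfl, rfl⟩ := h'
  have h1 := hγ'.comp_add (a' - b)
  have h2 := F.length_comp_add hab' hγ' (a' - b)
  rw [sub_sub_cancel] at h1 h2
  have h3 := hγ.piecewise h1 (by simp [hb, ha'])
  have hbb : b ≤ b' - (a' - b) := by linarith
  refine ⟨a, b' - (a' - b), _, hab.trans hbb, h3, if_pos hab, ?_, ?_⟩
  · rcases hbb.eq_or_lt with h | h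
    · have : b' = a' := by linarith
      subst this
      simp [hb, ha']
    · simp [h.not_ge]
  · rw [← F.length_add h3 hab hbb, ← h2]
    congr 1
    · exact F.length_congr hab fun t ht => (if_pos ht.2.le).symm
    · exact F.length_congr hbb fun t ht => (if_neg ht.1.not_ge).symm

theorem dist_nonneg (F : FinslerFunction n M) (x y : M) : 0 ≤ F.dist x y :=
  Real.sInf_nonneg fun _ h => HasCurve.nonneg h

theorem HasCurve.dist_le {F : FinslerFunction n M} {x y : M} {L : ℝ} (h : F.HasCurve x y L) :
    F.dist x y ≤ L :=
  csInf_le ⟨0, fun _ h => HasCurve.nonneg h⟩ h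

theorem dist_self (F : FinslerFunction n M) (x : M) : F.dist x x = 0 :=
  le_antisymm (HasCurve.refl F x).dist_le (F.dist_nonneg x x)

theorem dist_le_length (F : FinslerFunction n M) {γ : ℝ → M} {a b : ℝ} (hab : a ≤ b)
    (h : IsPiecewiseSmoothCurve n γ a b) : F.dist (γ a) (γ b) ≤ F.length γ a b :=
  HasCurve.dist_le ⟨a, b, γ, hab, h, rfl, rfl, rfl⟩

end FinslerFunction

/-! ### The distance in charts -/

section

variable {n : ℕ} [NeZero n] {M : Type*} [TopologicalSpace M]
  [ChartedSpace (EuclideanHalfSpace n) M]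

/-- A curve starting in a chart ball stays there or reaches the boundary sphere of the ball. -/
theorem stays_or_exists_exit [T2Space M] {p : M} {x₀ : EuclideanSpace ℝ (Fin n)} {r : ℝ}
    (hrp : chartBall x₀ r ⊆ (extChartAt (𝓡∂ n) p).target) {γ : ℝ → M} {a b : ℝ} (hab : a ≤ b)
    (hγ : ContinuousOn γ (Icc a b)) (ha : γ a ∈ (extChartAt (𝓡∂ n) p).source)
    (har : ‖extChartAt (𝓡∂ n) p (γ a) - x₀‖ < r) :
    ∃ c ∈ Icc a b, (∀ t ∈ Icc a c, γ t ∈ (extChartAt (𝓡∂ n) p).source ∧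
      extChartAt (𝓡∂ n) p (γ t) ∈ chartBall x₀ r) ∧
      (c = b ∨ ‖extChartAt (𝓡∂ n) p (γ c) - x₀‖ = r) := by
  set φ := extChartAt (𝓡∂ n) p
  set O : Set M := φ.source ∩ φ ⁻¹' Metric.ball x₀ r
  have hO : IsOpen O := isOpen_extChartAt_preimage' p Metric.isOpen_ball
  -- Compact, hence closed in the Hausdorff space `M`: the first exit point, a limit of points in
  -- the open ball, cannot leave the chart domain.
  set N : Set M := φ.symm '' chartBall x₀ r
  have hN : IsClosed N := ((isCompact_chartBall x₀ r).image_of_continuousOn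
    ((continuousOn_extChartAt_symm p).mono hrp)).isClosed
  have hNmem : ∀ q ∈ N, q ∈ φ.source ∧ φ q ∈ chartBall x₀ r := by
    rintro _ ⟨x, hx, rfl⟩
    exact ⟨φ.map_target (hrp hx), by rwa [φ.right_inv (hrp hx)]⟩
  have hON : O ⊆ N := fun q hq => ⟨φ q, mem_chartBall.mpr
    ⟨(mem_ball_iff_norm.mp hq.2).le, extChartAt_target_subset_range p (φ.map_source hq.1)⟩,
    φ.left_inv hq.1⟩
  set S : Set ℝ := Icc a b ∩ γ ⁻¹' Oᶜ
  have hS : IsCompact S := isCompact_Icc.of_isClosed_subset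
    (hγ.preimage_isClosed_of_isClosed isClosed_Icc hO.isClosed_compl) inter_subset_left
  have haO : γ a ∈ O := ⟨ha, mem_ball_iff_norm.mpr har⟩
  rcases S.eq_empty_or_nonempty with hSe | hSn
  · refine ⟨b, right_mem_Icc.mpr hab, fun t ht => hNmem _ (hON ?_), Or.inl rfl⟩
    by_contra h
    exact (hSe ▸ (⟨ht, h⟩ : t ∈ S) : t ∈ (∅ : Set ℝ))
  · obtain ⟨c, hc, hmin⟩ := hS.exists_isLeast hSn
    have hac : a < c := lt_of_le_of_ne hc.1.1 fun h => hc.2 (h ▸ haO)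
    have hlt : ∀ t ∈ Ico a c, γ t ∈ O := fun t ht => by
      by_contra h
      exact ht.2.not_ge (hmin ⟨⟨ht.1, ht.2.le.trans hc.1.2⟩, h⟩)
    have hcN : γ c ∈ N := by
      have h1 : Filter.Tendsto γ (𝓝[Ico a c] c) (𝓝 (γ c)) :=
        (hγ c hc.1).mono_left (nhdsWithin_mono _ fun t ht => ⟨ht.1, ht.2.le.trans hc.1.2⟩)
      have : (𝓝[Ico a c] c).NeBot := by
        rw [← mem_closure_iff_nhdsWithin_neBot, closure_Ico hac.ne]
        exact right_mem_Icc.mpr hac.le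
      refine hN.mem_of_tendsto h1 ?_
      filter_upwards [self_mem_nhdsWithin] with t ht using hON (hlt t ht)
    have hcN' := hNmem _ hcN
    refine ⟨c, hc.1, fun t ht => ?_, Or.inr (le_antisymm (mem_chartBall.mp hcN'.2).1 ?_)⟩
    · rcases ht.2.eq_or_lt with rfl | h
      · exact hcN'
      · exact hNmem _ (hON (hlt t ⟨ht.1, h⟩))
    · by_contra! h
      exact hc.2 ⟨hcN'.1, mem_ball_iff_norm.mpr h⟩

end

namespace FinslerFunction

variable {n : ℕ} [NeZero n] {M : Type*} [TopologicalSpace M]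
  [ChartedSpace (EuclideanHalfSpace n) M] [IsManifold (𝓡∂ n) ∞ M]

theorem exists_hasCurve_segment (F : FinslerFunction n M) {p : M}
    {x y : EuclideanSpace ℝ (Fin n)} {B : ℝ}
    (hxy : ∀ t ∈ Icc (0 : ℝ) 1, x + t • (y - x) ∈ (extChartAt (𝓡∂ n) p).target)
    (hB : ∀ t ∈ Icc (0 : ℝ) 1, F.inChart p (x + t • (y - x), y - x) ≤ B) :
    ∃ L ≤ B, F.HasCurve ((extChartAt (𝓡∂ n) p).symm x) ((extChartAt (𝓡∂ n) p).symm y) L := by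
  set φ := extChartAt (𝓡∂ n) p
  have h1 : ContMDiffOn 𝓘(ℝ, ℝ) (𝓡∂ n) ∞ (fun t : ℝ => φ.symm (x + t • (y - x))) (Icc 0 1) := by
    refine (contMDiffOn_extChartAt_symm p).comp (f := fun t : ℝ => x + t • (y - x)) ?_ hxy
    exact contMDiffOn_iff_contDiffOn.mpr (by fun_prop)
  have h2 := isPiecewiseSmoothCurve_of_contMDiffOn zero_le_one h1
  refine ⟨_, ?_, 0, 1, _, zero_le_one, h2, by simp, by simp, rfl⟩
  have h3 : ∀ t ∈ Ioo (0 : ℝ) 1, F.speed (fun t : ℝ => φ.symm (x + t • (y - x))) t ≤ B := by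
    intro t ht
    have h4 := (h1.contMDiffAt (Icc_mem_nhds ht.1 ht.2)).mdifferentiableAt (by simp)
    have ht' := Ioo_subset_Icc_self ht
    have h5 : φ.symm (x + t • (y - x)) ∈ φ.source := φ.map_target (hxy t ht')
    have h6 := (F.inChart_deriv h4 h5).2
    have h7 : HasDerivAt (fun s : ℝ => φ (φ.symm (x + s • (y - x)))) (y - x) t := by
      have := (hasDerivAt_id t).smul_const (y - x)
      refine ((this.const_add x).congr_deriv (one_smul _ _)).congr_of_eventuallyEq ?_
      filter_upwards [Ioo_mem_nhds ht.1 ht.2] with s hs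
      exact φ.right_inv (hxy s (Ioo_subset_Icc_self hs))
    rw [h7.deriv, φ.right_inv (hxy t ht')] at h6
    exact h6.symm.le.trans (hB t ht')
  have h8 := intervalIntegral.integral_mono_on_of_le_Ioo zero_le_one
    (F.intervalIntegrable_speed h2) (intervalIntegrable_const (c := B)) h3
  rw [intervalIntegral.integral_const, sub_zero, one_smul] at h8
  exact h8

/-- A lower bound for the length of a curve that stays in a chart. -/
theorem le_mul_length (F : FinslerFunction n M) {p : M} {x₀ : EuclideanSpace ℝ (Fin n)}
    {U : Set (EuclideanSpace ℝ (Fin n))} (h₀ : IsMinkowskiNorm fun v => F.inChart p (x₀, v))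
    {m κ : ℝ} (hm : 0 < m) (hmf : ∀ v, m * ‖v‖ ≤ F.inChart p (x₀, v))
    (hκ : ∀ x ∈ U, ∀ v, F.inChart p (x₀, v) ≤ κ * F.inChart p (x, v))
    {γ : ℝ → M} {a b : ℝ} (hab : a ≤ b) (hγ : IsPiecewiseSmoothCurve n γ a b)
    (hs : ∀ t ∈ Icc a b, γ t ∈ (extChartAt (𝓡∂ n) p).source)
    (hU : ∀ t ∈ Icc a b, extChartAt (𝓡∂ n) p (γ t) ∈ U) :
    F.inChart p (x₀, extChartAt (𝓡∂ n) p (γ b) - extChartAt (𝓡∂ n) p (γ a)) ≤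
      κ * F.length γ a b := by
  set φ := extChartAt (𝓡∂ n) p
  -- Calibration: `ξ` attains the frozen norm on the displacement and lies below it elsewhere, so
  -- integrating `ξ` over the velocity bounds the length from below.
  obtain ⟨ξ, hξ, hξle⟩ := h₀.exists_support (φ (γ b) - φ (γ a))
  obtain ⟨s, hsc, hd⟩ := hγ.exists_countable
  have hsp := F.intervalIntegrable_speed hγ
  have hder : ∀ t ∈ Icc a b \ s, F.inChart p (φ (γ t), deriv (fun s => φ (γ s)) t) = F.speed γ t :=
    fun t ht => (F.inChart_deriv (hd t ht) (hs t ht.1)).2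
  have hle : ∀ t ∈ Icc a b \ s, F.inChart p (x₀, deriv (fun s => φ (γ s)) t) ≤ κ * F.speed γ t :=
    fun t ht => by rw [← hder t ht]; exact hκ _ (hU t ht.1) _
  have hae : ∀ᵐ t ∂volume.restrict (Ioc a b), t ∈ Icc a b \ s := by
    filter_upwards [ae_restrict_mem measurableSet_Ioc, ae_restrict_of_ae (hsc.ae_notMem volume)]
      with t ht ht' using ⟨Ioc_subset_Icc_self ht, ht'⟩
  have hint : IntervalIntegrable (fun t => ξ (deriv (fun s => φ (γ s)) t)) volume a b := by
    rw [intervalIntegrable_iff_integrableOn_Ioc_of_le hab] at hsp ⊢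
    refine Integrable.mono' (hsp.const_mul (‖ξ‖ * (κ / m))) ?_ ?_
    · exact (ξ.continuous.measurable.comp (measurable_deriv _)).aestronglyMeasurable
    · filter_upwards [hae] with t ht
      refine (ξ.le_opNorm _).trans ?_
      rw [mul_assoc]
      refine mul_le_mul_of_nonneg_left ?_ (norm_nonneg _)
      rw [div_mul_eq_mul_div, le_div_iff₀ hm, mul_comm]
      exact (hmf _).trans (hle t ht)
  have hcont : ContinuousOn (fun t => ξ (φ (γ t))) (Icc a b) :=
    ξ.continuous.comp_continuousOn ((continuousOn_extChartAt p).comp hγ.1 hs)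
  have hFTC := integral_eq_of_hasDerivAt_off_countable_of_le (fun t => ξ (φ (γ t)))
    (fun t => ξ (deriv (fun s => φ (γ s)) t)) hab hsc hcont (fun t ht => by
      have ht' : t ∈ Icc a b \ s := ⟨Ioo_subset_Icc_self ht.1, ht.2⟩
      exact ξ.hasFDerivAt.comp_hasDerivAt t
        (F.inChart_deriv (hd t ht') (hs t ht'.1)).1.hasDerivAt) hint
  rw [← hξ, map_sub, ← hFTC]
  have hlen : κ * F.length γ a b = ∫ t in a..b, κ * F.speed γ t :=
    (intervalIntegral.integral_const_mul _ _).symm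
  rw [hlen]
  refine intervalIntegral.integral_mono_ae_restrict hab hint (hsp.const_mul κ) ?_
  rw [restrict_Ioc_eq_restrict_Icc] at hae
  filter_upwards [hae] with t ht
  exact (hξle _).trans (hle t ht)

/-- A curve that stays in the ball must cover the coordinate displacement, and one that leaves pays
at least `m` times the distance to the sphere before its first exit. `B` lies below both costs. -/
theorem le_mul_of_hasCurve [T2Space M] (F : FinslerFunction n M) {p : M}
    {x₀ : EuclideanSpace ℝ (Fin n)} {r : ℝ}
    (hrp : chartBall x₀ r ⊆ (extChartAt (𝓡∂ n) p).target)
    (h₀ : IsMinkowskiNorm fun v => F.inChart p (x₀, v))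
    {m κ : ℝ} (hm : 0 < m) (hκ0 : 0 ≤ κ) (hmf : ∀ v, m * ‖v‖ ≤ F.inChart p (x₀, v))
    (hκ : ∀ x ∈ chartBall x₀ r, ∀ v, F.inChart p (x₀, v) ≤ κ * F.inChart p (x, v))
    {q q' : M} {L B : ℝ} (h : F.HasCurve q q' L) (hq : q ∈ (extChartAt (𝓡∂ n) p).source)
    (hqr : ‖extChartAt (𝓡∂ n) p q - x₀‖ < r)
    (hB : B ≤ m * (r - ‖extChartAt (𝓡∂ n) p q - x₀‖))
    (hB' : q' ∈ (extChartAt (𝓡∂ n) p).source →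
      B ≤ F.inChart p (x₀, extChartAt (𝓡∂ n) p q' - extChartAt (𝓡∂ n) p q)) : B ≤ κ * L := by
  obtain ⟨a, b, γ, hab, hγ, rfl, rfl, rfl⟩ := h
  obtain ⟨c, hc, hst, hc'⟩ := stays_or_exists_exit hrp hab hγ.1 hq hqr
  have h1 := F.le_mul_length h₀ hm hmf hκ hc.1 (hγ.mono le_rfl hc.1 hc.2)
    (fun t ht => (hst t ht).1) (fun t ht => (hst t ht).2)
  rcases hc' with rfl | hc'
  · exact (hB' (hst c (right_mem_Icc.mpr hc.1)).1).trans h1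
  · have h2 : F.length γ a c ≤ F.length γ a b := by
      rw [← F.length_add hγ hc.1 hc.2]
      exact le_add_of_nonneg_right (F.length_nonneg γ hc.2)
    refine (hB.trans ?_).trans (h1.trans (mul_le_mul_of_nonneg_left h2 hκ0))
    refine (mul_le_mul_of_nonneg_left ?_ hm.le).trans (hmf _)
    rw [← hc']
    have := norm_sub_le (extChartAt (𝓡∂ n) p (γ c) - x₀) (extChartAt (𝓡∂ n) p (γ a) - x₀)
    have h3 := norm_add_le (extChartAt (𝓡∂ n) p (γ c) - extChartAt (𝓡∂ n) p (γ a))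
      (extChartAt (𝓡∂ n) p (γ a) - x₀)
    rw [sub_add_sub_cancel] at h3
    linarith

end FinslerFunction

/-! ### Local comparison of the distance with norms, and its global consequences. -/

namespace FinslerFunction

variable {n : ℕ} [NeZero n] {M : Type*} [TopologicalSpace M]
  [ChartedSpace (EuclideanHalfSpace n) M] [IsManifold (𝓡∂ n) ∞ M]

/-- Upper bounds for the distance in a chart ball. -/
theorem exists_hasCurve_le (F : FinslerFunction n M) {p : M} {x₀ : EuclideanSpace ℝ (Fin n)}
    (hx₀ : x₀ ∈ range (𝓡∂ n)) {r : ℝ} (hr : 0 < r)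
    (hrp : chartBall x₀ r ⊆ (extChartAt (𝓡∂ n) p).target) :
    ∃ C > 0, ∀ x ∈ chartBall x₀ r, ∀ y ∈ chartBall x₀ r, ∃ L ≤ C * ‖y - x‖,
      F.HasCurve ((extChartAt (𝓡∂ n) p).symm x) ((extChartAt (𝓡∂ n) p).symm y) L := by
  obtain ⟨m, C, -, hC, hmC⟩ := (F.isFinslerFamily_inChart hx₀ hr hrp).exists_bounds
  refine ⟨C, hC, fun x hx y hy => F.exists_hasCurve_segment (fun t ht => hrp ?_) fun t ht => ?_⟩
  · exact (convex_chartBall x₀ r).add_smul_sub_mem hx hy ht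
  · exact (hmC _ ((convex_chartBall x₀ r).add_smul_sub_mem hx hy ht) _).2

theorem eventually_hasCurve (F : FinslerFunction n M) (q : M) {ε : ℝ} (hε : 0 < ε) :
    ∀ᶠ x in 𝓝 q, (∃ L < ε, F.HasCurve q x L) ∧ ∃ L < ε, F.HasCurve x q L := by
  set φ := extChartAt (𝓡∂ n) q
  have hq := mem_extChartAt_source (I := 𝓡∂ n) q
  have hqt := mem_extChartAt_target (I := 𝓡∂ n) q
  have hqr := extChartAt_target_subset_range q hqt
  obtain ⟨r, hr, hrp⟩ := exists_chartBall_subset_target hqt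
  obtain ⟨C, hC, h⟩ := F.exists_hasCurve_le hqr hr hrp
  have hr' : 0 < min r (ε / (2 * C)) := by positivity
  filter_upwards [eventually_mem_chartBall hq hr'] with x hx
  have h1 := (mem_chartBall.mp hx.2).1
  have hx' := chartBall_mono (φ q) (min_le_left _ _) hx.2
  have h2 : C * ‖φ x - φ q‖ < ε := by
    have := h1.trans (min_le_right _ _)
    rw [le_div_iff₀ (by positivity)] at this
    change ‖φ x - φ q‖ * (2 * C) ≤ ε at this
    linarith
  obtain ⟨L, hL, hc⟩ := h _ (self_mem_chartBall hqr hr.le) _ hx'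
  obtain ⟨L', hL', hc'⟩ := h _ hx' _ (self_mem_chartBall hqr hr.le)
  rw [φ.left_inv hq, φ.left_inv hx.1] at hc hc'
  rw [norm_sub_rev] at hL'
  exact ⟨⟨L, hL.trans_lt h2, hc⟩, L', hL'.trans_lt h2, hc'⟩

/-- Being joined by a curve is transitive and holds locally in both directions, so connectedness
makes it global. Without it the infimum defining `dist` could be over the empty set. -/
theorem exists_hasCurve [PreconnectedSpace M] (F : FinslerFunction n M) (x y : M) :
    ∃ L, F.HasCurve x y L := by
  refine PreconnectedSpace.induction₂' (fun x y => ∃ L, F.HasCurve x y L) (fun q => ?_)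
    ⟨fun x y z ⟨L, h⟩ ⟨L', h'⟩ => ⟨_, h.trans h'⟩⟩ x y
  filter_upwards [F.eventually_hasCurve q one_pos] with x ⟨⟨L, _, h⟩, L', _, h'⟩
  exact ⟨⟨L, h⟩, L', h'⟩

theorem exists_hasCurve_lt [PreconnectedSpace M] (F : FinslerFunction n M) (x y : M) {B : ℝ}
    (hB : F.dist x y < B) : ∃ L < B, F.HasCurve x y L := by
  obtain ⟨L, hL, hLB⟩ := exists_lt_of_csInf_lt (F.exists_hasCurve x y) hB
  exact ⟨L, hLB, hL⟩

theorem dist_triangle [PreconnectedSpace M] (F : FinslerFunction n M) (x y z : M) :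
    F.dist x z ≤ F.dist x y + F.dist y z := by
  refine le_of_forall_pos_le_add fun ε hε => ?_
  obtain ⟨L, hL, h⟩ := F.exists_hasCurve_lt x y (lt_add_of_pos_right (F.dist x y) (half_pos hε))
  obtain ⟨L', hL', h'⟩ := F.exists_hasCurve_lt y z (lt_add_of_pos_right (F.dist y z) (half_pos hε))
  have := (h.trans h').dist_le
  linarith

theorem continuous_dist [PreconnectedSpace M] (F : FinslerFunction n M) :
    Continuous fun z : M × M => F.dist z.1 z.2 := by
  rw [continuous_iff_continuousAt]
  rintro ⟨x, y⟩
  rw [Metric.continuousAt_iff']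
  intro ε hε
  have h1 := F.eventually_hasCurve x (half_pos hε)
  have h2 := F.eventually_hasCurve y (half_pos hε)
  rw [nhds_prod_eq]
  filter_upwards [h1.prod_mk h2] with ⟨x', y'⟩ ⟨⟨⟨L₁, hL₁, h₁⟩, L₂, hL₂, h₂⟩,
    ⟨L₃, hL₃, h₃⟩, L₄, hL₄, h₄⟩
  have := h₁.dist_le
  have := h₂.dist_le
  have := h₃.dist_le
  have := h₄.dist_le
  have t1 := F.dist_triangle x x' y
  have t2 := F.dist_triangle x' y' y
  have t3 := F.dist_triangle x' x y'
  have t4 := F.dist_triangle x y y'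
  rw [Real.dist_eq, abs_lt]
  dsimp only at *
  constructor <;> linarith

/-- In a chart the distance is infinitesimally given by `F`. -/
theorem exists_abs_dist_sub_le [T2Space M] [PreconnectedSpace M] (F : FinslerFunction n M) {p : M}
    {x₀ : EuclideanSpace ℝ (Fin n)} (hx₀ : x₀ ∈ (extChartAt (𝓡∂ n) p).target) {ε : ℝ}
    (hε : 0 < ε) : ∃ ρ > 0, chartBall x₀ ρ ⊆ (extChartAt (𝓡∂ n) p).target ∧
      ∀ x ∈ chartBall x₀ ρ, ∀ y ∈ chartBall x₀ ρ,
      |F.dist ((extChartAt (𝓡∂ n) p).symm x) ((extChartAt (𝓡∂ n) p).symm y) -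
        F.inChart p (x₀, y - x)| ≤ ε * ‖y - x‖ := by
  set φ := extChartAt (𝓡∂ n) p
  have hx₀r := extChartAt_target_subset_range p hx₀
  obtain ⟨R, hR, hRp⟩ := exists_chartBall_subset_target hx₀
  have hfam := F.isFinslerFamily_inChart hx₀r hR hRp
  obtain ⟨m, C, hm, hC, hmC⟩ := hfam.exists_bounds
  obtain ⟨K, hK, hKf⟩ := hfam.exists_abs_sub_le
  obtain ⟨C', hC', hcurve⟩ := F.exists_hasCurve_le hx₀r hR hRp
  have hx₀R := self_mem_chartBall hx₀r hR.le
  -- Moving the base point within radius `r` changes the norm by at most `K * r * ‖v‖`, a relative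
  -- error of `K * r / m`. The choice of `r` keeps the resulting errors in the upper and in the
  -- lower bound below `ε * ‖y - x‖`.
  set r := min R (ε / (K + K * C' / m)) with hr_def
  have hr : 0 < r := by positivity
  have hrR : r ≤ R := min_le_left _ _
  have hrε : K * r ≤ ε ∧ K * r / m * C' ≤ ε := by
    have h1 : r * (K + K * C' / m) ≤ ε := by
      rw [← le_div_iff₀ (by positivity)]; exact min_le_right _ _
    have h2 : 0 ≤ r * (K * C' / m) := by positivity
    have h3 : 0 ≤ r * K := by positivity
    have h4 : K * r / m * C' = r * (K * C' / m) := by ring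
    rw [h4]
    constructor <;> linarith
  have hrp := (chartBall_mono x₀ hrR).trans hRp
  -- Chosen so that `2 * C * ρ = m * (r - ρ)`: for points of the `ρ`-ball, leaving the `r`-ball
  -- costs at least as much as the frozen norm of `y - x`.
  set ρ := m * r / (m + 2 * C) with hρ_def
  have hρ : 0 < ρ := by positivity
  have hρe : ρ * (m + 2 * C) = m * r := by rw [hρ_def]; field_simp
  have hρr : ρ < r := by
    have : 0 < ρ * C := by positivity
    nlinarith
  have hρR : chartBall x₀ ρ ⊆ chartBall x₀ R := chartBall_mono x₀ (hρr.le.trans hrR)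
  have hκ : ∀ x ∈ chartBall x₀ r, ∀ v,
      F.inChart p (x₀, v) ≤ (1 + K * r / m) * F.inChart p (x, v) := fun x hx v => by
    have hxR := chartBall_mono x₀ hrR hx
    have h1 := (abs_le.mp (hKf x₀ hx₀R x hxR v)).2
    have h2 : K * ‖x₀ - x‖ * ‖v‖ ≤ K * r / m * F.inChart p (x, v) := by
      have h3 : ‖x₀ - x‖ ≤ r := by rw [norm_sub_rev]; exact (mem_chartBall.mp hx).1
      have h4 := (hmC x hxR v).1
      calc K * ‖x₀ - x‖ * ‖v‖ ≤ K * r * ‖v‖ := by gcongr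
        _ = K * r / m * (m * ‖v‖) := by field_simp
        _ ≤ _ := by gcongr
    linarith
  refine ⟨ρ, hρ, hρR.trans hRp, fun x hx y hy => ?_⟩
  have hxρ := (mem_chartBall.mp hx).1
  have hyρ := (mem_chartBall.mp hy).1
  have hxt := hRp (hρR hx)
  have hyt := hRp (hρR hy)
  have hconv : ∀ t ∈ Icc (0 : ℝ) 1, x + t • (y - x) ∈ chartBall x₀ r := fun t ht =>
    chartBall_mono x₀ hρr.le ((convex_chartBall x₀ ρ).add_smul_sub_mem hx hy ht)
  have hup : F.dist (φ.symm x) (φ.symm y) ≤ F.inChart p (x₀, y - x) + ε * ‖y - x‖ := by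
    obtain ⟨L, hL, hc⟩ := F.exists_hasCurve_segment (p := p) (x := x) (y := y)
      (B := F.inChart p (x₀, y - x) + ε * ‖y - x‖) (fun t ht => hrp (hconv t ht)) fun t ht => by
        have h1 := (abs_le.mp (hKf _ (chartBall_mono x₀ hrR (hconv t ht)) x₀ hx₀R (y - x))).2
        have h2 := (mem_chartBall.mp (hconv t ht)).1
        have h3 : K * ‖x + t • (y - x) - x₀‖ * ‖y - x‖ ≤ ε * ‖y - x‖ := by
          refine mul_le_mul_of_nonneg_right (le_trans ?_ hrε.1) (norm_nonneg _)
          gcongr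
        linarith
    exact hc.dist_le.trans hL
  have hlow : F.inChart p (x₀, y - x) ≤ (1 + K * r / m) * F.dist (φ.symm x) (φ.symm y) := by
    rw [mul_comm, ← div_le_iff₀ (by positivity)]
    refine le_csInf (F.exists_hasCurve _ _) fun L hL => ?_
    rw [div_le_iff₀ (by positivity), mul_comm]
    refine F.le_mul_of_hasCurve hrp (F.isMinkowskiNorm_inChart p hx₀) hm (by positivity)
      (fun v => (hmC x₀ hx₀R v).1) hκ hL (φ.map_target hxt) ?_ ?_ ?_
    · change ‖φ (φ.symm x) - x₀‖ < r
      rw [φ.right_inv hxt]; exact hxρ.trans_lt hρr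
    · change _ ≤ m * (r - ‖φ (φ.symm x) - x₀‖)
      rw [φ.right_inv hxt]
      have h1 := (hmC x₀ hx₀R (y - x)).2
      have h2 : ‖y - x‖ ≤ 2 * ρ := by
        have := norm_sub_le (y - x₀) (x - x₀)
        rw [sub_sub_sub_cancel_right] at this
        linarith
      have h3 : C * ‖y - x‖ ≤ C * (2 * ρ) := by gcongr
      have h4 : m * ‖x - x₀‖ ≤ m * ρ := by gcongr
      linarith
    · intro _
      change _ ≤ F.inChart p (x₀, φ (φ.symm y) - φ (φ.symm x))
      rw [φ.right_inv hxt, φ.right_inv hyt]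
  have hdC : F.dist (φ.symm x) (φ.symm y) ≤ C' * ‖y - x‖ := by
    obtain ⟨L, hL, hc⟩ := hcurve x (hρR hx) y (hρR hy)
    exact hc.dist_le.trans hL
  have h5 : K * r / m * F.dist (φ.symm x) (φ.symm y) ≤ ε * ‖y - x‖ := by
    calc _ ≤ K * r / m * (C' * ‖y - x‖) := by gcongr
      _ = K * r / m * C' * ‖y - x‖ := by ring
      _ ≤ _ := mul_le_mul_of_nonneg_right hrε.2 (norm_nonneg _)
  rw [abs_le]
  constructor <;> linarith

theorem isLocalDist_inChart [T2Space M] [PreconnectedSpace M] (F : FinslerFunction n M) {p : M}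
    {x₀ : EuclideanSpace ℝ (Fin n)} (hx₀ : x₀ ∈ range (𝓡∂ n)) {r : ℝ} (hr : 0 < r)
    (hrp : chartBall x₀ r ⊆ (extChartAt (𝓡∂ n) p).target) :
    IsLocalDist (chartBall x₀ r) (F.inChart p) fun x y =>
      F.dist ((extChartAt (𝓡∂ n) p).symm x) ((extChartAt (𝓡∂ n) p).symm y) where
  triangle x _ y _ z _ := F.dist_triangle _ _ _
  le := by
    obtain ⟨C, hC, h⟩ := F.exists_hasCurve_le hx₀ hr hrp
    refine ⟨C, hC, fun x hx y hy => ?_⟩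
    obtain ⟨L, hL, hc⟩ := h x hx y hy
    rw [abs_of_nonneg (F.dist_nonneg _ _)]
    exact hc.dist_le.trans hL
  asymp := by
    intro x₁ hx₁ ε hε
    obtain ⟨ρ, hρ, -, h⟩ := F.exists_abs_dist_sub_le (hrp hx₁) hε
    exact ⟨ρ, hρ, fun x hx y hy hxρ hyρ => h x (mem_chartBall.mpr ⟨hxρ.le, hx.2⟩) y
      (mem_chartBall.mpr ⟨hyρ.le, hy.2⟩)⟩

/-- The distance dominates the norm in small chart balls. -/
theorem exists_le_dist [T2Space M] [PreconnectedSpace M] (F : FinslerFunction n M) {p : M}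
    {x₀ : EuclideanSpace ℝ (Fin n)} (hx₀ : x₀ ∈ (extChartAt (𝓡∂ n) p).target) :
    ∃ m > 0, ∃ ρ > 0, chartBall x₀ ρ ⊆ (extChartAt (𝓡∂ n) p).target ∧
      ∀ x ∈ chartBall x₀ ρ, ∀ y ∈ chartBall x₀ ρ,
      m * ‖y - x‖ ≤ F.dist ((extChartAt (𝓡∂ n) p).symm x) ((extChartAt (𝓡∂ n) p).symm y) := by
  obtain ⟨R, hR, hRp⟩ := exists_chartBall_subset_target hx₀
  have hx₀r := extChartAt_target_subset_range p hx₀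
  obtain ⟨m, C, hm, hC, hmC⟩ := (F.isFinslerFamily_inChart hx₀r hR hRp).exists_bounds
  obtain ⟨ρ, hρ, hρt, h⟩ := F.exists_abs_dist_sub_le hx₀ (half_pos hm)
  refine ⟨m / 2, half_pos hm, ρ, hρ, hρt, fun x hx y hy => ?_⟩
  have h1 := (abs_le.mp (h x hx y hy)).1
  have h2 := (hmC x₀ (self_mem_chartBall hx₀r hR.le) (y - x)).1
  linarith

/-- A curve to another point either leaves a fixed chart ball or covers a fixed nonzero coordinate
displacement; both cost a positive amount. -/
theorem eq_of_dist_eq_zero [T2Space M] [PreconnectedSpace M] (F : FinslerFunction n M) {x y : M}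
    (h : F.dist x y = 0) : x = y := by
  by_contra hne
  set φ := extChartAt (𝓡∂ n) x
  have hx := mem_extChartAt_source (I := 𝓡∂ n) x
  have hxt := mem_extChartAt_target (I := 𝓡∂ n) x
  have hxr := extChartAt_target_subset_range x hxt
  obtain ⟨R, hR, hRp⟩ := exists_chartBall_subset_target hxt
  have hxR := self_mem_chartBall hxr hR.le
  obtain ⟨m, C, hm, hC, hmC⟩ := (F.isFinslerFamily_inChart hxr hR hRp).exists_bounds
  have hκ : ∀ z ∈ chartBall (φ x) R, ∀ v,
      F.inChart x (φ x, v) ≤ C / m * F.inChart x (z, v) := fun z hz v => by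
    have h1 := (hmC _ hxR v).2
    have h2 := (hmC z hz v).1
    calc F.inChart x (φ x, v) ≤ C / m * (m * ‖v‖) := by field_simp; exact h1
      _ ≤ _ := by gcongr
  have hpos : ∃ B > 0, B ≤ m * R ∧ (y ∈ φ.source → B ≤ F.inChart x (φ x, φ y - φ x)) := by
    by_cases hy : y ∈ φ.source
    · have h1 : φ y - φ x ≠ 0 := sub_ne_zero.mpr fun h => hne (φ.injOn hy hx h).symm
      have h2 := (F.isMinkowskiNorm_inChart x hxt).pos h1
      exact ⟨min (m * R) _, lt_min (by positivity) h2, min_le_left _ _, fun _ => min_le_right _ _⟩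
    · exact ⟨m * R, by positivity, le_rfl, fun h => absurd h hy⟩
  obtain ⟨B, hB, hBR, hBy⟩ := hpos
  have hlow : B / (C / m) ≤ F.dist x y := by
    refine le_csInf (F.exists_hasCurve _ _) fun L hL => ?_
    rw [div_le_iff₀ (by positivity), mul_comm]
    refine F.le_mul_of_hasCurve hRp (F.isMinkowskiNorm_inChart x hxt) hm (by positivity)
      (fun v => (hmC _ hxR v).1) hκ hL hx ?_ ?_ hBy
    · change ‖φ x - φ x‖ < R
      simpa using hR
    · change B ≤ m * (R - ‖φ x - φ x‖)
      simpa using hBR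
  have : 0 < B / (C / m) := by positivity
  linarith

/-- The distance of a compact Finsler manifold is reversible up to a constant. -/
theorem exists_dist_le_mul_dist_swap [T2Space M] [CompactSpace M] [PreconnectedSpace M]
    (F : FinslerFunction n M) : ∃ Λ > 0, ∀ x y, F.dist y x ≤ Λ * F.dist x y := by
  -- Near the diagonal both distances are comparable with the coordinate norm; away from it the
  -- distance is positive and continuity suffices. Compactness of `M × M` then leaves finitely many
  -- constants, dominated by their sum.
  have key : ∀ z : M × M, ∃ t ∈ 𝓝 z, ∃ Λ > 0, ∀ w ∈ t, F.dist w.2 w.1 ≤ Λ * F.dist w.1 w.2 := by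
    rintro ⟨p, q⟩
    rcases eq_or_ne p q with rfl | hpq
    · set φ := extChartAt (𝓡∂ n) p
      have hpt := mem_extChartAt_target (I := 𝓡∂ n) p
      obtain ⟨m, hm, ρ, hρ, hρt, h⟩ := F.exists_le_dist hpt
      obtain ⟨C, hC, h'⟩ := F.exists_hasCurve_le (extChartAt_target_subset_range p hpt) hρ hρt
      have hev := eventually_mem_chartBall (mem_extChartAt_source (I := 𝓡∂ n) p) hρ
      refine ⟨_, by rw [nhds_prod_eq]; exact hev.prod_mk hev, C / m, by positivity, ?_⟩
      rintro ⟨x, y⟩ ⟨⟨hx, hxρ⟩, hy, hyρ⟩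
      have h1 := h _ hxρ _ hyρ
      obtain ⟨L, hL, hc⟩ := h' _ hyρ _ hxρ
      have h2 := hc.dist_le.trans hL
      rw [φ.left_inv hx, φ.left_inv hy] at h1 h2
      calc F.dist y x ≤ C / m * (m * ‖φ y - φ x‖) := by
            rw [norm_sub_rev]; field_simp; exact h2
        _ ≤ _ := by gcongr
    · have hpos : 0 < F.dist p q :=
        (F.dist_nonneg p q).lt_of_ne fun h => hpq (F.eq_of_dist_eq_zero h.symm)
      have h0 := F.dist_nonneg q p
      have hc1 := F.continuous_dist.continuousAt (x := (p, q))
      have hc2 : Continuous fun w : M × M => F.dist w.2 w.1 := F.continuous_dist.comp continuous_swap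
      have hlt : F.dist q p < (F.dist q p + 1) / F.dist p q * F.dist p q := by
        rw [div_mul_cancel₀ _ hpos.ne']; linarith
      exact ⟨_, hc2.continuousAt.eventually_lt (hc1.const_mul _) hlt, _, by positivity,
        fun w hw => le_of_lt hw⟩
  choose! t ht Λ hΛ h using key
  obtain ⟨s, hs⟩ := CompactSpace.elim_nhds_subcover t ht
  have hsum : ∀ z ∈ s, Λ z ≤ ∑ z ∈ s, Λ z + 1 := fun z hz =>
    (Finset.single_le_sum (fun z _ => (hΛ z).le) hz).trans (by linarith)
  refine ⟨∑ z ∈ s, Λ z + 1, by have := Finset.sum_nonneg fun z (_ : z ∈ s) => (hΛ z).le; linarith,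
    fun x y => ?_⟩
  have hxy : (x, y) ∈ ⋃ z ∈ s, t z := hs ▸ mem_univ _
  simp only [mem_iUnion] at hxy
  obtain ⟨z, hz, hxy⟩ := hxy
  exact (h z _ hxy).trans (mul_le_mul_of_nonneg_right (hsum z hz) (F.dist_nonneg x y))

end FinslerFunction

/-! ### Minimizers -/

namespace FinslerFunction

variable {n : ℕ} [NeZero n] {M : Type*} [TopologicalSpace M]
  [ChartedSpace (EuclideanHalfSpace n) M] [IsManifold (𝓡∂ n) ∞ M]

theorem tendsto_dist [PreconnectedSpace M] (F : FinslerFunction n M) {ι : Type*} {l : Filter ι}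
    {u v : ι → M} {p q : M} (hu : Filter.Tendsto u l (𝓝 p)) (hv : Filter.Tendsto v l (𝓝 q)) :
    Filter.Tendsto (fun i => F.dist (u i) (v i)) l (𝓝 (F.dist p q)) := by
  have h1 : Filter.Tendsto (fun i => (u i, v i)) l (𝓝 (p, q)) := hu.prodMk_nhds hv
  have h2 := F.continuous_dist.tendsto (p, q)
  have h3 := h2.comp h1
  exact h3

/-- On the compact complement of a neighbourhood of `q` the distance to `q` has a positive minimum.
-/
theorem tendsto_of_tendsto_dist [T2Space M] [CompactSpace M] [PreconnectedSpace M]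
    (F : FinslerFunction n M) {ι : Type*} {l : Filter ι} {u : ι → M} {q : M}
    (h : Filter.Tendsto (fun i => F.dist (u i) q) l (𝓝 0)) : Filter.Tendsto u l (𝓝 q) := by
  have hc : Continuous fun y => F.dist y q :=
    F.continuous_dist.comp (continuous_id.prodMk continuous_const)
  rw [tendsto_nhds]
  intro O hO hq
  rcases Oᶜ.eq_empty_or_nonempty with hO' | hO'
  · rw [compl_empty_iff] at hO'
    simp [hO']
  · obtain ⟨y, hy, hmin⟩ := hO.isClosed_compl.isCompact.exists_isMinOn hO' hc.continuousOn
    have hpos : 0 < F.dist y q := (F.dist_nonneg y q).lt_of_ne fun h0 =>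
      hy (F.eq_of_dist_eq_zero h0.symm ▸ hq)
    filter_upwards [h.eventually_lt_const hpos] with i hi
    by_contra hi'
    exact hi.not_ge (hmin hi')

/-- Take a curve that is longer than the distance by less than `ε`, and let `σ s` be its first point
at distance `s` from `x`. Every part of the curve is then almost shortest, since an excess on one
part is an excess of the whole. Parametrizing by distance instead of arc length avoids
reparametrizing curves. -/
theorem exists_approx_minimizer [PreconnectedSpace M] (F : FinslerFunction n M) (x z : M) {ε : ℝ}
    (hε : 0 < ε) : ∃ σ : ℝ → M, ∀ s ∈ Icc 0 (F.dist x z), F.dist x (σ s) = s ∧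
      F.dist (σ s) z ≤ F.dist x z - s + ε ∧
      ∀ t ∈ Icc s (F.dist x z), F.dist (σ s) (σ t) ≤ t - s + ε := by
  set D := F.dist x z with hD
  obtain ⟨_, hLD, a, b, c, hab, hc, rfl, rfl, rfl⟩ :=
    F.exists_hasCurve_lt x z (lt_add_of_pos_right (F.dist x z) hε)
  have hg : ContinuousOn (fun t => F.dist (c a) (c t)) (Icc a b) :=
    F.continuous_dist.comp_continuousOn (continuousOn_const.prodMk hc.1)
  have hleast : ∀ s ∈ Icc 0 D, ∃ τ, IsLeast {t ∈ Icc a b | s ≤ F.dist (c a) (c t)} τ :=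
    fun s hs => by
      refine IsCompact.exists_isLeast ?_ ⟨b, right_mem_Icc.mpr hab, hs.2⟩
      exact isCompact_Icc.of_isClosed_subset
        (hg.preimage_isClosed_of_isClosed isClosed_Icc isClosed_Ici) (sep_subset _ _)
  choose! τ hτ using hleast
  have hτab : ∀ s ∈ Icc 0 D, τ s ∈ Icc a b := fun s hs => (hτ s hs).1.1
  have hτeq : ∀ s ∈ Icc 0 D, F.dist (c a) (c (τ s)) = s := fun s hs => by
    refine le_antisymm ?_ (hτ s hs).1.2
    by_contra! hlt
    have h1 : s ∈ Icc (F.dist (c a) (c a)) (F.dist (c a) (c (τ s))) := by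
      rw [F.dist_self]; exact ⟨hs.1, hlt.le⟩
    obtain ⟨t, ht, hts⟩ := intermediate_value_Icc (hτab s hs).1
      (hg.mono (Icc_subset_Icc_right (hτab s hs).2)) h1
    have h2 : τ s ≤ t := (hτ s hs).2 ⟨⟨ht.1, ht.2.trans (hτab s hs).2⟩, hts.ge⟩
    obtain rfl := le_antisymm ht.2 h2
    exact hlt.ne' hts
  have hlen : ∀ s t, a ≤ s → s ≤ t → t ≤ b → F.dist (c s) (c t) ≤ F.length c s t :=
    fun s t h1 h2 h3 => F.dist_le_length h2 (hc.mono h1 h2 h3)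
  refine ⟨fun s => c (τ s), fun s hs => ⟨hτeq s hs, ?_, fun t ht => ?_⟩⟩
  · have h1 := F.length_add hc (hτab s hs).1 (hτab s hs).2
    have h2 := hlen a (τ s) le_rfl (hτab s hs).1 (hτab s hs).2
    have h3 := hlen (τ s) b (hτab s hs).1 (hτab s hs).2 le_rfl
    rw [hτeq s hs] at h2
    linarith
  · have ht' : t ∈ Icc 0 D := ⟨hs.1.trans ht.1, ht.2⟩
    have hst : τ s ≤ τ t := (hτ s hs).2 ⟨hτab t ht', ht.1.trans (hτeq t ht').ge⟩
    have h1 := F.length_add hc (hτab t ht').1 (hτab t ht').2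
    have h2 := F.length_add (hc.mono le_rfl (hτab t ht').1 (hτab t ht').2) (hτab s hs).1 hst
    have h3 := hlen a (τ s) le_rfl (hτab s hs).1 (hτab s hs).2
    have h4 := hlen (τ s) (τ t) (hτab s hs).1 hst (hτab t ht').2
    have h5 := hlen (τ t) b (hτab t ht').1 (hτab t ht').2 le_rfl
    have h6 := F.dist_triangle (c a) (c (τ t)) (c b)
    rw [hτeq s hs] at h3
    rw [hτeq t ht'] at h6
    linarith

/-- Any two points of a compact connected Finsler manifold are joined by a minimizer. -/
theorem exists_minimizer [T2Space M] [CompactSpace M] [PreconnectedSpace M]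
    (F : FinslerFunction n M) (x z : M) : ∃ γ : ℝ → M, γ 0 = x ∧ γ (F.dist x z) = z ∧
      ∀ s t, 0 ≤ s → s ≤ t → t ≤ F.dist x z → F.dist (γ s) (γ t) = t - s := by
  set D := F.dist x z with hD
  have hD0 : 0 ≤ D := F.dist_nonneg x z
  have hex : ∀ k : ℕ, ∃ σ : ℝ → M, ∀ s ∈ Icc 0 D, F.dist x (σ s) = s ∧
      F.dist (σ s) z ≤ D - s + 1 / ((k : ℝ) + 1) ∧
      ∀ t ∈ Icc s D, F.dist (σ s) (σ t) ≤ t - s + 1 / ((k : ℝ) + 1) :=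
    fun k => F.exists_approx_minimizer x z (by positivity)
  clear_value D
  choose σ hσ using hex
  -- Along an ultrafilter all the points `σ k s` converge at once in the compact space `M`, with no
  -- equicontinuity or choice of subsequences.
  obtain ⟨l, hl⟩ : ∃ l : Ultrafilter ℕ, (l : Filter ℕ) ≤ Filter.atTop :=
    ⟨Filter.hyperfilter ℕ, Nat.hyperfilter_le_atTop⟩
  have hlim : ∀ s, ∃ q, Filter.Tendsto (fun k => σ k s) l (𝓝 q) := fun s => by
    obtain ⟨q, -, hq⟩ := isCompact_univ.ultrafilter_le_nhds (l.map fun k => σ k s) (by simp)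
    exact ⟨q, hq⟩
  choose γ hγ using hlim
  have hε : Filter.Tendsto (fun k : ℕ => 1 / ((k : ℝ) + 1)) l (𝓝 0) :=
    tendsto_one_div_add_atTop_nhds_zero_nat.mono_left hl
  have hx : ∀ s ∈ Icc 0 D, F.dist x (γ s) = s := fun s hs =>
    tendsto_nhds_unique (F.tendsto_dist tendsto_const_nhds (hγ s))
      (tendsto_const_nhds.congr fun k => (hσ k s hs).1.symm)
  have hz : F.dist (γ D) z ≤ 0 := by
    have h1 := (tendsto_const_nhds (x := D - D)).add hε
    rw [sub_self, add_zero] at h1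
    refine le_of_tendsto_of_tendsto' (F.tendsto_dist (hγ D) tendsto_const_nhds) h1 fun k => ?_
    simpa using (hσ k D ⟨hD0, le_rfl⟩).2.1
  have hle : ∀ s t, 0 ≤ s → s ≤ t → t ≤ D → F.dist (γ s) (γ t) ≤ t - s := fun s t h0 hst ht => by
    have h1 := (tendsto_const_nhds (x := t - s)).add hε
    rw [add_zero] at h1
    exact le_of_tendsto_of_tendsto' (F.tendsto_dist (hγ s) (hγ t)) h1 fun k =>
      (hσ k s ⟨h0, hst.trans ht⟩).2.2 t ⟨hst, ht⟩
  refine ⟨γ, (F.eq_of_dist_eq_zero (hx 0 ⟨le_rfl, hD0⟩)).symm,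
    F.eq_of_dist_eq_zero (le_antisymm hz (F.dist_nonneg _ _)), fun s t h0 hst ht =>
    le_antisymm (hle s t h0 hst ht) ?_⟩
  have h1 := F.dist_triangle x (γ s) (γ t)
  rw [hx s ⟨h0, hst.trans ht⟩, hx t ⟨h0.trans hst, ht⟩] at h1
  linarith

/-- Minimizers may be extended to continuous curves that are Lipschitz for the distance. -/
theorem exists_continuous_minimizer [T2Space M] [CompactSpace M] [PreconnectedSpace M]
    (F : FinslerFunction n M) (x z : M) : ∃ γ : ℝ → M, γ 0 = x ∧ γ (F.dist x z) = z ∧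
      (∀ s t, 0 ≤ s → s ≤ t → t ≤ F.dist x z → F.dist (γ s) (γ t) = t - s) ∧
      Continuous γ ∧ ∃ K : NNReal, ∀ s t, F.dist (γ s) (γ t) ≤ K * |s - t| := by
  obtain ⟨γ, h0, h1, h⟩ := F.exists_minimizer x z
  set D := F.dist x z with hD
  have hD0 : 0 ≤ D := F.dist_nonneg x z
  obtain ⟨Λ, hΛ, hrev⟩ := F.exists_dist_le_mul_dist_swap
  -- Distances against the direction of the minimizer are controlled only through the reversibility
  -- constant.
  have hK : ∀ s ∈ Icc 0 D, ∀ t ∈ Icc 0 D, F.dist (γ s) (γ t) ≤ (1 + Λ) * |s - t| :=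
    fun s hs t ht => by
      rcases le_total s t with hst | hst
      · rw [h s t hs.1 hst ht.2, abs_sub_comm, abs_of_nonneg (sub_nonneg.mpr hst)]
        nlinarith
      · refine (hrev _ _).trans ?_
        rw [h t s ht.1 hst hs.2, abs_of_nonneg (sub_nonneg.mpr hst)]
        nlinarith
  have hK' : ∀ s t, F.dist (γ (projIcc 0 D hD0 s)) (γ (projIcc 0 D hD0 t)) ≤
      (1 + Λ) * |s - t| := fun s t =>
    (hK _ (projIcc 0 D hD0 s).2 _ (projIcc 0 D hD0 t).2).trans
      (mul_le_mul_of_nonneg_left (abs_projIcc_sub_projIcc hD0) (by positivity))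
  refine ⟨fun t => γ (projIcc 0 D hD0 t), by simpa using h0, by simpa using h1,
    fun s t hs hst ht => ?_, ?_, ⟨1 + Λ, by positivity⟩, hK'⟩
  · beta_reduce
    rw [projIcc_of_mem hD0 ⟨hs, hst.trans ht⟩, projIcc_of_mem hD0 ⟨hs.trans hst, ht⟩]
    exact h s t hs hst ht
  · rw [continuous_iff_continuousAt]
    intro t
    refine F.tendsto_of_tendsto_dist (squeeze_zero (fun s => F.dist_nonneg _ _)
      (fun s => hK' s t) ?_)
    have : Continuous fun s : ℝ => (1 + Λ) * |s - t| := by fun_prop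
    simpa using this.tendsto t

end FinslerFunction

/-! ### The boundary in charts -/

section

variable {n : ℕ} [NeZero n] {M : Type*} [TopologicalSpace M]
  [ChartedSpace (EuclideanHalfSpace n) M]

theorem mem_interior_chartBall {x₀ x : EuclideanSpace ℝ (Fin n)} {r : ℝ} (hx : ‖x - x₀‖ < r)
    (h0 : 0 < x 0) : x ∈ interior (chartBall x₀ r) := by
  rw [chartBall, interior_inter, interior_range_modelWithCornersEuclideanHalfSpace]
  exact ⟨Metric.ball_subset_interior_closedBall (mem_ball_iff_norm.mpr hx), h0⟩

theorem coord_eq_zero_of_mem_boundary {q : M} (hq : q ∈ (𝓡∂ n).boundary M) :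
    extChartAt (𝓡∂ n) q q 0 = 0 := by
  have h1 := (ModelWithCorners.isBoundaryPoint_iff (I := 𝓡∂ n)).mp hq
  rw [frontier_range_modelWithCornersEuclideanHalfSpace] at h1
  exact Eq.symm h1

theorem exists_delta_chart {γ : ℝ → M} (hγ : Continuous γ) (s : ℝ) {p : M}
    (hp : γ s = p) {r : ℝ} (hr : 0 < r) : ∃ δ > 0, ∀ t, |t - s| ≤ δ →
      γ t ∈ (extChartAt (𝓡∂ n) p).source ∧
      ‖extChartAt (𝓡∂ n) p (γ t) - extChartAt (𝓡∂ n) p p‖ < r := by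
  subst hp
  have h1 := hγ.continuousAt.eventually
    (eventually_mem_chartBall (mem_extChartAt_source (I := 𝓡∂ n) (γ s)) (half_pos hr))
  obtain ⟨δ, hδ, h⟩ := Metric.eventually_nhds_iff.mp h1
  refine ⟨δ / 2, half_pos hδ, fun t ht => ?_⟩
  have h2 := h (y := t) (by rw [Real.dist_eq]; linarith)
  exact ⟨h2.1, (mem_chartBall.mp h2.2).1.trans_lt (half_lt_self hr)⟩

variable [IsManifold (𝓡∂ n) ∞ M]

/-- Being an interior point can be read off in any chart of the atlas, not only in the preferred
chart at the point. -/
theorem coord_pos_of_notMem_boundary {p q : M} (hq : q ∈ (extChartAt (𝓡∂ n) p).source)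
    (hqb : q ∉ (𝓡∂ n).boundary M) : 0 < extChartAt (𝓡∂ n) p q 0 := by
  rw [← ModelWithCorners.compl_interior, notMem_compl_iff] at hqb
  rw [extChartAt_source] at hq
  have h1 := ((𝓡∂ n).isInteriorPoint_iff_of_mem_atlas (n := ∞) (by simp)
    (chart_mem_atlas (EuclideanHalfSpace n) p) hq).mp hqb
  have h2 := interior_mono (extChartAt_target_subset_range (I := 𝓡∂ n) p) h1
  rwa [interior_range_modelWithCornersEuclideanHalfSpace] at h2

theorem symm_mem_boundary_of_coord_eq_zero {p : M} {x : EuclideanSpace ℝ (Fin n)}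
    (hx : x ∈ (extChartAt (𝓡∂ n) p).target) (h0 : x 0 = 0) :
    (extChartAt (𝓡∂ n) p).symm x ∈ (𝓡∂ n).boundary M := by
  have hq := (extChartAt (𝓡∂ n) p).map_target hx
  by_contra h
  have := coord_pos_of_notMem_boundary hq h
  rw [(extChartAt (𝓡∂ n) p).right_inv hx, h0] at this
  exact this.false

end

namespace FinslerFunction

variable {n : ℕ} [NeZero n] {M : Type*} [TopologicalSpace M]
  [ChartedSpace (EuclideanHalfSpace n) M] [IsManifold (𝓡∂ n) ∞ M]

/-- A minimizer of the distance is a local minimizer in charts. -/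
theorem isLocalMinimizer_inChart (F : FinslerFunction n M) {p : M}
    {x₀ : EuclideanSpace ℝ (Fin n)} {r m a b : ℝ} {K : NNReal} (hm : 0 < m)
    (hle : ∀ x ∈ chartBall x₀ r, ∀ y ∈ chartBall x₀ r, m * ‖y - x‖ ≤
      F.dist ((extChartAt (𝓡∂ n) p).symm x) ((extChartAt (𝓡∂ n) p).symm y))
    {γ : ℝ → M} (hab : a ≤ b) (hK : ∀ s t, F.dist (γ s) (γ t) ≤ K * |s - t|)
    (hγ : ∀ s t, a ≤ s → s ≤ t → t ≤ b → F.dist (γ s) (γ t) = t - s)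
    (hs : ∀ t ∈ Icc a b, γ t ∈ (extChartAt (𝓡∂ n) p).source)
    (hr : ∀ t ∈ Icc a b, ‖extChartAt (𝓡∂ n) p (γ t) - x₀‖ < r)
    (hint : ∀ t ∈ Ico a b, γ t ∉ (𝓡∂ n).boundary M) :
    IsLocalMinimizer (chartBall x₀ r)
      (fun x y => F.dist ((extChartAt (𝓡∂ n) p).symm x) ((extChartAt (𝓡∂ n) p).symm y))
      (fun t => extChartAt (𝓡∂ n) p (γ (projIcc a b hab t))) a b := by
  set φ := extChartAt (𝓡∂ n) p
  have hmem : ∀ t ∈ Icc a b, φ (γ t) ∈ chartBall x₀ r := fun t ht => mem_chartBall.mpr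
    ⟨(hr t ht).le, extChartAt_target_subset_range p (φ.map_source (hs t ht))⟩
  refine ⟨⟨K / m.toNNReal, LipschitzWith.of_dist_le_mul fun s t => ?_⟩, fun t _ =>
    hmem _ (projIcc a b hab t).2, fun t ht => ?_, fun s t h1 h2 h3 => ?_⟩
  · have h1 := hle _ (hmem _ (projIcc a b hab t).2) _ (hmem _ (projIcc a b hab s).2)
    rw [φ.left_inv (hs _ (projIcc a b hab t).2), φ.left_inv (hs _ (projIcc a b hab s).2)] at h1
    have h2 := hK (projIcc a b hab t) (projIcc a b hab s)
    have h3 : (K : ℝ) * |(projIcc a b hab t : ℝ) - projIcc a b hab s| ≤ K * |t - s| :=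
      mul_le_mul_of_nonneg_left (abs_projIcc_sub_projIcc hab) K.2
    rw [dist_eq_norm, Real.dist_eq, NNReal.coe_div, Real.coe_toNNReal m hm.le, div_mul_eq_mul_div,
      le_div_iff₀ hm, mul_comm, abs_sub_comm]
    exact h1.trans (h2.trans h3)
  · have ht' := Ico_subset_Icc_self ht
    rw [projIcc_of_mem hab ht']
    exact mem_interior_chartBall (hr t ht')
      (coord_pos_of_notMem_boundary (hs t ht') (hint t ht))
  · have hs' : s ∈ Icc a b := ⟨h1, h2.trans h3⟩
    have ht' : t ∈ Icc a b := ⟨h1.trans h2, h3⟩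
    rw [projIcc_of_mem hab hs', projIcc_of_mem hab ht', φ.left_inv (hs _ hs'),
      φ.left_inv (hs _ ht')]
    exact hγ s t h1 h2 h3

/-- Minimizers that coincide on an interval and stay away from the boundary coincide a bit
further. -/
theorem exists_eqOn_left_of_notMem_boundary [T2Space M] [PreconnectedSpace M]
    (F : FinslerFunction n M) {γ₁ γ₂ : ℝ → M} {D s : ℝ} {K₁ K₂ : NNReal}
    (hc₁ : Continuous γ₁) (hc₂ : Continuous γ₂)
    (hK₁ : ∀ s t, F.dist (γ₁ s) (γ₁ t) ≤ K₁ * |s - t|)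
    (hK₂ : ∀ s t, F.dist (γ₂ s) (γ₂ t) ≤ K₂ * |s - t|)
    (hγ₁ : ∀ s t, 0 ≤ s → s ≤ t → t ≤ D → F.dist (γ₁ s) (γ₁ t) = t - s)
    (hγ₂ : ∀ s t, 0 ≤ s → s ≤ t → t ≤ D → F.dist (γ₂ s) (γ₂ t) = t - s)
    (hb₁ : ∀ t ∈ Ico 0 D, γ₁ t ∉ (𝓡∂ n).boundary M)
    (hb₂ : ∀ t ∈ Ico 0 D, γ₂ t ∉ (𝓡∂ n).boundary M)
    (hs0 : 0 < s) (hsD : s < D) (heq : EqOn γ₁ γ₂ (Icc s D)) :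
    ∃ a ∈ Ico 0 s, EqOn γ₁ γ₂ (Icc a D) := by
  set p := γ₁ s with hp
  have hp₂ : γ₂ s = p := (heq (left_mem_Icc.mpr hsD.le)).symm
  set φ := extChartAt (𝓡∂ n) p
  have hpt := mem_extChartAt_target (I := 𝓡∂ n) p
  obtain ⟨m, hm, r, hr, hrt, hle⟩ := F.exists_le_dist hpt
  have hpr := extChartAt_target_subset_range p hpt
  obtain ⟨δ₁, hδ₁, h₁⟩ := exists_delta_chart (n := n) hc₁ s hp.symm hr
  obtain ⟨δ₂, hδ₂, h₂⟩ := exists_delta_chart (n := n) hc₂ s hp₂ hr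
  obtain ⟨δ, hδ, hδ1, hδ2, hδ3, hδ4⟩ : ∃ δ > 0, δ ≤ δ₁ ∧ δ ≤ δ₂ ∧ δ ≤ s ∧ δ ≤ D - s :=
    ⟨min (min δ₁ δ₂) (min s (D - s)), by have := sub_pos.mpr hsD; positivity, by simp, by simp,
      by simp, by simp⟩
  have hab : s - δ ≤ s + δ := by linarith
  have habs : ∀ t ∈ Icc (s - δ) (s + δ), |t - s| ≤ δ := fun t ht =>
    abs_le.mpr ⟨by linarith [ht.1], by linarith [ht.2]⟩
  have hm₁ := F.isLocalMinimizer_inChart hm hle hab hK₁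
    (fun u v h1 h2 h3 => hγ₁ u v (by linarith) h2 (by linarith))
    (fun t ht => (h₁ t ((habs t ht).trans hδ1)).1) (fun t ht => (h₁ t ((habs t ht).trans hδ1)).2)
    (fun t ht => hb₁ t ⟨by linarith [ht.1], by linarith [ht.2]⟩)
  have hm₂ := F.isLocalMinimizer_inChart hm hle hab hK₂
    (fun u v h1 h2 h3 => hγ₂ u v (by linarith) h2 (by linarith))
    (fun t ht => (h₂ t ((habs t ht).trans hδ2)).1) (fun t ht => (h₂ t ((habs t ht).trans hδ2)).2)
    (fun t ht => hb₂ t ⟨by linarith [ht.1], by linarith [ht.2]⟩)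
  -- The chart curves agree on the right half of `[s - δ, s + δ]`, and unique continuation gives the
  -- left half.
  have key := hm₁.eqOn_of_eqOn_Icc (F.isFinslerFamily_inChart hpr hr hrt)
    (F.isLocalDist_inChart hpr hr hrt) hm₂ (s := s) (by linarith) (by linarith) fun t ht => by
      beta_reduce
      rw [projIcc_of_mem hab ⟨by linarith [ht.1], ht.2⟩]
      exact congrArg _ (heq ⟨ht.1, by linarith [ht.2]⟩)
  refine ⟨s - δ, ⟨by linarith, by linarith⟩, fun t ht => ?_⟩
  rcases le_total t s with hts | hts
  · have ht' : t ∈ Icc (s - δ) (s + δ) := ⟨ht.1, by linarith⟩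
    have h3 := key ht'
    beta_reduce at h3
    rw [projIcc_of_mem hab ht'] at h3
    exact φ.injOn (h₁ t ((habs t ht').trans hδ1)).1 (h₂ t ((habs t ht').trans hδ2)).1 h3
  · exact heq ⟨hts, ht.2⟩

/-- Two minimizers from a closest point of the boundary coincide near that point. -/
theorem exists_eqOn_left_of_mem_boundary [T2Space M] [PreconnectedSpace M]
    (F : FinslerFunction n M) {γ₁ γ₂ : ℝ → M} {D : ℝ} {K₁ K₂ : NNReal} {z : M}
    (hz : z ∈ (𝓡∂ n).boundary M) (hz₁ : γ₁ D = z) (hz₂ : γ₂ D = z)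
    (hc₁ : Continuous γ₁) (hc₂ : Continuous γ₂)
    (hK₁ : ∀ s t, F.dist (γ₁ s) (γ₁ t) ≤ K₁ * |s - t|)
    (hK₂ : ∀ s t, F.dist (γ₂ s) (γ₂ t) ≤ K₂ * |s - t|)
    (hγ₁ : ∀ s t, 0 ≤ s → s ≤ t → t ≤ D → F.dist (γ₁ s) (γ₁ t) = t - s)
    (hγ₂ : ∀ s t, 0 ≤ s → s ≤ t → t ≤ D → F.dist (γ₂ s) (γ₂ t) = t - s)
    (hb₁ : ∀ t ∈ Icc 0 D, ∀ z ∈ (𝓡∂ n).boundary M, D - t ≤ F.dist (γ₁ t) z)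
    (hb₂ : ∀ t ∈ Icc 0 D, ∀ z ∈ (𝓡∂ n).boundary M, D - t ≤ F.dist (γ₂ t) z) (hD : 0 < D) :
    ∃ a ∈ Ico 0 D, EqOn γ₁ γ₂ (Icc a D) := by
  set φ := extChartAt (𝓡∂ n) z
  have hzt := mem_extChartAt_target (I := 𝓡∂ n) z
  have hz0 : φ z 0 = 0 := coord_eq_zero_of_mem_boundary hz
  obtain ⟨m, hm, r, hr, hrt, hle⟩ := F.exists_le_dist hzt
  have hzr := extChartAt_target_subset_range z hzt
  obtain ⟨δ₁, hδ₁, h₁⟩ := exists_delta_chart (n := n) hc₁ D hz₁ (half_pos hr)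
  obtain ⟨δ₂, hδ₂, h₂⟩ := exists_delta_chart (n := n) hc₂ D hz₂ (half_pos hr)
  obtain ⟨δ, hδ, hδ1, hδ2, hδ3⟩ : ∃ δ > 0, δ ≤ δ₁ ∧ δ ≤ δ₂ ∧ δ ≤ D :=
    ⟨min (min δ₁ δ₂) D, by positivity, by simp, by simp, by simp⟩
  have hab : D - δ ≤ D := by linarith
  have habs : ∀ t ∈ Icc (D - δ) D, |t - D| ≤ δ := fun t ht =>
    abs_le.mpr ⟨by linarith [ht.1], by linarith [ht.2]⟩
  have hn₁ : ∀ t ∈ Ico (D - δ) D, γ₁ t ∉ (𝓡∂ n).boundary M := fun t ht h => by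
    have := hb₁ t ⟨by linarith [ht.1], ht.2.le⟩ _ h
    rw [F.dist_self] at this
    linarith [ht.2]
  have hn₂ : ∀ t ∈ Ico (D - δ) D, γ₂ t ∉ (𝓡∂ n).boundary M := fun t ht h => by
    have := hb₂ t ⟨by linarith [ht.1], ht.2.le⟩ _ h
    rw [F.dist_self] at this
    linarith [ht.2]
  have hm₁ := F.isLocalMinimizer_inChart hm hle hab hK₁
    (fun u v h1 h2 h3 => hγ₁ u v (by linarith) h2 (by linarith))
    (fun t ht => (h₁ t ((habs t ht).trans hδ1)).1)
    (fun t ht => (h₁ t ((habs t ht).trans hδ1)).2.trans (half_lt_self hr)) hn₁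
  have hm₂ := F.isLocalMinimizer_inChart hm hle hab hK₂
    (fun u v h1 h2 h3 => hγ₂ u v (by linarith) h2 (by linarith))
    (fun t ht => (h₂ t ((habs t ht).trans hδ2)).1)
    (fun t ht => (h₂ t ((habs t ht).trans hδ2)).2.trans (half_lt_self hr)) hn₂
  set bs := (EuclideanSpace.basisFun (Fin n) ℝ).toBasis with hbs
  have hcoord : ∀ i x, bs.coord i x = x i := fun i x => by simp [hbs]
  have hbsn : ∀ i, ‖bs i‖ = 1 := fun i => by simp [hbs]
  have hbs0 : ∀ i ≠ 0, bs i 0 = 0 := fun i hi => by simp [hbs, hi.symm]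
  have hproj : ∀ t (ht : t ∈ Icc (D - δ) D), (projIcc (D - δ) D hab t : ℝ) = t := fun t ht => by
    rw [projIcc_of_mem hab ht]
  -- Shifting a point of the half-ball parallel to the boundary.
  have hshift : ∀ i ≠ 0, ∀ ε, |ε| ≤ r / (2 * δ) → ∀ t ∈ Icc (D - δ) D,
      ∀ x ∈ range (𝓡∂ n), ‖x - φ z‖ < r / 2 →
      x + (ε * (t - (D - δ))) • bs i ∈ chartBall (φ z) r := by
    intro i hi ε hε t ht x hx hxz
    refine mem_chartBall.mpr ⟨?_, ?_⟩
    · have h1 : ‖(ε * (t - (D - δ))) • bs i‖ ≤ r / 2 := by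
        rw [norm_smul, hbsn, mul_one, Real.norm_eq_abs, abs_mul,
          abs_of_nonneg (by linarith [ht.1] : 0 ≤ t - (D - δ))]
        calc |ε| * (t - (D - δ)) ≤ r / (2 * δ) * δ := by
              gcongr
              · linarith [ht.1]
              · linarith [ht.2]
          _ = r / 2 := by field_simp
      have h2 := norm_add_le (x - φ z) ((ε * (t - (D - δ))) • bs i)
      rw [sub_add_eq_add_sub] at h2
      linarith
    · rw [range_modelWithCornersEuclideanHalfSpace] at hx ⊢
      simpa [hbs0 i hi] using hx
  have hrange : ∀ y ∈ φ.source, φ y ∈ range (𝓡∂ n) := fun y hy =>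
    extChartAt_target_subset_range z (φ.map_source hy)
  have hDmem : D ∈ Icc (D - δ) D := right_mem_Icc.mpr hab
  have haD : D - δ ∈ Icc (D - δ) D := left_mem_Icc.mpr hab
  -- Shifts of the end point parallel to the boundary hyperplane stay in the boundary, where no
  -- point is closer than `z`. This is what the natural boundary condition requires.
  have hend : ∀ i ≠ 0, ∀ ε, |ε| ≤ r / (2 * δ) →
      φ.symm (φ z + (ε * (D - (D - δ))) • bs i) ∈ (𝓡∂ n).boundary M := fun i hi ε hε => by
    refine symm_mem_boundary_of_coord_eq_zero
      (hrt (hshift i hi ε hε D hDmem _ hzr (by simpa using hr))) ?_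
    simp [hbs0 i hi, hz0]
  have key := hm₁.eqOn_of_coord_pos (F.isFinslerFamily_inChart hzr hr hrt)
    (F.isLocalDist_inChart hzr hr hrt) hm₂ (by linarith) bs 0 (ε₀ := r / (2 * δ))
    (by simp only [hproj D hDmem, hz₁, hz₂])
    (by simp only [hproj D hDmem, hz₁, hcoord]; exact hz0)
    (fun t ht => by
      rw [hcoord, hproj t (Ico_subset_Icc_self ht)]
      exact coord_pos_of_notMem_boundary
        (h₁ t ((habs t (Ico_subset_Icc_self ht)).trans hδ1)).1 (hn₁ t ht))
    (fun t ht => by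
      rw [hcoord, hproj t (Ico_subset_Icc_self ht)]
      exact coord_pos_of_notMem_boundary
        (h₂ t ((habs t (Ico_subset_Icc_self ht)).trans hδ2)).1 (hn₂ t ht))
    (by positivity)
    (fun i hi ε hε t ht => by
      rw [hproj t ht]
      have h3 := h₁ t ((habs t ht).trans hδ1)
      exact hshift i hi ε hε t ht _ (hrange _ h3.1) h3.2)
    (fun i hi ε hε t ht => by
      rw [hproj t ht]
      have h3 := h₂ t ((habs t ht).trans hδ2)
      exact hshift i hi ε hε t ht _ (hrange _ h3.1) h3.2)
    (fun i hi ε hε => by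
      rw [hproj _ haD, hproj D hDmem, hz₁, φ.left_inv (h₁ _ ((habs _ haD).trans hδ1)).1]
      exact hb₁ _ ⟨by linarith, hab⟩ _ (hend i hi ε hε))
    (fun i hi ε hε => by
      rw [hproj _ haD, hproj D hDmem, hz₂, φ.left_inv (h₂ _ ((habs _ haD).trans hδ2)).1]
      exact hb₂ _ ⟨by linarith, hab⟩ _ (hend i hi ε hε))
  refine ⟨D - δ, ⟨by linarith, by linarith⟩, fun t ht => ?_⟩
  have h3 := key ht
  beta_reduce at h3
  rw [hproj t ht] at h3
  exact φ.injOn (h₁ t ((habs t ht).trans hδ1)).1 (h₂ t ((habs t ht).trans hδ2)).1 h3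

end FinslerFunction

/-! ### The boundary distance representation -/

namespace FinslerFunction

variable {n : ℕ} [NeZero n] {M : Type*} [TopologicalSpace M]
  [ChartedSpace (EuclideanHalfSpace n) M] [IsManifold (𝓡∂ n) ∞ M]
  [PreconnectedSpace M]

theorem continuous_boundaryDist (F : FinslerFunction n M) (x : M) :
    Continuous (F.boundaryDist x) :=
  F.continuous_dist.comp (continuous_const.prodMk continuous_subtype_val)

variable [T2Space M] [CompactSpace M]

/-- Points with the same boundary distance function coincide. -/
theorem boundaryDist_injective (hbdry : ((𝓡∂ n).boundary M).Nonempty) (F : FinslerFunction n M) :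
    Function.Injective F.boundaryDist := by
  intro x₁ x₂ h
  have hx : ∀ z ∈ (𝓡∂ n).boundary M, F.dist x₁ z = F.dist x₂ z := fun z hz =>
    congrFun h (⟨z, hz⟩ : (𝓡∂ n).boundary M)
  obtain ⟨z₀, hz₀⟩ := hbdry
  have : Nonempty ((𝓡∂ n).boundary M) := ⟨⟨z₀, hz₀⟩⟩
  -- Since the boundary distance functions agree, `z` is a closest boundary point for `x₂` as well,
  -- at the same distance.
  obtain ⟨⟨z, hz⟩, -, hmin⟩ := isCompact_univ.exists_isMinOn univ_nonempty
    (F.continuous_boundaryDist x₁).continuousOn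
  have hmin₁ : ∀ z' ∈ (𝓡∂ n).boundary M, F.dist x₁ z ≤ F.dist x₁ z' := fun z' hz' =>
    hmin (mem_univ (⟨z', hz'⟩ : (𝓡∂ n).boundary M))
  obtain ⟨γ₁, h₁0, h₁D, hγ₁, hc₁, K₁, hK₁⟩ := F.exists_continuous_minimizer x₁ z
  obtain ⟨γ₂, h₂0, h₂D, hγ₂, hc₂, K₂, hK₂⟩ := F.exists_continuous_minimizer x₂ z
  rw [← hx z hz] at h₂D hγ₂
  have hmin₂ : ∀ z' ∈ (𝓡∂ n).boundary M, F.dist x₁ z ≤ F.dist x₂ z' := fun z' hz' =>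
    (hmin₁ z' hz').trans (hx z' hz').le
  have hD0 : 0 ≤ F.dist x₁ z := F.dist_nonneg x₁ z
  generalize F.dist x₁ z = D at *
  -- A boundary point closer to `γ₁ t` than the remaining `D - t` would be closer to `x₁` than `z`.
  -- Applied to `γ₁ t` itself, this keeps the curve off the boundary before time `D`.
  have hb₁ : ∀ t ∈ Icc 0 D, ∀ z ∈ (𝓡∂ n).boundary M, D - t ≤ F.dist (γ₁ t) z :=
    fun t ht z' hz' => by
      have h1 := F.dist_triangle (γ₁ 0) (γ₁ t) z'
      rw [hγ₁ 0 t le_rfl ht.1 ht.2, h₁0] at h1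
      linarith [hmin₁ z' hz']
  have hb₂ : ∀ t ∈ Icc 0 D, ∀ z ∈ (𝓡∂ n).boundary M, D - t ≤ F.dist (γ₂ t) z :=
    fun t ht z' hz' => by
      have h1 := F.dist_triangle (γ₂ 0) (γ₂ t) z'
      rw [hγ₂ 0 t le_rfl ht.1 ht.2, h₂0] at h1
      linarith [hmin₂ z' hz']
  have hn₁ : ∀ t ∈ Ico 0 D, γ₁ t ∉ (𝓡∂ n).boundary M := fun t ht hb => by
    have h1 := hb₁ t (Ico_subset_Icc_self ht) _ hb
    rw [F.dist_self] at h1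
    linarith [ht.2]
  have hn₂ : ∀ t ∈ Ico 0 D, γ₂ t ∉ (𝓡∂ n).boundary M := fun t ht hb => by
    have h1 := hb₂ t (Ico_subset_Icc_self ht) _ hb
    rw [F.dist_self] at h1
    linarith [ht.2]
  -- Continuity argument: the infimum of `S` is attained, and a positive infimum could be lowered,
  -- by the boundary lemma when it equals `D` and by the interior one otherwise.
  set S : Set ℝ := {s ∈ Icc 0 D | EqOn γ₁ γ₂ (Icc s D)}
  have hSD : D ∈ S := ⟨right_mem_Icc.mpr hD0, fun t ht => by
    obtain rfl : t = D := le_antisymm ht.2 ht.1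
    rw [h₁D, h₂D]⟩
  have hSb : BddBelow S := ⟨0, fun s hs => hs.1.1⟩
  have hs0 : 0 ≤ sInf S := le_csInf ⟨D, hSD⟩ fun s hs => hs.1.1
  have hsD : sInf S ≤ D := csInf_le hSb hSD
  have hEq : EqOn γ₁ γ₂ (Icc (sInf S) D) := by
    rcases hsD.eq_or_lt with h1 | h1
    · rw [h1]; exact hSD.2
    · have h2 : EqOn γ₁ γ₂ (Ioc (sInf S) D) := fun t ht => by
        obtain ⟨s, hs, hst⟩ := exists_lt_of_csInf_lt ⟨D, hSD⟩ ht.1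
        exact hs.2 ⟨hst.le, ht.2⟩
      rw [← closure_Ioc h1.ne]
      exact h2.closure hc₁ hc₂
  have hzero : sInf S = 0 := by
    by_contra hne
    have hpos : 0 < sInf S := hs0.lt_of_ne' hne
    obtain ⟨a, ha, haeq⟩ : ∃ a ∈ Ico 0 (sInf S), EqOn γ₁ γ₂ (Icc a D) := by
      rcases hsD.eq_or_lt with h1 | h1
      · rw [h1] at hpos ⊢
        exact F.exists_eqOn_left_of_mem_boundary hz h₁D h₂D hc₁ hc₂ hK₁ hK₂ hγ₁ hγ₂ hb₁ hb₂ hpos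
      · exact F.exists_eqOn_left_of_notMem_boundary hc₁ hc₂ hK₁ hK₂ hγ₁ hγ₂ hn₁ hn₂ hpos h1 hEq
    exact ha.2.not_ge (csInf_le hSb ⟨⟨ha.1, ha.2.le.trans hsD⟩, haeq⟩)
  rw [← h₁0, ← h₂0]
  exact hEq ⟨hzero.le, hD0⟩

/-- The triangle inequality bounds the difference on one side by the distance from `x₁` to `x₂` and
on the other by the reverse distance, which costs the factor `Λ`. -/
theorem exists_norm_boundaryDist_sub_le (F : FinslerFunction n M) :
    ∃ L : ℝ, 0 < L ∧ ∀ x₁ x₂ : M,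
      ‖(⟨F.boundaryDist x₁, F.continuous_boundaryDist x₁⟩ : C((𝓡∂ n).boundary M, ℝ)) -
        ⟨F.boundaryDist x₂, F.continuous_boundaryDist x₂⟩‖ ≤ L * F.dist x₁ x₂ := by
  obtain ⟨Λ, hΛ, hrev⟩ := F.exists_dist_le_mul_dist_swap
  refine ⟨1 + Λ, by positivity, fun x₁ x₂ => ?_⟩
  have h0 := F.dist_nonneg x₁ x₂
  rw [ContinuousMap.norm_le _ (by positivity)]
  intro z
  have h1 := F.dist_triangle x₁ x₂ z
  have h2 := F.dist_triangle x₂ x₁ z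
  have h3 := hrev x₁ x₂
  have h4 : 0 ≤ Λ * F.dist x₁ x₂ := by positivity
  change |F.dist x₁ z - F.dist x₂ z| ≤ _
  rw [abs_le]
  constructor <;> linarith

/-- A continuous injection of a compact space into a Hausdorff space is a closed embedding, so no
estimate for the inverse is needed. -/
theorem isEmbedding_boundaryDist (hbdry : ((𝓡∂ n).boundary M).Nonempty)
    (F : FinslerFunction n M) :
    IsEmbedding fun x : M => (⟨F.boundaryDist x, F.continuous_boundaryDist x⟩ :
      C((𝓡∂ n).boundary M, ℝ)) := by
  refine (Continuous.isClosedEmbedding ?_ fun x y h => ?_).isEmbedding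
  · exact ContinuousMap.continuous_of_continuous_uncurry _
      (F.continuous_dist.comp (continuous_fst.prodMk
        (continuous_subtype_val.comp continuous_snd)))
  · exact F.boundaryDist_injective hbdry (congrArg (fun f : C((𝓡∂ n).boundary M, ℝ) => ⇑f) h)

end FinslerFunction

theorem mainTheorem4 {n : ℕ} [NeZero n] {M : Type*} [TopologicalSpace M]
    [ChartedSpace (EuclideanHalfSpace n) M] [IsManifold (𝓡∂ n) ∞ M]
    [T2Space M] [CompactSpace M] [ConnectedSpace M]
    (hbdry : ((𝓡∂ n).boundary M).Nonempty) (F : FinslerFunction n M) :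
    ∃ hcont : ∀ x : M, Continuous (F.boundaryDist x),
      IsEmbedding (fun x : M => (⟨F.boundaryDist x, hcont x⟩ : C((𝓡∂ n).boundary M, ℝ))) ∧
      ∃ L : ℝ, 0 < L ∧ ∀ x₁ x₂ : M,
        ‖(⟨F.boundaryDist x₁, hcont x₁⟩ : C((𝓡∂ n).boundary M, ℝ)) -
          ⟨F.boundaryDist x₂, hcont x₂⟩‖ ≤ L * F.dist x₁ x₂ :=
  ⟨F.continuous_boundaryDist, F.isEmbedding_boundaryDist hbdry, F.exists_norm_boundaryDist_sub_le⟩
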